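/- Work in $\mathsf{ZF}$ (no choice is assumed; equivalently, the following holds in every model of $\mathsf{ZF}$). Call an uncountable cardinal (initial ordinal) $\kappa$ *weakly Löwenheim–Skolem* (weakly LS) if for all $\gamma<\kappa$, all ordinals $\alpha\ge\kappa$ and all $x\in V_\alpha$ there is an elementary submodel $X\prec V_\alpha$ such that $V_\gamma\subseteq X$, $x\in X$, and the transitive collapse of $X$ belongs to $V_\kappa$. A filter $F$ over a cardinal $\lambda$ is *normal* if it is proper, contains all co-bounded subsets of $\lambda$, and satisfies the following two (equivalent) conditions: (1) for every family $\langle D_\xi : \xi<\lambda\rangle$ of members of $F$, the diagonal intersection $\{\beta<\lambda : \beta\in D_\xi \text{ for all } \xi<\beta\}$ is in $F$; (2) for every $F$-positive $S\subseteq\lambda$ (that is, $S$ meets every member of $F$) and every $f:S\to\lambda$ that is regressive ($f(\beta)<\beta$ for all nonzero $\beta\in S$) there is $\xi<\lambda$ such that $\{\beta\in S : f(\beta)=\xi\}$ is $F$-positive. Let $\kappa$ be a singular weakly LS cardinal and let $\kappa^+$ be the least cardinal greater than $\kappa$. Let $F\subseteq\mathcal P(\kappa^+)$ be the set of all $D\subseteq\kappa^+$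 for which there are an ordinal $\alpha\ge\kappa^+$ and $x\in V_\alpha$ such that $$\{\eta<\kappa^+ : \text{there is } X\prec V_\alpha \text{ with } x\in X \text{ and } \eta=X\cap\kappa^+\}\subseteq D.$$ Then $F$ is a normal filter over $\kappa^+$, and $F$ is definable with parameter $\kappa^+$: there is a formula $\varphi(u,v)$ of the language of set theory, not depending on $\kappa$ or on the model, such that $F=\{D : \varphi(D,\kappa^+)\}$. -/

import Mathlib

/-! The theorem is a theorem of ZF, without the axiom of choice. It is stated for an arbitrary
model `M` of first-order ZF set theory. Every notion below (ordinals, cardinals, the sets `V_α`,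
formulas, satisfaction, elementary submodels, ...) is the usual set-theoretic one, interpreted
inside `M`: all quantifiers range over `M`, and `∊` is the membership relation of `M`. -/

namespace ZFModel

/-- The only symbol of the language of set theory: a binary relation symbol. -/
inductive SetRel : ℕ → Type
  | mem : SetRel 2

/-- The first-order language of set theory. -/
def setLang : FirstOrder.Language.{0, 0} := ⟨fun _ => Empty, SetRel⟩

section Notions

variable {M : Type*} [setLang.Structure M]

/-- The membership relation of the structure `M`. -/
def Mem (a b : M) : Prop :=
  FirstOrder.Language.Structure.RelMap (L := setLang) SetRel.mem ![a, b]

infix:50 " ∊ " => Mem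

/-! ### Basic set theory -/

/-- `a ⊆ b`. -/
def IsSub (a b : M) : Prop := ∀ z, z ∊ a → z ∊ b

/-- `a = ∅`. -/
def IsEmptySet (a : M) : Prop := ∀ z, ¬ z ∊ a

/-- `c = {a, b}`. -/
def IsUPair (c a b : M) : Prop := ∀ z, z ∊ c ↔ z = a ∨ z = b

/-- `c = ⟨a, b⟩ = {{a}, {a, b}}`. -/
def IsOPair (c a b : M) : Prop :=
  ∃ p q, IsUPair p a a ∧ IsUPair q a b ∧ IsUPair c p q

/-- `s = a ∪ {a}`. -/
def IsSucc (s a : M) : Prop := ∀ z, z ∊ s ↔ z ∊ a ∨ z = a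

/-- `⟨a, b⟩ ∈ r`; if `r` is a function, this says `r(a) = b`. -/
def InRel (r a b : M) : Prop := ∃ c, IsOPair c a b ∧ c ∊ r

/-- `f` is a function from `a` to `b`. -/
def IsFun (f a b : M) : Prop :=
  (∀ c, c ∊ f → ∃ x y, x ∊ a ∧ y ∊ b ∧ IsOPair c x y) ∧
  ∀ x, x ∊ a → ∃! y, InRel f x y

/-- `f` is a bijection from `a` onto `b`. -/
def IsBij (f a b : M) : Prop :=
  IsFun f a b ∧ ∀ y, y ∊ b → ∃! x, InRel f x y

end Notions

/-- `M` is a model of Zermelo–Fraenkel set theory (without choice). The schemata of separation and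
replacement are for classes that are first-order definable over `M` with parameters from `M`. -/
structure IsModelZF (M : Type*) [setLang.Structure M] : Prop where
  extensionality : ∀ a b : M, (∀ z, z ∊ a ↔ z ∊ b) → a = b
  foundation : ∀ a : M, (∃ z, z ∊ a) → ∃ z, z ∊ a ∧ ∀ y, y ∊ a → ¬ y ∊ z
  pairing : ∀ a b : M, ∃ c, IsUPair c a b
  union : ∀ a : M, ∃ u, ∀ z, z ∊ u ↔ ∃ y, y ∊ a ∧ z ∊ y
  powerset : ∀ a : M, ∃ p, ∀ z, z ∊ p ↔ IsSub z a
  infinity : ∃ w : M, (∃ e, IsEmptySet e ∧ e ∊ w) ∧ ∀ x, x ∊ w → ∃ s, IsSucc s x ∧ s ∊ w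
  separation : ∀ S : Set M, (Set.univ : Set M).Definable₁ setLang S →
    ∀ a, ∃ b, ∀ z, z ∊ b ↔ z ∊ a ∧ z ∈ S
  replacement : ∀ R : M → M → Prop,
    (Set.univ : Set M).Definable₂ setLang {p : M × M | R p.1 p.2} →
    ∀ a, (∀ x, x ∊ a → ∃! y, R x y) → ∃ b, ∀ y, y ∊ b ↔ ∃ x, x ∊ a ∧ R x y

section Notions

variable {M : Type*} [setLang.Structure M]

/-! ### Ordinals, cardinals and the cumulative hierarchy -/

/-- `a` is a transitive set. -/
def IsTransSet (a : M) : Prop := ∀ y, y ∊ a → IsSub y a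

/-- `a` is an ordinal: a transitive set of transitive sets. -/
def IsOrd (a : M) : Prop := IsTransSet a ∧ ∀ y, y ∊ a → IsTransSet y

/-- `n` is a natural number, i.e. an ordinal such that it and all its elements are `0` or
successors. -/
def IsNat (n : M) : Prop :=
  IsOrd n ∧ (IsEmptySet n ∨ ∃ m, IsSucc n m) ∧
    ∀ k, k ∊ n → IsEmptySet k ∨ ∃ m, IsSucc k m

/-- `w = ω`. -/
def IsOmega (w : M) : Prop := ∀ n, n ∊ w ↔ IsNat n

/-- `κ` is a cardinal, i.e. an initial ordinal. -/
def IsCard (κ : M) : Prop := IsOrd κ ∧ ∀ β, β ∊ κ → ¬ ∃ f, IsBij f β κ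

/-- `κ` is an uncountable cardinal. -/
def IsUncountableCard (κ : M) : Prop := IsCard κ ∧ ∀ w, IsOmega w → w ∊ κ

/-- `p = κ⁺`, the least cardinal greater than `κ`. -/
def IsSuccCard (p κ : M) : Prop :=
  IsCard p ∧ κ ∊ p ∧ ∀ q, IsCard q → κ ∊ q → IsSub p q

/-- `κ` is a singular cardinal: an infinite cardinal such that for some `β < κ` there is a cofinal
map from `β` to `κ`. -/
def IsSingular (κ : M) : Prop :=
  IsCard κ ∧ (∀ w, IsOmega w → IsSub w κ) ∧
    ∃ β f, β ∊ κ ∧ IsFun f β κ ∧ ∀ ξ, ξ ∊ κ → ∃ η ζ, η ∊ β ∧ InRel f η ζ ∧ IsSub ξ ζ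

/-- `α` is an ordinal and `v = V_α`, where `V_β = {z | z ⊆ V_γ for some γ < β}`. -/
def IsV (α v : M) : Prop :=
  IsOrd α ∧ ∃ s b f, IsSucc s α ∧ IsFun f s b ∧
    (∀ β u, β ∊ s → InRel f β u → ∀ z, z ∊ u ↔ ∃ γ t, γ ∊ β ∧ InRel f γ t ∧ IsSub z t) ∧
    InRel f α v

/-! ### Formulas, satisfaction and elementary submodels, inside `M` -/

/-- `t` is the natural number `k` of `M`. -/
def IsNumeral : ℕ → M → Prop
  | 0, t => IsEmptySet t
  | k + 1, t => ∃ r, IsNumeral k r ∧ IsSucc t r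

/-- `c = ⟨k, p⟩`. -/
def IsTagged (k : ℕ) (c p : M) : Prop := ∃ t, IsNumeral k t ∧ IsOPair c t p

/-- `c` is the code of the formula `v_i ∈ v_j`. -/
def IsMemCode (c i j : M) : Prop := ∃ p, IsOPair p i j ∧ IsTagged 0 c p

/-- `c` is the code of the formula `v_i = v_j`. -/
def IsEqCode (c i j : M) : Prop := ∃ p, IsOPair p i j ∧ IsTagged 1 c p

/-- `c` is the code of the formula `¬ φ`. -/
def IsNegCode (c φ : M) : Prop := IsTagged 2 c φ

/-- `c` is the code of the formula `φ ∧ ψ`. -/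
def IsAndCode (c φ ψ : M) : Prop := ∃ p, IsOPair p φ ψ ∧ IsTagged 3 c p

/-- `c` is the code of the formula `∃ v_i φ`. -/
def IsExCode (c i φ : M) : Prop := ∃ p, IsOPair p i φ ∧ IsTagged 4 c p

/-- The set `S` contains all atomic formulas and is closed under the formation rules. -/
def FormulaClosed (S : M) : Prop :=
  (∀ i j c, IsNat i → IsNat j → IsMemCode c i j → c ∊ S) ∧
  (∀ i j c, IsNat i → IsNat j → IsEqCode c i j → c ∊ S) ∧
  (∀ φ c, φ ∊ S → IsNegCode c φ → c ∊ S) ∧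
  (∀ φ ψ c, φ ∊ S → ψ ∊ S → IsAndCode c φ ψ → c ∊ S) ∧
  (∀ i φ c, IsNat i → φ ∊ S → IsExCode c i φ → c ∊ S)

/-- `c` is (the code of) a formula of the language of set theory. -/
def IsFormula (c : M) : Prop := ∀ S, FormulaClosed S → c ∊ S

/-- `s` is an assignment of elements of `A` to the variables, i.e. a function from `ω` to `A`. -/
def IsAssign (s A : M) : Prop := ∃ w, IsOmega w ∧ IsFun s w A

/-- The assignment `s'` maps `i` to `a` and agrees with the assignment `s` elsewhere. -/
def IsUpdate (s' s i a : M) : Prop :=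
  InRel s' i a ∧ ∀ j, IsNat j → j ≠ i → ∀ y, InRel s' j y ↔ InRel s j y

/-- The relation `R` satisfies Tarski's clauses for satisfaction `(A, ∈) ⊨ φ[s]`, for all
formulas `φ` and all assignments `s` in `A`. -/
def IsSatRel (A R : M) : Prop :=
  ∀ s, IsAssign s A →
    (∀ i j c, IsNat i → IsNat j → IsMemCode c i j →
      (InRel R c s ↔ ∃ a b, InRel s i a ∧ InRel s j b ∧ a ∊ b)) ∧
    (∀ i j c, IsNat i → IsNat j → IsEqCode c i j →
      (InRel R c s ↔ ∃ a, InRel s i a ∧ InRel s j a)) ∧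
    (∀ φ c, IsFormula φ → IsNegCode c φ → (InRel R c s ↔ ¬ InRel R φ s)) ∧
    (∀ φ ψ c, IsFormula φ → IsFormula ψ → IsAndCode c φ ψ →
      (InRel R c s ↔ InRel R φ s ∧ InRel R ψ s)) ∧
    (∀ i φ c, IsNat i → IsFormula φ → IsExCode c i φ →
      (InRel R c s ↔ ∃ a s', a ∊ A ∧ IsAssign s' A ∧ IsUpdate s' s i a ∧ InRel R φ s'))

/-- `(A, ∈) ⊨ φ[s]`. -/
def Sat (A φ s : M) : Prop := ∃ R, IsSatRel A R ∧ InRel R φ s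

/-- `X ≺ A`: `(X, ∈)` is an elementary submodel of `(A, ∈)`. -/
def ElemSub (X A : M) : Prop :=
  (∃ x, x ∊ X) ∧ IsSub X A ∧
    ∀ φ s, IsFormula φ → IsAssign s X → (Sat X φ s ↔ Sat A φ s)

/-- `Y` is the transitive collapse of `X`, i.e. the range of the function `π` on `X` with
`π(x) = {π(y) | y ∈ x ∩ X}`. -/
def IsCollapse (X Y : M) : Prop :=
  ∃ f, IsFun f X Y ∧ (∀ z, z ∊ Y → ∃ x, x ∊ X ∧ InRel f x z) ∧
    ∀ x u, x ∊ X → InRel f x u → ∀ z, z ∊ u ↔ ∃ y, y ∊ X ∧ y ∊ x ∧ InRel f y z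

/-! ### Weakly Löwenheim–Skolem cardinals and normal filters -/

/-- `κ` is a weakly Löwenheim–Skolem cardinal: `κ` is an uncountable cardinal, and for all
`γ < κ`, `α ≥ κ` and `x ∈ V_α` there is `X ≺ V_α` with `V_γ ⊆ X` and `x ∈ X` whose transitive
collapse belongs to `V_κ`. -/
def IsWeaklyLS (κ : M) : Prop :=
  IsUncountableCard κ ∧
    ∀ γ α x vγ vα vκ, γ ∊ κ → IsOrd α → IsSub κ α →
      IsV γ vγ → IsV α vα → IsV κ vκ → x ∊ vα →
      ∃ X, ElemSub X vα ∧ IsSub vγ X ∧ x ∊ X ∧ ∃ Y, IsCollapse X Y ∧ Y ∊ vκ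

/-- `D` belongs to the family of all `D ⊆ p` such that, for some `α ≥ p` and `x ∈ V_α`, the set `D`
contains `{η < p | η = X ∩ p for some X ≺ V_α with x ∈ X}`. -/
def InElemFilter (p D : M) : Prop :=
  IsSub D p ∧ ∃ α v x, IsOrd α ∧ IsSub p α ∧ IsV α v ∧ x ∊ v ∧
    ∀ η, η ∊ p → (∃ X, ElemSub X v ∧ x ∊ X ∧ ∀ z, z ∊ η ↔ z ∊ X ∧ z ∊ p) → η ∊ D

/-- `F` is a filter over `p`. -/
def IsFilterOver (p F : M) : Prop :=
  (∀ D, D ∊ F → IsSub D p) ∧ p ∊ F ∧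
  (∀ D E, D ∊ F → IsSub D E → IsSub E p → E ∊ F) ∧
  (∀ D E C, D ∊ F → E ∊ F → (∀ z, z ∊ C ↔ z ∊ D ∧ z ∊ E) → C ∊ F)

/-- `X` is an `F`-positive subset of `p`. -/
def IsPositive (p F X : M) : Prop := IsSub X p ∧ ∀ C, C ∊ F → ∃ z, z ∊ X ∧ z ∊ C

/-- `F` is a normal filter over the cardinal `p`: a proper filter over `p` that contains all
co-bounded subsets of `p` and is closed under diagonal intersections; equivalently to the last
condition, every regressive function on a positive set is constant on a positive set (both
forms are required here). -/
def IsNormalFilter (p F : M) : Prop :=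
  IsFilterOver p F ∧ (∀ D, D ∊ F → ∃ z, z ∊ D) ∧
  (∀ D ξ, IsSub D p → ξ ∊ p → (∀ η, η ∊ p → IsSub ξ η → η ∊ D) → D ∊ F) ∧
  (∀ G D, IsFun G p F →
    (∀ β, β ∊ D ↔ β ∊ p ∧ ∀ α d, α ∊ β → InRel G α d → β ∊ d) → D ∊ F) ∧
  (∀ X f, IsPositive p F X → IsFun f X p →
    (∀ β η, β ∊ X → ¬ IsEmptySet β → InRel f β η → η ∊ β) →
    ∃ α, α ∊ p ∧ ∀ Y, (∀ β, β ∊ Y ↔ β ∊ X ∧ InRel f β α) → IsPositive p F Y)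

end Notions

end ZFModel

/-!
Let `κ` be a singular weakly Löwenheim–Skolem cardinal and `p = κ⁺`. The main point is that the
family in question is a proper filter: every `V_α` with `α ≥ p` has an elementary submodel that
contains a given `x` and intersects `p` in an element of `p` (`exists_elemSub_inter_mem`). In the
presence of choice one would close off under Skolem functions. Here a submodel `Y` of a larger level
`V_m` is used, such that `V_β ⊆ Y`, where `β` is the domain of a cofinal map into `κ`, and such that
the transitive collapse `N` of `Y` belongs to `V_κ`. Its hull consists of the values `g(a)` of all
functions `g ∈ Y` whose domain belongs to `V_κ`.

* Skolem functions for a relation are not available, but for a function `g` as above there is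
  another one, `h`, the values of which contain witnesses for all values of `g`: it is the inverse
  of the collapse of a suitable elementary submodel (`IsWeaklyLS.exists_witnesses`). If the relation
  that holds between such `g` and `h` belongs to `Y`, then by elementarity there is such an `h` in
  `Y` for every `g` in `Y`. So the hull is closed under the relation (`hull_closedRel`), and two
  suitable relations suffice for its part in `V_α` to be elementary (`elemSub_of_closed`).
* The hull includes `κ` by the cofinal map, and then its intersection with `p` is an initial segment
  of `p`, because it is closed under a relation that provides, for every `ξ < p`, a bijection from a
  subset of `κ` onto `ξ`.
* It is a proper initial segment, because by way of the collapse of `Y` the hull is the image of a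
  partial function on `N × V_κ`, and there is no such function onto `p`
  (`IsWeaklyLS.not_onto_succCard`). This in turn follows from the fact that there is no partial
  function from `V_γ × V_γ` onto `κ`, for `γ < κ` (`IsWeaklyLS.not_onto`).

Closure under diagonal intersections (`exists_diagonal_witness`) comes from a single relation that
assigns to every `ξ < p` a witness for the `ξ`-th member; a submodel containing this relation
contains a witness for each of its elements `ξ < p`.

The separation and replacement schemata apply to classes that are definable by a first-order
formula. The classes `Dfn` and `DTerm` let instance search find the formulas. They are set up for
families of structures, so that the same instances also provide one formula that defines the filter
in all models (`exists_formula`). The formulas inside the model are connected with those outside by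
`exists_code`, and so elementary submodels in the sense of the model have the closure properties
`BasicClosed`.
-/

namespace ZFModel

open FirstOrder FirstOrder.Language

universe u w

/-! ### Uniform definability -/

/-- A context for formulas: a type `Γ` of environments `γ`, each speaking about a structure `𝓜 γ`,
together with the set of coordinates, i.e. the functions of the environment that may be used as
variables. Letting the structure depend on the environment makes it possible to speak of one formula
that works in all models at once. -/
class Ctx (Γ : Type w) (𝓜 : outParam (Γ → Type u)) where
  /-- The membership structures. -/
  str : ∀ γ, setLang.Structure (𝓜 γ)
  /-- The functions that may be used as variables. -/
  coords : Set (∀ γ, 𝓜 γ)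

/-- An environment extended by the value of one more variable. -/
structure Ext {Γ : Type w} (𝓜 : Γ → Type u) where
  /-- The old environment; it is accessed through `Ext.pre`. -/
  base : Γ
  /-- The new value; it is accessed through `Ext.var`. -/
  val : 𝓜 base

/-- The old environment. This and `Ext.var` are definitions, and not projections, so that the
unifier treats them as function applications in the search for instances. -/
def Ext.pre {Γ : Type w} {𝓜 : Γ → Type u} (x : Ext 𝓜) : Γ := x.base

/-- The value of the last variable. -/
def Ext.var {Γ : Type w} {𝓜 : Γ → Type u} (x : Ext 𝓜) : 𝓜 x.pre := x.val

/-- The structure of the old environment, seen from the extended one. -/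
abbrev Lift {Γ : Type w} (𝓜 : Γ → Type u) : Ext 𝓜 → Type u := fun x => 𝓜 x.pre

/-- Extending a context by one variable. -/
instance {Γ : Type w} {𝓜 : Γ → Type u} [Ctx Γ 𝓜] : Ctx (Ext 𝓜) (fun x => 𝓜 x.pre) :=
  ⟨fun x => Ctx.str x.pre, {t : ∀ x : Ext 𝓜, 𝓜 x.pre | t = (fun x => x.var) ∨
    ∃ s ∈ Ctx.coords (Γ := Γ), t = fun x : Ext 𝓜 => s x.pre}⟩

section Family

attribute [reducible] Ctx.str
attribute [local instance] Ctx.str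

variable {Γ : Type w} {𝓜 : Γ → Type u} [Ctx Γ 𝓜]

/-- `P` is defined by one formula of the language of set theory, evaluated at finitely many
coordinates of the environment. -/
class Dfn (P : Γ → Prop) : Prop where
  out : ∃ (ι : Type) (_ : Finite ι) (φ : setLang.Formula ι) (t : ι → ∀ γ, 𝓜 γ),
    (∀ i, t i ∈ Ctx.coords (Γ := Γ)) ∧ ∀ γ, P γ ↔ φ.Realize (fun i => t i γ)

/-- The function `t` of the environment has a definable graph. -/
class DTerm (t : ∀ γ, 𝓜 γ) : Prop where
  out : Dfn (fun x : Ext 𝓜 => x.var = t x.pre)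

theorem Dfn.congr {P Q : Γ → Prop} (h : ∀ γ, P γ ↔ Q γ) [hQ : Dfn Q] : Dfn P := by
  have : P = Q := funext fun γ => propext (h γ)
  exact this ▸ hQ

/-- Definability is preserved under a change of environment that maps coordinates to
coordinates. -/
theorem Dfn.subst {Γ' : Type*} (σ : Γ' → Γ) [C : Ctx Γ' (fun x => 𝓜 (σ x))]
    (hs : C.str = fun x => Ctx.str (σ x))
    (h : ∀ t ∈ Ctx.coords (Γ := Γ), (fun x => t (σ x)) ∈ Ctx.coords (Γ := Γ'))
    {P : Γ → Prop} (hP : Dfn P) : Dfn (fun x => P (σ x)) := by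
  obtain ⟨ι, fin, φ, t, ht, hφ⟩ := hP.out
  refine ⟨ι, fin, φ, fun i x => t i (σ x), fun i => h _ (ht i), fun x => ?_⟩
  rw [hs]
  exact hφ (σ x)

instance Dfn.not {P : Γ → Prop} [hP : Dfn P] : Dfn (fun x => ¬ P x) := by
  obtain ⟨ι, fin, φ, t, ht, hφ⟩ := hP.out
  exact ⟨ι, fin, φ.not, t, ht, fun x => by rw [Formula.realize_not, hφ]⟩

instance Dfn.and {P Q : Γ → Prop} [hP : Dfn P] [hQ : Dfn Q] : Dfn (fun x => P x ∧ Q x) := by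
  obtain ⟨ι, fin, φ, t, ht, hφ⟩ := hP.out
  obtain ⟨κ, fin', ψ, s, hs, hψ⟩ := hQ.out
  refine ⟨ι ⊕ κ, inferInstance, φ.relabel Sum.inl ⊓ ψ.relabel Sum.inr, Sum.elim t s, ?_, ?_⟩
  · rintro (i | i)
    exacts [ht i, hs i]
  · intro x
    rw [Formula.realize_inf, Formula.realize_relabel, Formula.realize_relabel, hφ, hψ]
    rfl

instance Dfn.or {P Q : Γ → Prop} [Dfn P] [Dfn Q] : Dfn (fun x => P x ∨ Q x) :=
  Dfn.congr (Q := fun x => ¬ (¬ P x ∧ ¬ Q x)) fun _ => by tauto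

instance Dfn.imp {P Q : Γ → Prop} [Dfn P] [Dfn Q] : Dfn (fun x => P x → Q x) :=
  Dfn.congr (Q := fun x => ¬ (P x ∧ ¬ Q x)) fun _ => by tauto

instance Dfn.iff {P Q : Γ → Prop} [Dfn P] [Dfn Q] : Dfn (fun x => P x ↔ Q x) :=
  Dfn.congr (Q := fun x => (P x → Q x) ∧ (Q x → P x)) fun _ => by tauto

/-- The variables of the formula that stand for the last coordinate become bound, the others stay
free. -/
instance Dfn.ex {P : ∀ γ, 𝓜 γ → Prop} [hP : Dfn (fun x : Ext 𝓜 => P x.pre x.var)] :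
    Dfn (fun x => ∃ y, P x y) := by
  classical
  obtain ⟨ι, fin, φ, t, ht, hφ⟩ := hP.out
  have key : ∀ i : {i // t i ≠ fun x => x.var}, ∃ s ∈ Ctx.coords (Γ := Γ),
      t i = fun x : Ext 𝓜 => s x.pre :=
    fun i => (ht i).resolve_left i.2
  choose s hs hts using key
  let g : ι → {i // t i ≠ fun x => x.var} ⊕ Fin 1 :=
    fun i => if h : t i = fun x => x.var then Sum.inr 0 else Sum.inl ⟨i, h⟩
  refine ⟨_, inferInstance, (BoundedFormula.relabel (n := 1) (k := 0) g φ).ex, s, hs, fun x => ?_⟩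
  rw [Formula.Realize, BoundedFormula.realize_ex]
  refine exists_congr fun a => ?_
  rw [BoundedFormula.realize_relabel]
  refine (hφ ⟨x, a⟩).trans ?_
  rw [Formula.Realize]
  refine iff_of_eq (congrArg₂ (BoundedFormula.Realize φ) (funext fun i => ?_) (funext finZeroElim))
  by_cases h : t i = fun x => x.var
  · simp only [Function.comp_apply, g, h]
    exact (Fin.snoc_last (n := 0) (α := fun _ => 𝓜 x) a default).symm
  · simp only [Function.comp_apply, g, dif_neg h, Sum.elim_inl]
    exact congrFun (hts ⟨i, h⟩) ⟨x, a⟩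

instance Dfn.all {P : ∀ γ, 𝓜 γ → Prop} [Dfn (fun x : Ext 𝓜 => P x.pre x.var)] :
    Dfn (fun x => ∀ y, P x y) :=
  Dfn.congr (Q := fun x => ¬ ∃ y, ¬ P x y) fun _ => by push Not; rfl

/-- Coordinates are definable. -/
theorem DTerm.of_mem {t : ∀ γ, 𝓜 γ} (ht : t ∈ Ctx.coords (Γ := Γ)) : DTerm t := by
  refine ⟨⟨Bool, inferInstance, (Term.var true).equal (Term.var false),
    fun b => if b then fun x => x.var else fun x => t x.pre, ?_, ?_⟩⟩
  · rintro (_ | _)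
    exacts [Or.inr ⟨t, ht, rfl⟩, Or.inl rfl]
  · intro x
    rw [Formula.realize_equal]
    rfl

instance DTerm.snd : DTerm (fun x : Ext 𝓜 => x.var) := DTerm.of_mem (Or.inl rfl)

/-- A definable property of the last variable and of the environment stays definable if another
variable is inserted between the two. -/
theorem Dfn.drop {P : Ext 𝓜 → Prop} (hP : Dfn P) :
    Dfn (fun x : Ext (Lift 𝓜) => P ⟨x.pre.pre, x.var⟩) :=
  Dfn.subst (fun x : Ext (Lift 𝓜) => (⟨x.pre.pre, x.var⟩ : Ext 𝓜)) rfl (by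
      rintro _ (rfl | ⟨s, hs, rfl⟩)
      exacts [Or.inl rfl, Or.inr ⟨_, Or.inr ⟨s, hs, rfl⟩, rfl⟩]) hP

/-! The instances for weakening are stated separately for each number of variables, since the
unifier does not find `t` for a term of the form `t x.pre.pre` in one step. -/

instance (priority := 900) DTerm.weaken {t : ∀ γ, 𝓜 γ} [ht : DTerm t] :
    DTerm (fun x : Ext 𝓜 => t x.pre) :=
  ⟨Dfn.drop ht.out⟩

instance (priority := 880) DTerm.weaken₂ {t : ∀ γ, 𝓜 γ} [DTerm t] :
    DTerm (fun x : Ext (Lift 𝓜) => t x.pre.pre) :=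
  DTerm.weaken (t := fun x : Ext 𝓜 => t x.pre)

instance (priority := 870) DTerm.weaken₃ {t : ∀ γ, 𝓜 γ} [DTerm t] :
    DTerm (fun x : Ext (Lift (Lift 𝓜)) => t x.pre.pre.pre) :=
  DTerm.weaken₂ (t := fun x : Ext 𝓜 => t x.pre)

instance (priority := 860) DTerm.weaken₄ {t : ∀ γ, 𝓜 γ} [DTerm t] :
    DTerm (fun x : Ext (Lift (Lift (Lift 𝓜))) => t x.pre.pre.pre.pre) :=
  DTerm.weaken₃ (t := fun x : Ext 𝓜 => t x.pre)

instance (priority := 850) DTerm.weaken₅ {t : ∀ γ, 𝓜 γ} [DTerm t] :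
    DTerm (fun x : Ext (Lift (Lift (Lift (Lift 𝓜)))) => t x.pre.pre.pre.pre.pre) :=
  DTerm.weaken₄ (t := fun x : Ext 𝓜 => t x.pre)

instance (priority := 840) DTerm.weaken₆ {t : ∀ γ, 𝓜 γ} [DTerm t] :
    DTerm (fun x : Ext (Lift (Lift (Lift (Lift (Lift 𝓜))))) => t x.pre.pre.pre.pre.pre.pre) :=
  DTerm.weaken₅ (t := fun x : Ext 𝓜 => t x.pre)

instance DTerm.var : DTerm (fun x : Ext (Lift 𝓜) => x.pre.var) :=
  DTerm.weaken (t := fun x : Ext 𝓜 => x.var)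

instance DTerm.var₂ : DTerm (fun x : Ext (Lift (Lift 𝓜)) => x.pre.pre.var) :=
  DTerm.weaken (t := fun x : Ext (Lift 𝓜) => x.pre.var)

instance DTerm.var₃ : DTerm (fun x : Ext (Lift (Lift (Lift 𝓜))) => x.pre.pre.pre.var) :=
  DTerm.weaken₂ (t := fun x : Ext (Lift 𝓜) => x.pre.var)

instance DTerm.var₄ :
    DTerm (fun x : Ext (Lift (Lift (Lift (Lift 𝓜)))) => x.pre.pre.pre.pre.var) :=
  DTerm.weaken₃ (t := fun x : Ext (Lift 𝓜) => x.pre.var)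

instance DTerm.var₅ :
    DTerm (fun x : Ext (Lift (Lift (Lift (Lift (Lift 𝓜))))) => x.pre.pre.pre.pre.pre.var) :=
  DTerm.weaken₄ (t := fun x : Ext (Lift 𝓜) => x.pre.var)

instance DTerm.var₆ : DTerm (fun x : Ext (Lift (Lift (Lift (Lift (Lift (Lift 𝓜)))))) =>
    x.pre.pre.pre.pre.pre.pre.var) :=
  DTerm.weaken₅ (t := fun x : Ext (Lift 𝓜) => x.pre.var)

/-- A definable term may be substituted for the last variable. -/
theorem Dfn.comp_term {P : Ext 𝓜 → Prop} (hP : Dfn P) {t : ∀ γ, 𝓜 γ} [ht : DTerm t] :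
    Dfn (fun x => P ⟨x, t x⟩) := by
  have : Dfn (fun x : Ext 𝓜 => P ⟨x.pre, x.var⟩) := hP
  have : Dfn (fun x : Ext 𝓜 => x.var = t x.pre) := ht.out
  exact Dfn.congr (Q := fun x => ∃ y, y = t x ∧ P ⟨x, y⟩) fun x => by simp

instance Dfn.eq {s t : ∀ γ, 𝓜 γ} [hs : DTerm s] [ht : DTerm t] : Dfn (fun x => s x = t x) :=
  Dfn.comp_term ht.out

instance Dfn.ne {s t : ∀ γ, 𝓜 γ} [hs : DTerm s] [ht : DTerm t] : Dfn (fun x => s x ≠ t x) :=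
  Dfn.not (P := fun x => s x = t x)

/-- The membership symbol. -/
def memSymbol : setLang.Relations 2 := SetRel.mem

theorem Dfn.mem_vars : Dfn (fun x : Ext (Lift 𝓜) => x.pre.var ∊ x.var) := by
  refine ⟨Bool, inferInstance,
    Relations.formula₂ memSymbol (Term.var true) (Term.var false),
    fun b x => if b then x.pre.var else x.var, ?_, ?_⟩
  · rintro (_ | _)
    exacts [Or.inl rfl, Or.inr ⟨_, Or.inl rfl, rfl⟩]
  · intro x
    exact (Formula.realize_rel₂ (L := setLang) (M := 𝓜 x.pre.pre) (R := memSymbol)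
      (t₁ := Term.var true) (t₂ := Term.var false)
      (v := fun b => if b then x.pre.var else x.var)).symm

instance Dfn.mem {s t : ∀ γ, 𝓜 γ} [hs : DTerm s] [ht : DTerm t] : Dfn (fun x => s x ∊ t x) :=
  Dfn.comp_term (P := fun x : Ext 𝓜 => x.var ∊ t x.pre)
    (Dfn.comp_term (P := fun x : Ext (Lift 𝓜) => x.pre.var ∊ x.var)
      (t := fun x : Ext 𝓜 => t x.pre) Dfn.mem_vars)

instance Dfn.exUnique {P : ∀ γ, 𝓜 γ → Prop}
    [Dfn (fun x : Ext 𝓜 => P x.pre x.var)]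
    [Dfn (fun x : Ext (Lift 𝓜) => P x.pre.pre x.var)] :
    Dfn (fun x => ∃! y, P x y) := by
  exact Dfn.congr (Q := fun x => ∃ y, P x y ∧ ∀ z, P x z → z = y) fun _ => Iff.rfl

/-! ### The notions of set theory are uniformly definable -/

variable {a b c d : ∀ γ, 𝓜 γ} [DTerm a] [DTerm b] [DTerm c] [DTerm d]

instance : Dfn (fun x => IsSub (a x) (b x)) := by unfold IsSub; infer_instance
instance : Dfn (fun x => IsEmptySet (a x)) := by unfold IsEmptySet; infer_instance
instance : Dfn (fun x => IsUPair (a x) (b x) (c x)) := by unfold IsUPair; infer_instance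
instance : Dfn (fun x => IsOPair (a x) (b x) (c x)) := by unfold IsOPair; infer_instance
instance : Dfn (fun x => IsSucc (a x) (b x)) := by unfold IsSucc; infer_instance
instance : Dfn (fun x => InRel (a x) (b x) (c x)) := by unfold InRel; infer_instance
instance : Dfn (fun x => IsFun (a x) (b x) (c x)) := by unfold IsFun; infer_instance
instance : Dfn (fun x => IsBij (a x) (b x) (c x)) := by unfold IsBij; infer_instance
instance : Dfn (fun x => IsTransSet (a x)) := by unfold IsTransSet; infer_instance
instance : Dfn (fun x => IsOrd (a x)) := by unfold IsOrd; infer_instance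
instance : Dfn (fun x => IsNat (a x)) := by unfold IsNat; infer_instance
instance : Dfn (fun x => IsOmega (a x)) := by unfold IsOmega; infer_instance
instance : Dfn (fun x => IsV (a x) (b x)) := by unfold IsV; infer_instance

theorem Dfn.isNumeral (k : ℕ) : Dfn (fun x : Ext 𝓜 => IsNumeral k x.var) := by
  induction k with
  | zero => simp only [IsNumeral]; infer_instance
  | succ k ih =>
    simp only [IsNumeral]
    have : Dfn (fun x : Ext (Lift 𝓜) => IsNumeral k x.var) := Dfn.drop ih
    infer_instance

instance (k : ℕ) : Dfn (fun x => IsNumeral k (a x)) :=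
  Dfn.comp_term (Dfn.isNumeral k)

instance (k : ℕ) : Dfn (fun x => IsTagged k (a x) (b x)) := by unfold IsTagged; infer_instance
instance : Dfn (fun x => IsMemCode (a x) (b x) (c x)) := by unfold IsMemCode; infer_instance
instance : Dfn (fun x => IsEqCode (a x) (b x) (c x)) := by unfold IsEqCode; infer_instance
instance : Dfn (fun x => IsNegCode (a x) (b x)) := by unfold IsNegCode; infer_instance
instance : Dfn (fun x => IsAndCode (a x) (b x) (c x)) := by unfold IsAndCode; infer_instance
instance : Dfn (fun x => IsExCode (a x) (b x) (c x)) := by unfold IsExCode; infer_instance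
instance : Dfn (fun x => FormulaClosed (a x)) := by unfold FormulaClosed; infer_instance
instance : Dfn (fun x => IsFormula (a x)) := by unfold IsFormula; infer_instance
instance : Dfn (fun x => IsAssign (a x) (b x)) := by unfold IsAssign; infer_instance
instance : Dfn (fun x => IsUpdate (a x) (b x) (c x) (d x)) := by unfold IsUpdate; infer_instance
set_option synthInstance.maxSize 1000 in
instance : Dfn (fun x => IsSatRel (a x) (b x)) := by unfold IsSatRel; infer_instance
instance : Dfn (fun x => Sat (a x) (b x) (c x)) := by unfold Sat; infer_instance
instance : Dfn (fun x => ElemSub (a x) (b x)) := by unfold ElemSub; infer_instance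
instance : Dfn (fun x => InElemFilter (a x) (b x)) := by unfold InElemFilter; infer_instance

end Family

/-! ### Classes and class functions of a model of set theory -/

/-- The environment without variables, for formulas with parameters from `M`. -/
structure Base (M : Type u) : Type u where

/-- The environments of one variable with values in `M`. -/
abbrev Env₁ (M : Type u) := Ext (fun _ : Base M => M)

/-- The environments of two variables with values in `M`. -/
abbrev Env₂ (M : Type u) := Ext (fun _ : Env₁ M => M)

/-- The environments of three variables with values in `M`. -/
abbrev Env₃ (M : Type u) := Ext (fun _ : Env₂ M => M)

/-- A context that speaks about the fixed set `M` and has all elements of `M` as parameters. -/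
class PCtx (Γ : Type w) (M : outParam (Type u)) where
  /-- The functions that may be used as variables. -/
  coords : Set (Γ → M)
  const_mem : ∀ c : M, (fun _ => c) ∈ coords

section Pars

variable {M : Type u} [S : setLang.Structure M]

instance : PCtx (Base M) M := ⟨Set.univ, fun _ => trivial⟩

instance {Γ : Type w} [PCtx Γ M] : PCtx (Ext (fun _ : Γ => M)) M :=
  ⟨{t : Ext (fun _ : Γ => M) → M | t = (fun x => x.var) ∨
    ∃ s ∈ PCtx.coords (Γ := Γ) (M := M), t = fun x : Ext (fun _ : Γ => M) => s x.pre},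
    fun c => Or.inr ⟨_, PCtx.const_mem c, rfl⟩⟩

instance {Γ : Type w} [PCtx Γ M] : Ctx Γ (fun _ => M) := ⟨fun _ => S, PCtx.coords⟩

variable {Γ : Type w} [hC : PCtx Γ M]

instance DTerm.const {c : M} : DTerm (fun _ : Γ => c) := DTerm.of_mem (hC.const_mem c)

/-! The following four classes are found by instance search for all lambda terms built from the
notions and operations below. For a local definition, a `show` first replaces the name by the term
it stands for. -/

/-- The class `P` is definable with parameters. -/
class DPred (P : M → Prop) : Prop where
  out : Dfn (fun x : Env₁ M => P x.var)

/-- The class relation `R` is definable with parameters. -/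
class DRel (R : M → M → Prop) : Prop where
  out : Dfn (fun x : Env₂ M => R x.pre.var x.var)

/-- The class function `F` is definable with parameters. -/
class DFun (F : M → M) : Prop where
  out : DTerm (fun x : Env₁ M => F x.var)

/-- The binary class function `F` is definable with parameters. -/
class DFun₂ (F : M → M → M) : Prop where
  out : DTerm (fun x : Env₂ M => F x.pre.var x.var)

instance (priority := 200) {P : M → Prop} [h : Dfn (fun x : Env₁ M => P x.var)] : DPred P := ⟨h⟩
instance (priority := 200) {R : M → M → Prop} [h : Dfn (fun x : Env₂ M => R x.pre.var x.var)] :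
    DRel R := ⟨h⟩
instance (priority := 200) {F : M → M} [h : DTerm (fun x : Env₁ M => F x.var)] : DFun F := ⟨h⟩
instance (priority := 200) {F : M → M → M} [h : DTerm (fun x : Env₂ M => F x.pre.var x.var)] :
    DFun₂ F := ⟨h⟩

/-- `Dfn.subst`, for contexts that speak about the same model. -/
theorem Dfn.subst_pars {Γ' : Type*} [C' : PCtx Γ' M] (σ : Γ' → Γ)
    (h : ∀ t ∈ hC.coords, (fun x => t (σ x)) ∈ C'.coords) {P : Γ → Prop} (hP : Dfn P) :
    Dfn (fun x => P (σ x)) :=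
  Dfn.subst σ rfl h hP

theorem Dfn.comp_pred {P : M → Prop} (hP : Dfn (fun x : Env₁ M => P x.var)) {t : Γ → M}
    [DTerm t] : Dfn (fun x => P (t x)) :=
  Dfn.comp_term (P := fun x : Ext (fun _ : Γ => M) => P x.var)
    (Dfn.subst_pars (fun x : Ext (fun _ : Γ => M) => (⟨⟨⟩, x.var⟩ : Env₁ M)) (by
      rintro t (rfl | ⟨s, -, rfl⟩)
      · exact Or.inl rfl
      · exact Or.inr ⟨fun _ => s ⟨⟩, hC.const_mem _, rfl⟩) hP)

theorem Dfn.comp_rel {R : M → M → Prop} (hR : Dfn (fun x : Env₂ M => R x.pre.var x.var))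
    {s t : Γ → M} [DTerm s] [DTerm t] : Dfn (fun x => R (s x) (t x)) :=
  Dfn.comp_term (P := fun x : Ext (fun _ : Γ => M) => R x.var (t x.pre))
    (Dfn.comp_term (P := fun x : Ext (fun _ : Ext (fun _ : Γ => M) => M) => R x.pre.var x.var)
      (t := fun x : Ext (fun _ : Γ => M) => t x.pre)
      (Dfn.subst_pars (fun x : Ext (fun _ : Ext (fun _ : Γ => M) => M) =>
        (⟨⟨⟨⟩, x.pre.var⟩, x.var⟩ : Env₂ M)) (by
      rintro t (rfl | ⟨_, (rfl | ⟨s, -, rfl⟩), rfl⟩)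
      · exact Or.inl rfl
      · exact Or.inr ⟨_, Or.inl rfl, rfl⟩
      · exact Or.inr ⟨_, Or.inr ⟨fun _ => s ⟨⟩, hC.const_mem _, rfl⟩, rfl⟩) hR))

instance (priority := 100) {P : M → Prop} [h : DPred P] {t : Γ → M} [DTerm t] :
    Dfn (fun x => P (t x)) := Dfn.comp_pred h.out

theorem Dfn.comp_rel₃ {R : M → M → M → Prop}
    (hR : Dfn (fun x : Env₃ M => R x.pre.pre.var x.pre.var x.var))
    {r s t : Γ → M} [DTerm r] [DTerm s] [DTerm t] : Dfn (fun x => R (r x) (s x) (t x)) :=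
  Dfn.comp_term (P := fun x : Ext (fun _ : Γ => M) => R x.var (s x.pre) (t x.pre))
    (Dfn.comp_term
      (P := fun x : Ext (fun _ : Ext (fun _ : Γ => M) => M) => R x.pre.var x.var (t x.pre.pre))
      (t := fun x : Ext (fun _ : Γ => M) => s x.pre)
      (Dfn.comp_term
        (P := fun x : Ext (fun _ : Ext (fun _ : Ext (fun _ : Γ => M) => M) => M) =>
          R x.pre.pre.var x.pre.var x.var)
        (t := fun x : Ext (fun _ : Ext (fun _ : Γ => M) => M) => t x.pre.pre)
        (Dfn.subst_pars (fun x : Ext (fun _ : Ext (fun _ : Ext (fun _ : Γ => M) => M) => M) =>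
          (⟨⟨⟨⟨⟩, x.pre.pre.var⟩, x.pre.var⟩, x.var⟩ : Env₃ M)) (by
        rintro t (rfl | ⟨_, (rfl | ⟨_, (rfl | ⟨s, -, rfl⟩), rfl⟩), rfl⟩)
        · exact Or.inl rfl
        · exact Or.inr ⟨_, Or.inl rfl, rfl⟩
        · exact Or.inr ⟨_, Or.inr ⟨_, Or.inl rfl, rfl⟩, rfl⟩
        · exact Or.inr ⟨_, Or.inr ⟨_, Or.inr ⟨fun _ => s ⟨⟩, hC.const_mem _, rfl⟩, rfl⟩, rfl⟩)
        hR)))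

instance (priority := 100) {F : M → M} [h : DFun F] {t : Γ → M} [DTerm t] :
    DTerm (fun x => F (t x)) :=
  ⟨Dfn.comp_rel (R := fun a b => b = F a) (s := fun x : Ext (fun _ : Γ => M) => t x.pre) h.out.out⟩

instance (priority := 90) {F : M → M → M} [h : DFun₂ F] {s t : Γ → M} [DTerm s] [DTerm t] :
    DTerm (fun x => F (s x) (t x)) :=
  ⟨Dfn.comp_rel₃ (R := fun a b c => c = F a b) (r := fun x : Ext (fun _ : Γ => M) => s x.pre)
    (s := fun x : Ext (fun _ : Γ => M) => t x.pre) h.out.out⟩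

/-- Fixing the values of all variables but one turns them into parameters. -/
theorem Dfn.dpred {P : Γ → M → Prop} (hP : Dfn (fun x : Ext (fun _ : Γ => M) => P x.pre x.var))
    (γ : Γ) : DPred (P γ) :=
  ⟨Dfn.subst_pars (fun x : Env₁ M => (⟨γ, x.var⟩ : Ext (fun _ : Γ => M))) (by
    rintro t (rfl | ⟨s, -, rfl⟩)
    · exact Or.inl rfl
    · exact Or.inr ⟨fun _ => s γ, trivial, rfl⟩) hP⟩

theorem DTerm.dfun {F : Γ → M → M} (hF : DTerm (fun x : Ext (fun _ : Γ => M) => F x.pre x.var))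
    (γ : Γ) : DFun (F γ) :=
  ⟨⟨Dfn.subst_pars (fun x : Env₂ M => (⟨⟨γ, x.pre.var⟩, x.var⟩ :
      Ext (fun _ : Ext (fun _ : Γ => M) => M))) (by
    rintro t (rfl | ⟨_, (rfl | ⟨s, -, rfl⟩), rfl⟩)
    · exact Or.inl rfl
    · exact Or.inr ⟨_, Or.inl rfl, rfl⟩
    · exact Or.inr ⟨_, Or.inr ⟨fun _ => s γ, trivial, rfl⟩, rfl⟩) hF.out⟩⟩

/-- The analogue of `Dfn.drop` for terms. -/
theorem DTerm.drop {F : Γ → M → M} (hF : DTerm (fun x : Ext (fun _ : Γ => M) => F x.pre x.var)) :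
    DTerm (fun x : Ext (fun _ : Ext (fun _ : Γ => M) => M) => F x.pre.pre x.var) :=
  ⟨Dfn.subst_pars (fun x : Ext (fun _ : Ext (fun _ : Ext (fun _ : Γ => M) => M) => M) =>
      (⟨⟨x.pre.pre.pre, x.pre.var⟩, x.var⟩ : Ext (fun _ : Ext (fun _ : Γ => M) => M))) (by
    rintro t (rfl | ⟨_, (rfl | ⟨s, hs, rfl⟩), rfl⟩)
    · exact Or.inl rfl
    · exact Or.inr ⟨_, Or.inl rfl, rfl⟩
    · exact Or.inr ⟨_, Or.inr ⟨_, Or.inr ⟨s, hs, rfl⟩, rfl⟩, rfl⟩) hF.out⟩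

theorem DPred.definable₁ {P : M → Prop} [hP : DPred P] :
    (Set.univ : Set M).Definable₁ setLang {z | P z} := by
  obtain ⟨ι, fin, φ, t, ht, hφ⟩ := hP.out.out
  have key : ∀ i, ∃ j : (Set.univ : Set M) ⊕ Fin 1, ∀ x : Env₁ M,
      t i x = Sum.elim Subtype.val (fun _ => x.var) j := by
    intro i
    rcases ht i with h | ⟨s, -, h⟩
    · exact ⟨Sum.inr 0, fun x => congrFun h x⟩
    · exact ⟨Sum.inl ⟨s ⟨⟩, trivial⟩, fun x => congrFun h x⟩
  choose g hg using key
  rw [Set.Definable₁, Set.definable_iff_exists_formula_sum]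
  refine ⟨φ.relabel g, Set.ext fun v => ?_⟩
  refine (hφ ⟨⟨⟩, v 0⟩).trans ?_
  refine Iff.trans ?_ Formula.realize_relabel.symm
  refine iff_of_eq (congrArg φ.Realize (funext fun i => ?_))
  rw [hg]
  simp only [Function.comp_apply]
  rcases g i with c | j
  · rfl
  · exact congrArg v (Subsingleton.elim _ _)

theorem DRel.definable₂ {R : M → M → Prop} [hR : DRel R] :
    (Set.univ : Set M).Definable₂ setLang {p : M × M | R p.1 p.2} := by
  obtain ⟨ι, fin, φ, t, ht, hφ⟩ := hR.out.out
  have key : ∀ i, ∃ j : (Set.univ : Set M) ⊕ Fin 2, ∀ x : Env₂ M,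
      t i x = Sum.elim Subtype.val ![x.pre.var, x.var] j := by
    intro i
    rcases ht i with h | ⟨_, h' | ⟨s, -, h'⟩, h⟩
    · exact ⟨Sum.inr 1, fun x => congrFun h x⟩
    · exact ⟨Sum.inr 0, fun x => by rw [h, h']; rfl⟩
    · exact ⟨Sum.inl ⟨s ⟨⟩, trivial⟩, fun x => by rw [h, h']; rfl⟩
  choose g hg using key
  rw [Set.Definable₂, Set.definable_iff_exists_formula_sum]
  refine ⟨φ.relabel g, Set.ext fun v => ?_⟩
  refine (hφ ⟨⟨⟨⟩, v 0⟩, v 1⟩).trans ?_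
  refine Iff.trans ?_ Formula.realize_relabel.symm
  refine iff_of_eq (congrArg φ.Realize (funext fun i => ?_))
  rw [hg]
  simp only [Function.comp_apply]
  rcases g i with c | j
  · rfl
  · fin_cases j <;> rfl

end Pars

/-! ### Basic operations on sets -/

/-- `M` is a model of ZF. -/
class ZF (M : Type u) [setLang.Structure M] : Prop where
  isModel : IsModelZF M

section Basic

variable {M : Type u} [S : setLang.Structure M] [Z : ZF M]

theorem ext {a b : M} (h : ∀ z, z ∊ a ↔ z ∊ b) : a = b := Z.isModel.extensionality a b h

theorem exists_sep (P : M → Prop) [DPred P] (a : M) : ∃ b, ∀ z, z ∊ b ↔ z ∊ a ∧ P z :=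
  Z.isModel.separation {z | P z} DPred.definable₁ a

theorem exists_img (F : M → M) [DFun F] (a : M) : ∃ b, ∀ y, y ∊ b ↔ ∃ x, x ∊ a ∧ y = F x :=
  Z.isModel.replacement (fun x y => y = F x)
    (DRel.definable₂ (R := fun x y => y = F x)) a fun x _ => ⟨F x, rfl, fun _ h => h⟩

omit Z in
open Classical in
/-- The set of all `z ∈ a` such that `P z`, if it exists, and `a` otherwise. Its existence is not
an argument, in order that the operation may be used inside definable terms. -/
noncomputable def sep (a : M) (P : M → Prop) : M :=
  if h : ∃ b, ∀ z, z ∊ b ↔ z ∊ a ∧ P z then h.choose else a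

omit Z in
open Classical in
/-- The set of all `F x` for `x ∈ a`, if it exists, and `a` otherwise. -/
noncomputable def img (a : M) (F : M → M) : M :=
  if h : ∃ b, ∀ y, y ∊ b ↔ ∃ x, x ∊ a ∧ y = F x then h.choose else a

theorem mem_sep {P : M → Prop} [DPred P] {a z : M} : z ∊ sep a P ↔ z ∊ a ∧ P z := by
  have h := exists_sep P a
  rw [sep, dif_pos h]
  exact h.choose_spec z

theorem mem_img {F : M → M} [DFun F] {a y : M} : y ∊ img a F ↔ ∃ x, x ∊ a ∧ y = F x := by
  have h := exists_img F a
  rw [img, dif_pos h]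
  exact h.choose_spec y

variable {Γ : Type w} [hC : PCtx Γ M]

instance {a : Γ → M} [DTerm a] {P : Γ → M → Prop}
    [h : Dfn (fun x : Ext (fun _ : Γ => M) => P x.pre x.var)] :
    DTerm (fun x => sep (a x) (P x)) := by
  have : Dfn (fun x : Ext (fun _ : Ext (fun _ : Γ => M) => M) => P x.pre.pre x.var) := Dfn.drop h
  refine ⟨Dfn.congr (Q := fun x : Ext (fun _ : Γ => M) =>
    ∀ z : M, z ∊ x.var ↔ z ∊ a x.pre ∧ P x.pre z) fun x => ?_⟩
  have := Dfn.dpred h x.pre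
  exact ⟨fun e z => by rw [e, mem_sep], fun e => ext fun z => by rw [e, mem_sep]⟩

instance {a : Γ → M} [DTerm a] {F : Γ → M → M}
    [h : DTerm (fun x : Ext (fun _ : Γ => M) => F x.pre x.var)] :
    DTerm (fun x => img (a x) (F x)) := by
  have : DTerm (fun x : Ext (fun _ : Ext (fun _ : Γ => M) => M) => F x.pre.pre x.var) :=
    DTerm.drop h
  have : DTerm (fun x : Ext (fun _ : Ext (fun _ : Ext (fun _ : Γ => M) => M) => M) =>
      F x.pre.pre.pre x.var) := DTerm.drop (F := fun x : Ext (fun _ : Γ => M) => F x.pre) this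
  refine ⟨Dfn.congr (Q := fun x : Ext (fun _ : Γ => M) =>
    ∀ z : M, z ∊ x.var ↔ ∃ y, y ∊ a x.pre ∧ z = F x.pre y) fun x => ?_⟩
  have := DTerm.dfun h x.pre
  exact ⟨fun e z => by rw [e, mem_img], fun e => ext fun z => by rw [e, mem_img]⟩

variable (M) in
theorem exists_empty : ∃ e : M, IsEmptySet e :=
  let ⟨_, ⟨e, he, _⟩, _⟩ := Z.isModel.infinity
  ⟨e, he⟩

variable (M) in
/-- The empty set. -/
noncomputable def emp : M := (exists_empty M).choose

@[simp] theorem not_mem_emp (z : M) : ¬ z ∊ (emp M) := (exists_empty M).choose_spec z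

theorem isEmptySet_iff {a : M} : IsEmptySet a ↔ a = emp M :=
  ⟨fun h => ext fun z => ⟨fun hz => (h z hz).elim, fun hz => (not_mem_emp z hz).elim⟩,
    fun h => h ▸ not_mem_emp⟩

theorem exists_mem_of_ne_emp {a : M} (h : a ≠ emp M) : ∃ z, z ∊ a := by
  by_contra hc
  exact h (isEmptySet_iff.1 fun z hz => hc ⟨z, hz⟩)

/-- The unordered pair `{a, b}`. -/
noncomputable def upair (a b : M) : M := (Z.isModel.pairing a b).choose

@[simp] theorem mem_upair {a b z : M} : z ∊ upair a b ↔ z = a ∨ z = b :=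
  (Z.isModel.pairing a b).choose_spec z

theorem isUPair_iff {c a b : M} : IsUPair c a b ↔ c = upair a b :=
  ⟨fun h => ext fun z => (h z).trans mem_upair.symm, fun h => h ▸ fun _ => mem_upair⟩

/-- The union `⋃ a`. -/
noncomputable def sUnion (a : M) : M := (Z.isModel.union a).choose

@[simp] theorem mem_sUnion {a z : M} : z ∊ sUnion a ↔ ∃ y, y ∊ a ∧ z ∊ y :=
  (Z.isModel.union a).choose_spec z

/-- The power set of `a`. -/
noncomputable def pow (a : M) : M := (Z.isModel.powerset a).choose

@[simp] theorem mem_pow {a z : M} : z ∊ pow a ↔ IsSub z a := (Z.isModel.powerset a).choose_spec z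

/-- The union `a ∪ b`. -/
noncomputable def cup (a b : M) : M := sUnion (upair a b)

@[simp] theorem mem_cup {a b z : M} : z ∊ cup a b ↔ z ∊ a ∨ z ∊ b := by
  simp only [cup, mem_sUnion, mem_upair, or_and_right, exists_or, exists_eq_left]

/-- The singleton `{a}`. -/
noncomputable def single (a : M) : M := upair a a

@[simp] theorem mem_single {a z : M} : z ∊ single a ↔ z = a := by simp [single]

/-- The successor `a ∪ {a}`. -/
noncomputable def succ (a : M) : M := cup a (single a)

@[simp] theorem mem_succ {a z : M} : z ∊ succ a ↔ z ∊ a ∨ z = a := by simp [succ]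

theorem isSucc_iff {s a : M} : IsSucc s a ↔ s = succ a :=
  ⟨fun h => ext fun z => (h z).trans mem_succ.symm, fun h => h ▸ fun _ => mem_succ⟩

/-- The ordered pair `⟨a, b⟩`. -/
noncomputable def opair (a b : M) : M := upair (single a) (upair a b)

theorem isOPair_iff {c a b : M} : IsOPair c a b ↔ c = opair a b := by
  simp only [IsOPair, isUPair_iff, opair, single]
  simp

theorem upair_inj_left {a b c : M} (h : upair a b = upair a c) : b = c := by
  have h₁ : b ∊ upair a c := h ▸ mem_upair.2 (Or.inr rfl)
  have h₂ : c ∊ upair a b := h ▸ mem_upair.2 (Or.inr rfl)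
  rw [mem_upair] at h₁ h₂
  rcases h₁ with rfl | rfl
  · rcases h₂ with rfl | rfl <;> rfl
  · rfl

theorem opair_inj {a b c d : M} : opair a b = opair c d ↔ a = c ∧ b = d := by
  refine ⟨fun h => ?_, by rintro ⟨rfl, rfl⟩; rfl⟩
  have hac : a = c := by
    have h₁ : single c ∊ opair a b := h ▸ mem_upair.2 (Or.inl rfl)
    rcases mem_upair.1 h₁ with e | e
    · exact (mem_single.1 (e ▸ mem_single.2 rfl : c ∊ single a)).symm
    · exact mem_single.1 (e.symm ▸ mem_upair.2 (Or.inl rfl) : a ∊ single c)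
  subst hac
  exact ⟨rfl, upair_inj_left (upair_inj_left h)⟩

theorem inRel_iff {r a b : M} : InRel r a b ↔ opair a b ∊ r := by
  simp [InRel, isOPair_iff]

section Instances

variable {a b c : Γ → M} [DTerm a] [DTerm b] [DTerm c]

instance : DTerm (fun x => upair (a x) (b x)) :=
  ⟨Dfn.congr (Q := fun x : Ext (fun _ : Γ => M) => IsUPair x.var (a x.pre) (b x.pre))
    fun _ => isUPair_iff.symm⟩

instance : DTerm (fun x => single (a x)) := by unfold single; infer_instance

instance : DTerm (fun x => opair (a x) (b x)) := by unfold opair; infer_instance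

instance : DTerm (fun x => sUnion (a x)) :=
  ⟨Dfn.congr (Q := fun x : Ext (fun _ : Γ => M) => ∀ z : M, z ∊ x.var ↔ ∃ y, y ∊ a x.pre ∧ z ∊ y)
    fun _ => ⟨fun h => h ▸ fun _ => mem_sUnion, fun h => ext fun z => (h z).trans mem_sUnion.symm⟩⟩

instance : DTerm (fun x => pow (a x)) :=
  ⟨Dfn.congr (Q := fun x : Ext (fun _ : Γ => M) => ∀ z : M, z ∊ x.var ↔ IsSub z (a x.pre))
    fun _ => ⟨fun h => h ▸ fun _ => mem_pow, fun h => ext fun z => (h z).trans mem_pow.symm⟩⟩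

instance : DTerm (fun x => cup (a x) (b x)) := by unfold cup; infer_instance

instance : DTerm (fun x => succ (a x)) := by unfold succ; infer_instance

end Instances

/-- The product `a × b`. -/
noncomputable def prod (a b : M) : M := sUnion (img a fun x => img b fun y => opair x y)

theorem mem_prod {a b z : M} : z ∊ prod a b ↔ ∃ x y, x ∊ a ∧ y ∊ b ∧ z = opair x y := by
  simp only [prod, mem_sUnion, mem_img]
  constructor
  · rintro ⟨_, ⟨x, hx, rfl⟩, hz⟩
    obtain ⟨y, hy, rfl⟩ := mem_img.1 hz
    exact ⟨x, y, hx, hy, rfl⟩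
  · rintro ⟨x, y, hx, hy, rfl⟩
    exact ⟨_, ⟨x, hx, rfl⟩, mem_img.2 ⟨y, hy, rfl⟩⟩

@[simp] theorem opair_mem_prod {a b x y : M} : opair x y ∊ prod a b ↔ x ∊ a ∧ y ∊ b := by
  rw [mem_prod]
  constructor
  · rintro ⟨x', y', hx, hy, e⟩
    obtain ⟨rfl, rfl⟩ := opair_inj.1 e
    exact ⟨hx, hy⟩
  · rintro ⟨hx, hy⟩
    exact ⟨x, y, hx, hy, rfl⟩

instance {a b : Γ → M} [DTerm a] [DTerm b] : DTerm (fun x => prod (a x) (b x)) := by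
  unfold prod; infer_instance

/-- The restriction of the class function `F` to the set `a`, as a set of pairs. -/
noncomputable def graph (a : M) (F : M → M) : M := img a fun x => opair x (F x)

theorem mem_graph {F : M → M} [DFun F] {a z : M} :
    z ∊ graph a F ↔ ∃ x, x ∊ a ∧ z = opair x (F x) := by rw [graph, mem_img]

theorem inRel_graph {F : M → M} [DFun F] {a x y : M} :
    InRel (graph a F) x y ↔ x ∊ a ∧ y = F x := by
  rw [inRel_iff, mem_graph]
  constructor
  · rintro ⟨x', hx, e⟩
    obtain ⟨rfl, rfl⟩ := opair_inj.1 e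
    exact ⟨hx, rfl⟩
  · rintro ⟨hx, rfl⟩
    exact ⟨x, hx, rfl⟩

instance {a : Γ → M} [DTerm a] {F : Γ → M → M}
    [h : DTerm (fun x : Ext (fun _ : Γ => M) => F x.pre x.var)] :
    DTerm (fun x => graph (a x) (F x)) := by
  unfold graph; infer_instance

theorem isFun_graph {F : M → M} [DFun F] {a b : M} (h : ∀ x, x ∊ a → F x ∊ b) :
    IsFun (graph a F) a b := by
  refine ⟨fun c hc => ?_,
    fun x hx => ⟨F x, inRel_graph.2 ⟨hx, rfl⟩, fun y hy => (inRel_graph.1 hy).2⟩⟩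
  obtain ⟨x, hx, rfl⟩ := mem_graph.1 hc
  exact ⟨x, F x, hx, h x hx, isOPair_iff.2 rfl⟩

open Classical in
/-- The unique `y` such that `P y`, and `∅` if there is none. -/
noncomputable def the (P : M → Prop) : M := if h : ∃! y, P y then h.choose else emp M

theorem the_eq {P : M → Prop} (h : ∃! y, P y) {y : M} (hy : P y) : the P = y := by
  rw [the, dif_pos h]
  exact h.unique h.choose_spec.1 hy

theorem the_eq_of_iff {P : M → Prop} {a : M} (h : ∀ y, P y ↔ y = a) : the P = a :=
  the_eq ⟨a, (h a).2 rfl, fun y hy => (h y).1 hy⟩ ((h a).2 rfl)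

theorem the_spec {P : M → Prop} (h : ∃! y, P y) : P (the P) := by
  rw [the, dif_pos h]
  exact h.choose_spec.1

instance {P : Γ → M → Prop} [h : Dfn (fun x : Ext (fun _ : Γ => M) => P x.pre x.var)] :
    DTerm (fun x => the (P x)) := by
  have h₁ : Dfn (fun x : Ext (fun _ : Ext (fun _ : Γ => M) => M) => P x.pre.pre x.var) := h.drop
  have h₂ : Dfn (fun x : Ext (fun _ : Ext (fun _ : Ext (fun _ : Γ => M) => M) => M) =>
      P x.pre.pre.pre x.var) := h₁.drop
  refine ⟨Dfn.congr (Q := fun x : Ext (fun _ : Γ => M) =>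
    (P x.pre x.var ∧ ∃! y, P x.pre y) ∨ ((¬ ∃! y, P x.pre y) ∧ x.var = emp M)) fun x => ?_⟩
  by_cases h : ∃! y, P x.pre y
  · refine ⟨fun e => Or.inl ⟨e ▸ the_spec h, h⟩, ?_⟩
    rintro (⟨h', -⟩ | ⟨h', -⟩)
    · exact (the_eq h h').symm
    · exact (h' h).elim
  · rw [the, dif_neg h]
    tauto

/-- The value `f(x)` of the function `f`, and `∅` if it is not determined. -/
noncomputable def app (f x : M) : M := the (InRel f x)

theorem app_eq {f x y : M} (h : ∃! y, InRel f x y) (hy : InRel f x y) : app f x = y :=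
  the_eq h hy

instance {a b : Γ → M} [DTerm a] [DTerm b] : DTerm (fun x => app (a x) (b x)) := by
  unfold app; infer_instance

theorem IsFun.inRel_app {f a b x : M} (hf : IsFun f a b) (hx : x ∊ a) : InRel f x (app f x) := by
  obtain ⟨y, hy, -⟩ := id (hf.2 x hx)
  rwa [app_eq (hf.2 x hx) hy]

theorem IsFun.mem {f a b x y : M} (hf : IsFun f a b) (h : InRel f x y) : x ∊ a ∧ y ∊ b := by
  obtain ⟨c, hc, hcf⟩ := h
  obtain ⟨x', y', hx, hy, hc'⟩ := hf.1 c hcf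
  obtain ⟨rfl, rfl⟩ := opair_inj.1 ((isOPair_iff.1 hc).symm.trans (isOPair_iff.1 hc'))
  exact ⟨hx, hy⟩

theorem IsFun.inRel_iff {f a b x y : M} (hf : IsFun f a b) : InRel f x y ↔ x ∊ a ∧ y = app f x :=
  ⟨fun h => ⟨(hf.mem h).1, (app_eq (hf.2 x (hf.mem h).1) h).symm⟩,
    fun h => h.2 ▸ hf.inRel_app h.1⟩

theorem IsFun.app_mem {f a b x : M} (hf : IsFun f a b) (hx : x ∊ a) : app f x ∊ b :=
  (hf.mem (hf.inRel_app hx)).2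

theorem IsFun.eq_graph {f a b : M} (hf : IsFun f a b) : f = graph a (app f) := by
  refine ext fun c => ⟨fun hc => ?_, fun hc => ?_⟩
  · obtain ⟨x, y, hx, hy, h⟩ := hf.1 c hc
    exact mem_graph.2 ⟨x, hx, (isOPair_iff.1 h).trans (by rw [app_eq (hf.2 x hx) ⟨c, h, hc⟩])⟩
  · obtain ⟨x, hx, rfl⟩ := mem_graph.1 hc
    exact ZFModel.inRel_iff.1 (hf.inRel_app hx)

theorem graph_congr {F G : M → M} [DFun F] [DFun G] {a : M} (h : ∀ x, x ∊ a → F x = G x) :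
    graph a F = graph a G :=
  ext fun z => by
    rw [mem_graph, mem_graph]
    exact exists_congr fun x => and_congr_right fun hx => by rw [h x hx]

theorem app_graph {F : M → M} [DFun F] {a x : M} (hx : x ∊ a) : app (graph a F) x = F x :=
  app_eq ⟨F x, inRel_graph.2 ⟨hx, rfl⟩, fun _ h => (inRel_graph.1 h).2⟩ (inRel_graph.2 ⟨hx, rfl⟩)

end Basic

section Ordinals

variable {M : Type u} [S : setLang.Structure M] [Z : ZF M]

/-! ### Ordinals -/

/-- Foundation, for definable subclasses of a set. -/
theorem exists_minimal (P : M → Prop) [DPred P] {a z : M} (hz : z ∊ a) (hP : P z) :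
    ∃ y, y ∊ a ∧ P y ∧ ∀ x, x ∊ y → x ∊ a → ¬ P x := by
  obtain ⟨y, hy, hmin⟩ := Z.isModel.foundation (sep a P) ⟨z, mem_sep.2 ⟨hz, hP⟩⟩
  obtain ⟨hya, hyP⟩ := mem_sep.1 hy
  exact ⟨y, hya, hyP, fun x hx hxa hxP => hmin x (mem_sep.2 ⟨hxa, hxP⟩) hx⟩

theorem mem_irrefl (a : M) : ¬ a ∊ a := by
  intro h
  obtain ⟨z, hz, hmin⟩ := Z.isModel.foundation (single a) ⟨a, mem_single.2 rfl⟩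
  obtain rfl := mem_single.1 hz
  exact hmin z (mem_single.2 rfl) h

theorem mem_asymm {a b : M} (h : a ∊ b) : ¬ b ∊ a := by
  intro h'
  obtain ⟨z, hz, hmin⟩ := Z.isModel.foundation (upair a b) ⟨a, mem_upair.2 (Or.inl rfl)⟩
  rcases mem_upair.1 hz with rfl | rfl
  · exact hmin b (mem_upair.2 (Or.inr rfl)) h'
  · exact hmin a (mem_upair.2 (Or.inl rfl)) h

omit Z in
theorem IsSub.refl (a : M) : IsSub a a := fun _ h => h

omit Z in
theorem IsSub.trans {a b c : M} (h : IsSub a b) (h' : IsSub b c) : IsSub a c :=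
  fun z hz => h' z (h z hz)

omit Z in
theorem IsOrd.trans {α β γ : M} (h : IsOrd α) (hβ : β ∊ α) (hγ : γ ∊ β) : γ ∊ α := h.1 β hβ γ hγ

omit Z in
theorem IsOrd.mem {α β : M} (h : IsOrd α) (hβ : β ∊ α) : IsOrd β :=
  ⟨h.2 β hβ, fun y hy => h.2 y (h.1 β hβ y hy)⟩

theorem IsOrd.succ {α : M} (h : IsOrd α) : IsOrd (succ α) := by
  constructor
  · intro y hy z hz
    rcases mem_succ.1 hy with hy | rfl
    exacts [mem_succ.2 (Or.inl (h.1 y hy z hz)), mem_succ.2 (Or.inl hz)]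
  · intro y hy
    rcases mem_succ.1 hy with hy | rfl
    exacts [h.2 y hy, h.1]

theorem isOrd_sUnion {a : M} (h : ∀ x, x ∊ a → IsOrd x) : IsOrd (sUnion a) := by
  constructor
  · intro y hy z hz
    obtain ⟨x, hx, hyx⟩ := mem_sUnion.1 hy
    exact mem_sUnion.2 ⟨x, hx, (h x hx).trans hyx hz⟩
  · intro y hy
    obtain ⟨x, hx, hyx⟩ := mem_sUnion.1 hy
    exact (h x hx).2 y hyx

theorem ord_induction (P : M → Prop) [DPred P]
    (h : ∀ α, IsOrd α → (∀ β, β ∊ α → P β) → P α) {α : M} (hα : IsOrd α) : P α := by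
  by_contra hc
  obtain ⟨β, hβ, hPβ, hmin⟩ := exists_minimal (fun x => ¬ P x) (mem_succ.2 (Or.inr rfl)) hc
  have hoβ := hα.succ.mem hβ
  exact hPβ (h β hoβ fun γ hγ => not_not.1 (hmin γ hγ (hα.succ.trans hβ hγ)))

theorem exists_least_ord (P : M → Prop) [DPred P] {α : M} (hα : IsOrd α) (h : P α) :
    ∃ β, IsOrd β ∧ P β ∧ ∀ γ, γ ∊ β → ¬ P γ := by
  obtain ⟨β, hβ, hPβ, hmin⟩ := exists_minimal P (mem_succ.2 (Or.inr rfl)) h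
  exact ⟨β, hα.succ.mem hβ, hPβ, fun γ hγ => hmin γ hγ (hα.succ.trans hβ hγ)⟩

theorem IsOrd.trichotomy {α β : M} (hα : IsOrd α) (hβ : IsOrd β) : α ∊ β ∨ α = β ∨ β ∊ α := by
  refine ord_induction (fun α => ∀ β : M, IsOrd β → α ∊ β ∨ α = β ∨ β ∊ α) ?_ hα β hβ
  intro α hα ihα β hβ
  refine ord_induction (fun β => α ∊ β ∨ α = β ∨ β ∊ α) ?_ hβ
  intro β hβ ihβ
  by_contra hc
  rw [not_or, not_or] at hc
  obtain ⟨h₁, h₂, h₃⟩ := hc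
  refine h₂ (ext fun z => ⟨fun hz => ?_, fun hz => ?_⟩)
  · rcases ihα z hz β hβ with h | rfl | h
    exacts [h, (h₃ hz).elim, (h₃ (hα.trans hz h)).elim]
  · rcases ihβ z hz with h | rfl | h
    exacts [(h₁ (hβ.trans hz h)).elim, (h₁ hz).elim, h]

theorem IsOrd.mem_or_sub {α β : M} (hα : IsOrd α) (hβ : IsOrd β) : α ∊ β ∨ IsSub β α := by
  rcases hα.trichotomy hβ with h | rfl | h
  exacts [Or.inl h, Or.inr (IsSub.refl _), Or.inr (hα.1 β h)]

theorem IsOrd.mem_of_sub_of_ne {α β : M} (hα : IsOrd α) (hβ : IsOrd β) (h : IsSub α β)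
    (hne : α ≠ β) : α ∊ β := by
  rcases hα.trichotomy hβ with h' | rfl | h'
  exacts [h', (hne rfl).elim, (mem_irrefl β (h β h')).elim]

theorem IsOrd.sub_iff {α β : M} (hα : IsOrd α) (hβ : IsOrd β) : IsSub α β ↔ α ∊ ZFModel.succ β := by
  rw [mem_succ]
  refine ⟨fun h => or_iff_not_imp_right.2 fun hne => hα.mem_of_sub_of_ne hβ h hne, ?_⟩
  rintro (h | rfl)
  exacts [hβ.1 α h, IsSub.refl _]

omit Z in
theorem isOrd_of_transitive {a : M} (ht : IsTransSet a) (h : ∀ x, x ∊ a → IsOrd x) : IsOrd a :=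
  ⟨ht, fun x hx => (h x hx).1⟩

theorem isOrd_emp : IsOrd (emp M) :=
  ⟨fun y hy => (not_mem_emp y hy).elim, fun y hy => (not_mem_emp y hy).elim⟩

/-- Any two ordinals have an upper bound among the two. -/
theorem IsOrd.exists_sup {α β : M} (hα : IsOrd α) (hβ : IsOrd β) :
    ∃ γ, (γ = α ∨ γ = β) ∧ IsOrd γ ∧ IsSub α γ ∧ IsSub β γ := by
  rcases hα.mem_or_sub hβ with h | h
  · exact ⟨β, Or.inr rfl, hβ, hβ.1 α h, IsSub.refl _⟩
  · exact ⟨α, Or.inl rfl, hα, IsSub.refl _, h⟩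

/-! ### Recursion -/

/-- Recursion along a definable relation: if the predecessors of each `x` form the set `pr x`, and
proofs by induction along this relation are possible for definable classes, then a definable class
function may be given by its values in terms of the values at the predecessors. -/
theorem exists_rec (pr : M → M) [DFun pr] (G : M → M → M) [DFun₂ G]
    (hind : ∀ (P : M → Prop) [DPred P], (∀ x, (∀ y, y ∊ pr x → P y) → P x) → ∀ x, P x) :
    ∃ F : M → M, DFun F ∧ ∀ x, F x = G x (graph (pr x) F) := by
  let Closed : M → Prop := fun d => ∀ x, x ∊ d → ∀ y, y ∊ pr x → y ∊ d
  have dClosed : DPred Closed := by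
    show DPred fun d => ∀ x, x ∊ d → ∀ y, y ∊ pr x → y ∊ d
    infer_instance
  -- the closure of a point under predecessors is a set
  have hcl : ∀ x, ∃ d, Closed d ∧ x ∊ d := by
    let cl : M → M := fun y => the fun c => ∀ z, z ∊ c ↔ ∀ d, Closed d → y ∊ d → z ∊ d
    have dcl : DFun cl := by
      show DFun fun y => the fun c => ∀ z, z ∊ c ↔ ∀ d, Closed d → y ∊ d → z ∊ d
      infer_instance
    refine hind (fun x => ∃ d, Closed d ∧ x ∊ d) fun x ih => ?_
    have hcl : ∀ y, y ∊ pr x → ∀ z, z ∊ cl y ↔ ∀ d, Closed d → y ∊ d → z ∊ d := by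
      intro y hy
      obtain ⟨d, hd, hyd⟩ := ih y hy
      refine the_spec (P := fun c => ∀ z, z ∊ c ↔ ∀ d, Closed d → y ∊ d → z ∊ d)
        ⟨sep d fun z => ∀ d, Closed d → y ∊ d → z ∊ d, fun z => ?_, fun c hc => ext fun z => ?_⟩
      · rw [mem_sep]
        exact ⟨fun h => h.2, fun h => ⟨h d hd hyd, h⟩⟩
      · rw [hc, mem_sep]
        exact ⟨fun h => ⟨h d hd hyd, h⟩, fun h => h.2⟩
    refine ⟨cup (single x) (sUnion (img (pr x) cl)), fun z hz y hy => ?_,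
      mem_cup.2 (Or.inl (mem_single.2 rfl))⟩
    refine mem_cup.2 (Or.inr (mem_sUnion.2 ?_))
    rcases mem_cup.1 hz with hz | hz
    · obtain rfl := mem_single.1 hz
      exact ⟨cl y, mem_img.2 ⟨y, hy, rfl⟩, (hcl y hy y).2 fun d _ h => h⟩
    · obtain ⟨_, h, hz⟩ := mem_sUnion.1 hz
      obtain ⟨v, hv, rfl⟩ := mem_img.1 h
      exact ⟨cl v, h, (hcl v hv y).2 fun d hd hvd => hd z ((hcl v hv z).1 hz d hd hvd) y hy⟩
  -- the functions that satisfy the recursion equation on a closed set; any two of them agree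
  let Appr : M → M → Prop := fun f d => Closed d ∧
    ∀ x, x ∊ d → app f x = G x (graph (pr x) (app f))
  have dAppr : DRel Appr := by
    show DRel fun f d => Closed d ∧ ∀ x, x ∊ d → app f x = G x (graph (pr x) fun z => app f z)
    infer_instance
  have huniq : ∀ f d f' d', Appr f d → Appr f' d' → ∀ x, x ∊ d → x ∊ d' → app f x = app f' x := by
    intro f d f' d' h h'
    refine hind (fun x => x ∊ d → x ∊ d' → app f x = app f' x) fun x ih hx hx' => ?_
    rw [h.2 x hx, h'.2 x hx', graph_congr fun y hy => ih y hy (h.1 x hx y hy) (h'.1 x hx' y hy)]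
  let Val : M → M → Prop := fun x y => ∃ f d, Appr f d ∧ x ∊ d ∧ y = app f x
  have dVal : DRel Val := by
    show DRel fun x y => ∃ f d, Appr f d ∧ x ∊ d ∧ y = app f x
    infer_instance
  let F : M → M := fun x => the fun y => Val x y
  have dF : DFun F := by
    show DFun fun x : M => the (Val x)
    infer_instance
  have hF : ∀ f d x, Appr f d → x ∊ d → F x = app f x := by
    intro f d x h hx
    have hv : Val x (app f x) := ⟨f, d, h, hx, rfl⟩
    refine the_eq (P := Val x) ⟨_, hv, ?_⟩ hv
    rintro _ ⟨f', d', h', hx', rfl⟩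
    exact huniq f' d' f d h' h x hx' hx
  have hF' : ∀ f d x, Appr f d → x ∊ d → F x = G x (graph (pr x) F) := by
    intro f d x h hx
    rw [hF f d x h hx, h.2 x hx]
    exact congrArg _ (graph_congr fun y hy => (hF f d y h (h.1 x hx y hy)).symm)
  refine ⟨F, dF, fun x => ?_⟩
  suffices h : ∃ f d, Appr f d ∧ x ∊ d by
    obtain ⟨f, d, h, hx⟩ := h
    exact hF' f d x h hx
  -- approximations defined at the predecessors of `x` are merged into one defined at `x`
  refine hind (fun x => ∃ f d, Appr f d ∧ x ∊ d) (fun x ih => ?_) x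
  obtain ⟨d, hd, hxd⟩ := hcl x
  let d' := cup (single x) (sep d fun z => ∃ f d, Appr f d ∧ z ∊ d)
  have hd' : ∀ z y, z ∊ d' → y ∊ pr z → y ∊ d ∧ ∃ f d, Appr f d ∧ y ∊ d := by
    intro z y hz hy
    rcases mem_cup.1 hz with hz | hz
    · obtain rfl := mem_single.1 hz
      exact ⟨hd z hxd y hy, ih y hy⟩
    · obtain ⟨hz, f, e, h, hze⟩ := mem_sep.1 hz
      exact ⟨hd z hz y hy, f, e, h, h.1 z hze y hy⟩
  have hclosed : Closed d' := fun z hz y hy => mem_cup.2 (Or.inr (mem_sep.2 (hd' z y hz hy)))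
  refine ⟨graph d' fun z => G z (graph (pr z) F), d', ⟨hclosed, fun z hz => ?_⟩,
    mem_cup.2 (Or.inl (mem_single.2 rfl))⟩
  rw [app_graph hz]
  refine congrArg _ (graph_congr fun y hy => ?_)
  obtain ⟨-, f, e, h, hye⟩ := hd' z y hz hy
  rw [app_graph (hclosed z hz y hy)]
  exact hF' f e y h hye

/-- Recursion on ordinals. -/
theorem exists_ord_rec (G : M → M → M) [DFun₂ G] :
    ∃ F : M → M, DFun F ∧ ∀ α, IsOrd α → F α = G α (graph α F) := by
  obtain ⟨F, dF, hF⟩ := exists_rec (fun x => sep x fun _ => IsOrd x) G fun P _ h x => by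
    have hord : ∀ α, IsOrd α → P α := fun α hα =>
      ord_induction P (fun α _ ih => h α fun y hy => ih y (mem_sep.1 hy).1) hα
    exact h x fun y hy => hord y ((mem_sep.1 hy).2.mem (mem_sep.1 hy).1)
  refine ⟨F, dF, fun α hα => ?_⟩
  have e : (sep α fun _ => IsOrd α) = α := ext fun z => by
    rw [mem_sep]
    exact ⟨fun h => h.1, fun h => ⟨h, hα⟩⟩
  have := hF α
  rwa [e] at this

/-! ### The natural numbers -/

theorem isNat_emp : IsNat (emp M) :=
  ⟨isOrd_emp, Or.inl not_mem_emp, fun k hk => (not_mem_emp k hk).elim⟩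

theorem IsNat.succ {n : M} (h : IsNat n) : IsNat (succ n) := by
  refine ⟨h.1.succ, Or.inr ⟨n, isSucc_iff.2 rfl⟩, fun k hk => ?_⟩
  rcases mem_succ.1 hk with hk | rfl
  exacts [h.2.2 k hk, h.2.1]

omit Z in
theorem IsNat.mem {n m : M} (h : IsNat n) (hm : m ∊ n) : IsNat m :=
  ⟨h.1.mem hm, h.2.2 m hm, fun k hk => h.2.2 k (h.1.trans hm hk)⟩

theorem IsNat.cases {n : M} (h : IsNat n) : n = emp M ∨ ∃ m, IsNat m ∧ n = ZFModel.succ m := by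
  rcases h.2.1 with h0 | ⟨m, hm⟩
  · exact Or.inl (isEmptySet_iff.1 h0)
  · obtain rfl := isSucc_iff.1 hm
    exact Or.inr ⟨m, h.mem (mem_succ.2 (Or.inr rfl)), rfl⟩

theorem nat_induction (P : M → Prop) [DPred P] (h0 : P (emp M))
    (hs : ∀ n, IsNat n → P n → P (succ n)) {n : M} (hn : IsNat n) : P n := by
  refine ord_induction (fun n => IsNat n → P n) (fun n _ ih hn => ?_) hn.1 hn
  rcases hn.cases with rfl | ⟨m, hm, rfl⟩
  · exact h0
  · exact hs m hm (ih m (mem_succ.2 (Or.inr rfl)) hm)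

variable (M) in
theorem exists_omega : ∃ w : M, ∀ n, n ∊ w ↔ IsNat n := by
  obtain ⟨w, ⟨e, he, hew⟩, hw⟩ := Z.isModel.infinity
  obtain rfl := isEmptySet_iff.1 he
  refine ⟨sep w fun n => IsNat n, fun n => ?_⟩
  rw [mem_sep]
  refine ⟨fun h => h.2, fun h => ⟨nat_induction (fun n => n ∊ w) hew (fun n _ hn => ?_) h, h⟩⟩
  obtain ⟨s, hs, hsw⟩ := hw n hn
  exact isSucc_iff.1 hs ▸ hsw

variable (M) in
/-- The set `ω` of natural numbers. -/
noncomputable def omega : M := (exists_omega M).choose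

@[simp] theorem mem_omega {n : M} : n ∊ omega M ↔ IsNat n := (exists_omega M).choose_spec n

theorem isOmega_iff {w : M} : IsOmega w ↔ w = omega M :=
  ⟨fun h => ext fun z => (h z).trans mem_omega.symm, fun h => h ▸ fun _ => mem_omega⟩

theorem isOrd_omega : IsOrd (omega M) :=
  isOrd_of_transitive (fun _ hy _ hz => mem_omega.2 ((mem_omega.1 hy).mem hz))
    fun _ hx => (mem_omega.1 hx).1

/-! ### Limit ordinals and the cumulative hierarchy -/

/-- `l` is a limit ordinal (and not `0`). -/
def IsLim (l : M) : Prop := IsOrd l ∧ emp M ∊ l ∧ ∀ x, x ∊ l → succ x ∊ l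

theorem isLim_omega : IsLim (omega M) :=
  ⟨isOrd_omega, mem_omega.2 isNat_emp, fun _ hx => mem_omega.2 (mem_omega.1 hx).succ⟩

/-- The limit is the supremum of the sequence `F n = α + 1 + n`. -/
theorem exists_lim {α : M} (hα : IsOrd α) : ∃ l, IsLim l ∧ α ∊ l := by
  obtain ⟨F, dF, hF⟩ := exists_ord_rec fun β f : M =>
    cup (succ α) (sUnion (img β fun γ => succ (app f γ)))
  have hF' : ∀ β, IsOrd β → ∀ z, z ∊ F β ↔ z ∊ succ α ∨ ∃ γ, γ ∊ β ∧ z ∊ succ (F γ) := by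
    intro β hβ z
    rw [hF β hβ, mem_cup, mem_sUnion]
    refine or_congr Iff.rfl ⟨?_, ?_⟩
    · rintro ⟨y, hy, hz⟩
      obtain ⟨γ, hγ, rfl⟩ := mem_img.1 hy
      rw [app_graph hγ] at hz
      exact ⟨γ, hγ, hz⟩
    · rintro ⟨γ, hγ, hz⟩
      refine ⟨_, mem_img.2 ⟨γ, hγ, rfl⟩, ?_⟩
      rwa [app_graph hγ]
  have hord : ∀ β, IsOrd β → IsOrd (F β) := by
    intro β hβ
    refine ord_induction (fun β => IsOrd (F β)) (fun β hβ ih => ?_) hβ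
    refine isOrd_of_transitive (fun y hy z hz => ?_) fun y hy => ?_
    · rw [hF' β hβ] at hy ⊢
      rcases hy with hy | ⟨γ, hγ, hy⟩
      · exact Or.inl (hα.succ.trans hy hz)
      · exact Or.inr ⟨γ, hγ, (ih γ hγ).succ.trans hy hz⟩
    · rcases (hF' β hβ y).1 hy with hy | ⟨γ, hγ, hy⟩
      exacts [hα.succ.mem hy, (ih γ hγ).succ.mem hy]
  have hmem : ∀ z, z ∊ sUnion (img (omega M) F) ↔ ∃ n, IsNat n ∧ z ∊ F n := by
    intro z
    rw [mem_sUnion]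
    constructor
    · rintro ⟨y, hy, hz⟩
      obtain ⟨n, hn, rfl⟩ := mem_img.1 hy
      exact ⟨n, mem_omega.1 hn, hz⟩
    · rintro ⟨n, hn, hz⟩
      exact ⟨_, mem_img.2 ⟨n, mem_omega.2 hn, rfl⟩, hz⟩
  have hα0 : ∀ z, z ∊ succ α → z ∊ sUnion (img (omega M) F) := fun z hz =>
    (hmem z).2 ⟨emp M, isNat_emp, (hF' _ isOrd_emp z).2 (Or.inl hz)⟩
  refine ⟨sUnion (img (omega M) F), ⟨isOrd_sUnion fun x hx => ?_, hα0 _ ?_, fun x hx => ?_⟩,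
    hα0 _ (mem_succ.2 (Or.inr rfl))⟩
  · obtain ⟨n, hn, rfl⟩ := mem_img.1 hx
    exact hord n (mem_omega.1 hn).1
  · exact (isOrd_emp.sub_iff hα).1 fun z hz => (not_mem_emp z hz).elim
  · obtain ⟨n, hn, hx⟩ := (hmem x).1 hx
    refine (hmem _).2 ⟨succ n, hn.succ, (hF' _ hn.1.succ _).2
      (Or.inr ⟨n, mem_succ.2 (Or.inr rfl), ?_⟩)⟩
    refine (((hord n hn.1).mem hx).succ.sub_iff (hord n hn.1)).1 fun z hz => ?_
    rcases mem_succ.1 hz with hz | rfl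
    exacts [(hord n hn.1).trans hx hz, hx]

variable (M) in
theorem exists_hierarchy : ∃ F : M → M, DFun F ∧
    ∀ α, IsOrd α → ∀ z, z ∊ F α ↔ ∃ γ, γ ∊ α ∧ IsSub z (F γ) := by
  obtain ⟨F, dF, hF⟩ := exists_ord_rec fun β f : M => sUnion (img β fun γ => pow (app f γ))
  refine ⟨F, dF, fun α hα z => ?_⟩
  rw [hF α hα, mem_sUnion]
  constructor
  · rintro ⟨y, hy, hz⟩
    obtain ⟨γ, hγ, rfl⟩ := mem_img.1 hy
    rw [app_graph hγ, mem_pow] at hz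
    exact ⟨γ, hγ, hz⟩
  · rintro ⟨γ, hγ, hz⟩
    refine ⟨_, mem_img.2 ⟨γ, hγ, rfl⟩, ?_⟩
    rwa [app_graph hγ, mem_pow]

/-- The set `V_α`, for an ordinal `α`. -/
noncomputable def V (α : M) : M := (exists_hierarchy M).choose α

instance : DFun (V : M → M) := (exists_hierarchy M).choose_spec.1

theorem mem_V {α z : M} (hα : IsOrd α) : z ∊ V α ↔ ∃ γ, γ ∊ α ∧ IsSub z (V γ) :=
  (exists_hierarchy M).choose_spec.2 α hα z

theorem isV_iff {α v : M} : IsV α v ↔ IsOrd α ∧ v = V α := by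
  constructor
  · rintro ⟨hα, s, b, f, hs, hf, h, hv⟩
    obtain rfl := isSucc_iff.1 hs
    have key : ∀ β, IsOrd β → β ∊ succ α → app f β = V β := by
      intro β hβ
      refine ord_induction (fun β => β ∊ succ α → app f β = V β) (fun β hβ ih hβs => ?_) hβ
      refine ext fun z => (h β _ hβs (hf.inRel_app hβs) z).trans ?_
      rw [mem_V hβ]
      refine exists_congr fun γ => ⟨?_, ?_⟩
      · rintro ⟨t, hγ, ht, hz⟩
        rw [hf.inRel_iff] at ht
        obtain ⟨hγs, rfl⟩ := ht
        exact ⟨hγ, ih γ hγ hγs ▸ hz⟩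
      · rintro ⟨hγ, hz⟩
        have hγs := hα.succ.trans hβs hγ
        exact ⟨_, hγ, hf.inRel_app hγs, (ih γ hγ hγs).symm ▸ hz⟩
    obtain ⟨h₁, rfl⟩ := hf.inRel_iff.1 hv
    exact ⟨hα, key α hα h₁⟩
  · rintro ⟨hα, rfl⟩
    refine ⟨hα, succ α, img (succ α) V, graph (succ α) V, isSucc_iff.2 rfl,
      isFun_graph fun x hx => mem_img.2 ⟨x, hx, rfl⟩, fun β u hβ hu z => ?_,
      inRel_graph.2 ⟨mem_succ.2 (Or.inr rfl), rfl⟩⟩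
    obtain ⟨-, rfl⟩ := inRel_graph.1 hu
    rw [mem_V (hα.succ.mem hβ)]
    refine exists_congr fun γ => ⟨?_, ?_⟩
    · rintro ⟨hγ, hz⟩
      exact ⟨V γ, hγ, inRel_graph.2 ⟨hα.succ.trans hβ hγ, rfl⟩, hz⟩
    · rintro ⟨t, hγ, ht, hz⟩
      obtain ⟨-, rfl⟩ := inRel_graph.1 ht
      exact ⟨hγ, hz⟩

theorem V_mono {α β : M} (hα : IsOrd α) (hβ : IsOrd β) (h : IsSub α β) : IsSub (V α) (V β) :=
  fun _ hz =>
    let ⟨γ, hγ, hz⟩ := (mem_V hα).1 hz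
    (mem_V hβ).2 ⟨γ, h γ hγ, hz⟩

theorem V_trans {α y z : M} (hα : IsOrd α) (hz : z ∊ V α) (hy : y ∊ z) : y ∊ V α := by
  obtain ⟨γ, hγ, hz⟩ := (mem_V hα).1 hz
  exact V_mono (hα.mem hγ) hα (hα.1 γ hγ) y (hz y hy)

theorem V_sub {α y z : M} (hα : IsOrd α) (hz : z ∊ V α) (hy : IsSub y z) : y ∊ V α := by
  obtain ⟨γ, hγ, hz⟩ := (mem_V hα).1 hz
  exact (mem_V hα).2 ⟨γ, hγ, hy.trans hz⟩

theorem mem_V_of_sub {α γ z : M} (hα : IsOrd α) (hγ : γ ∊ α) (hz : IsSub z (V γ)) : z ∊ V α :=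
  (mem_V hα).2 ⟨γ, hγ, hz⟩

theorem ord_sub_V {α : M} (hα : IsOrd α) : IsSub α (V α) :=
  ord_induction (fun α => IsSub α (V α))
    (fun _ hα ih β hβ => (mem_V hα).2 ⟨β, hβ, ih β hβ⟩) hα

theorem ord_not_mem_V {α : M} (hα : IsOrd α) : ¬ α ∊ V α := by
  refine ord_induction (fun α => ¬ α ∊ V α) (fun α hα ih h => ?_) hα
  obtain ⟨γ, hγ, hs⟩ := (mem_V hα).1 h
  exact ih γ hγ (hs γ hγ)

theorem emp_mem_V {α : M} (hα : IsOrd α) (h : α ≠ emp M) : emp M ∊ V α := by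
  obtain ⟨γ, hγ⟩ := exists_mem_of_ne_emp h
  exact mem_V_of_sub hα hγ fun z hz => (not_mem_emp z hz).elim

theorem upair_sub_V {γ a b : M} (ha : a ∊ V γ) (hb : b ∊ V γ) : IsSub (upair a b) (V γ) :=
  fun z hz => by rcases mem_upair.1 hz with rfl | rfl <;> assumption

theorem opair_mem_V_succ {γ a b : M} (hγ : IsOrd γ) (ha : a ∊ V γ) (hb : b ∊ V γ) :
    opair a b ∊ V (succ (succ γ)) :=
  mem_V_of_sub hγ.succ.succ (mem_succ.2 (Or.inr rfl))
    (upair_sub_V (mem_V_of_sub hγ.succ (mem_succ.2 (Or.inr rfl)) (upair_sub_V ha ha))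
      (mem_V_of_sub hγ.succ (mem_succ.2 (Or.inr rfl)) (upair_sub_V ha hb)))

theorem IsLim.exists_bound {l a b : M} (hl : IsLim l) (ha : a ∊ V l) (hb : b ∊ V l) :
    ∃ γ, γ ∊ l ∧ IsOrd γ ∧ IsSub a (V γ) ∧ IsSub b (V γ) := by
  obtain ⟨γ, hγ, hz⟩ := (mem_V hl.1).1 ha
  obtain ⟨δ, hδ, hz'⟩ := (mem_V hl.1).1 hb
  have oγ := hl.1.mem hγ
  have oδ := hl.1.mem hδ
  obtain ⟨ε, e, oε, h₁, h₂⟩ := oγ.exists_sup oδ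
  exact ⟨ε, by rcases e with rfl | rfl <;> assumption, oε, hz.trans (V_mono oγ oε h₁),
    hz'.trans (V_mono oδ oε h₂)⟩

theorem IsLim.mem_V_succ {l γ z : M} (hl : IsLim l) (hγ : γ ∊ l) (hz : IsSub z (V γ)) :
    z ∊ V (succ γ) := mem_V_of_sub (hl.1.mem hγ).succ (mem_succ.2 (Or.inr rfl)) hz

theorem IsLim.opair_mem {l a b : M} (hl : IsLim l) (ha : a ∊ V l) (hb : b ∊ V l) :
    opair a b ∊ V l := by
  obtain ⟨γ, hγ, oγ, h₁, h₂⟩ := hl.exists_bound ha hb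
  have := opair_mem_V_succ oγ.succ (hl.mem_V_succ hγ h₁) (hl.mem_V_succ hγ h₂)
  have hs := hl.2.2 _ (hl.2.2 _ (hl.2.2 _ hγ))
  exact V_mono (hl.1.mem hs) hl.1 (hl.1.1 _ hs) _ this

theorem IsLim.prod_mem {l a b : M} (hl : IsLim l) (ha : a ∊ V l) (hb : b ∊ V l) :
    prod a b ∊ V l := by
  obtain ⟨γ, hγ, oγ, h₁, h₂⟩ := hl.exists_bound ha hb
  refine mem_V_of_sub hl.1 (hl.2.2 _ (hl.2.2 _ hγ)) fun z hz => ?_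
  obtain ⟨x, y, hx, hy, rfl⟩ := mem_prod.1 hz
  exact opair_mem_V_succ oγ (h₁ x hx) (h₂ y hy)

theorem V_mem {α β : M} (hβ : IsOrd β) (h : α ∊ β) : V α ∊ V β :=
  mem_V_of_sub hβ h (IsSub.refl _)

theorem ord_mem_V {α β : M} (hβ : IsOrd β) (h : α ∊ β) : α ∊ V β := ord_sub_V hβ α h

theorem IsLim.ne_emp {l : M} (hl : IsLim l) : l ≠ emp M := fun h =>
  not_mem_emp _ (h ▸ hl.2.1)

end Ordinals

section Formulas

variable {M : Type u} [S : setLang.Structure M] [Z : ZF M]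

/-! ### Formulas inside the model -/

variable (M) in
/-- The numeral `k` of `M`. -/
noncomputable def num : ℕ → M
  | 0 => emp M
  | k + 1 => succ (num k)

theorem isNumeral_iff {k : ℕ} {t : M} : IsNumeral k t ↔ t = num M k := by
  induction k generalizing t with
  | zero => exact isEmptySet_iff
  | succ k ih => simp [IsNumeral, ih, isSucc_iff, num]

theorem isNat_num (k : ℕ) : IsNat (num M k) := by
  induction k with
  | zero => exact isNat_emp
  | succ k ih => exact ih.succ

theorem num_mem_num {j k : ℕ} (h : j < k) : num M j ∊ num M k := by
  induction k with
  | zero => omega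
  | succ k ih =>
    rcases Nat.lt_succ_iff_lt_or_eq.1 h with h | rfl
    exacts [mem_succ.2 (Or.inl (ih h)), mem_succ.2 (Or.inr rfl)]

theorem num_inj {j k : ℕ} : num M j = num M k ↔ j = k := by
  refine ⟨fun h => ?_, congrArg _⟩
  rcases lt_trichotomy j k with h' | h' | h'
  · exact (mem_irrefl _ (h ▸ num_mem_num (M := M) h')).elim
  · exact h'
  · exact (mem_irrefl _ (h ▸ num_mem_num (M := M) h')).elim

/-- The code of `v_i ∈ v_j`. -/
noncomputable def memCode (i j : M) : M := opair (num M 0) (opair i j)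
/-- The code of `v_i = v_j`. -/
noncomputable def eqCode (i j : M) : M := opair (num M 1) (opair i j)
/-- The code of `¬ φ`. -/
noncomputable def negCode (φ : M) : M := opair (num M 2) φ
/-- The code of `φ ∧ ψ`. -/
noncomputable def andCode (φ ψ : M) : M := opair (num M 3) (opair φ ψ)
/-- The code of `∃ v_i φ`. -/
noncomputable def exCode (i φ : M) : M := opair (num M 4) (opair i φ)

theorem isMemCode_iff {c i j : M} : IsMemCode c i j ↔ c = memCode i j := by
  simp [IsMemCode, IsTagged, isNumeral_iff, isOPair_iff, memCode]
theorem isEqCode_iff {c i j : M} : IsEqCode c i j ↔ c = eqCode i j := by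
  simp [IsEqCode, IsTagged, isNumeral_iff, isOPair_iff, eqCode]
theorem isNegCode_iff {c φ : M} : IsNegCode c φ ↔ c = negCode φ := by
  simp [IsNegCode, IsTagged, isNumeral_iff, isOPair_iff, negCode]
theorem isAndCode_iff {c φ ψ : M} : IsAndCode c φ ψ ↔ c = andCode φ ψ := by
  simp [IsAndCode, IsTagged, isNumeral_iff, isOPair_iff, andCode]
theorem isExCode_iff {c i φ : M} : IsExCode c i φ ↔ c = exCode i φ := by
  simp [IsExCode, IsTagged, isNumeral_iff, isOPair_iff, exCode]

theorem formulaClosed_iff {T : M} : FormulaClosed T ↔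
    (∀ i j, IsNat i → IsNat j → memCode i j ∊ T) ∧ (∀ i j, IsNat i → IsNat j → eqCode i j ∊ T) ∧
    (∀ φ, φ ∊ T → negCode φ ∊ T) ∧ (∀ φ ψ, φ ∊ T → ψ ∊ T → andCode φ ψ ∊ T) ∧
    ∀ i φ, IsNat i → φ ∊ T → exCode i φ ∊ T := by
  simp only [FormulaClosed, isMemCode_iff, isEqCode_iff, isNegCode_iff, isAndCode_iff,
    isExCode_iff]
  refine ⟨fun ⟨h₁, h₂, h₃, h₄, h₅⟩ => ⟨fun i j hi hj => h₁ i j _ hi hj rfl,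
    fun i j hi hj => h₂ i j _ hi hj rfl, fun φ h => h₃ φ _ h rfl, fun φ ψ h h' => h₄ φ ψ _ h h' rfl,
    fun i φ hi h => h₅ i φ _ hi h rfl⟩, fun ⟨h₁, h₂, h₃, h₄, h₅⟩ => ⟨?_, ?_, ?_, ?_, ?_⟩⟩
  · rintro i j _ hi hj rfl
    exact h₁ i j hi hj
  · rintro i j _ hi hj rfl
    exact h₂ i j hi hj
  · rintro φ _ h rfl
    exact h₃ φ h
  · rintro φ ψ _ h h' rfl
    exact h₄ φ ψ h h'
  · rintro i φ _ hi h rfl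
    exact h₅ i φ hi h

theorem nat_mem_V_omega {n : M} (h : IsNat n) : n ∊ V (omega M) :=
  ord_mem_V isOrd_omega (mem_omega.2 h)

/-- The hereditarily finite sets are closed under the formation rules, so that the formulas form a
set. -/
theorem formulaClosed_V_omega : FormulaClosed (V (omega M)) := by
  have p : ∀ {k : ℕ} {a : M}, a ∊ V (omega M) → opair (num M k) a ∊ V (omega M) :=
    fun h => isLim_omega.opair_mem (nat_mem_V_omega (isNat_num _)) h
  exact formulaClosed_iff.2
    ⟨fun i j hi hj => p (isLim_omega.opair_mem (nat_mem_V_omega hi) (nat_mem_V_omega hj)),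
    fun i j hi hj => p (isLim_omega.opair_mem (nat_mem_V_omega hi) (nat_mem_V_omega hj)),
    fun φ h => p h, fun φ ψ h h' => p (isLim_omega.opair_mem h h'),
    fun i φ hi h => p (isLim_omega.opair_mem (nat_mem_V_omega hi) h)⟩

variable (M) in
/-- The set of all formulas. -/
noncomputable def Form : M := sep (V (omega M)) IsFormula

theorem mem_Form {c : M} : c ∊ Form M ↔ IsFormula c := by
  rw [Form, mem_sep]
  exact ⟨fun h => h.2, fun h => ⟨h _ formulaClosed_V_omega, h⟩⟩

theorem isFormula_memCode {i j : M} (hi : IsNat i) (hj : IsNat j) : IsFormula (memCode i j) :=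
  fun _ hT => (formulaClosed_iff.1 hT).1 i j hi hj
theorem isFormula_eqCode {i j : M} (hi : IsNat i) (hj : IsNat j) : IsFormula (eqCode i j) :=
  fun _ hT => (formulaClosed_iff.1 hT).2.1 i j hi hj
theorem IsFormula.neg {φ : M} (h : IsFormula φ) : IsFormula (negCode φ) :=
  fun T hT => (formulaClosed_iff.1 hT).2.2.1 φ (h T hT)
theorem IsFormula.and {φ ψ : M} (h : IsFormula φ) (h' : IsFormula ψ) : IsFormula (andCode φ ψ) :=
  fun T hT => (formulaClosed_iff.1 hT).2.2.2.1 φ ψ (h T hT) (h' T hT)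
theorem IsFormula.ex {i φ : M} (hi : IsNat i) (h : IsFormula φ) : IsFormula (exCode i φ) :=
  fun T hT => (formulaClosed_iff.1 hT).2.2.2.2 i φ hi (h T hT)

theorem formula_induction (P : M → Prop) [DPred P]
    (hmem : ∀ i j, IsNat i → IsNat j → P (memCode i j))
    (heq : ∀ i j, IsNat i → IsNat j → P (eqCode i j))
    (hneg : ∀ φ, IsFormula φ → P φ → P (negCode φ))
    (hand : ∀ φ ψ, IsFormula φ → IsFormula ψ → P φ → P ψ → P (andCode φ ψ))
    (hex : ∀ i φ, IsNat i → IsFormula φ → P φ → P (exCode i φ)) {c : M} (hc : IsFormula c) :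
    P c := by
  have mem : ∀ {c : M}, c ∊ sep (Form M) P ↔ IsFormula c ∧ P c := by
    intro c
    rw [mem_sep, mem_Form]
  refine (mem.1 (hc _ (formulaClosed_iff.2 ⟨fun i j hi hj => ?_, fun i j hi hj => ?_,
    fun φ h => ?_, fun φ ψ h h' => ?_, fun i φ hi h => ?_⟩))).2
  · exact mem.2 ⟨isFormula_memCode hi hj, hmem i j hi hj⟩
  · exact mem.2 ⟨isFormula_eqCode hi hj, heq i j hi hj⟩
  · rw [mem] at h ⊢
    exact ⟨h.1.neg, hneg φ h.1 h.2⟩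
  · rw [mem] at h h' ⊢
    exact ⟨h.1.and h'.1, hand φ ψ h.1 h'.1 h.2 h'.2⟩
  · rw [mem] at h ⊢
    exact ⟨h.1.ex hi, hex i φ hi h.1 h.2⟩

/-! ### Assignments -/

/-- The set of all assignments of elements of `A` to the variables. -/
noncomputable def asg (A : M) : M := sep (pow (prod (omega M) A)) fun s => IsFun s (omega M) A

theorem isFun_sub_prod {f a b : M} (h : IsFun f a b) : IsSub f (prod a b) := by
  intro c hc
  obtain ⟨x, y, hx, hy, e⟩ := h.1 c hc
  rw [isOPair_iff.1 e, opair_mem_prod]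
  exact ⟨hx, hy⟩

theorem mem_asg {A s : M} : s ∊ asg A ↔ IsFun s (omega M) A := by
  rw [asg, mem_sep, mem_pow]
  exact ⟨fun h => h.2, fun h => ⟨isFun_sub_prod h, h⟩⟩

theorem isAssign_iff {A s : M} : IsAssign s A ↔ s ∊ asg A := by
  simp [IsAssign, isOmega_iff, mem_asg]

instance {Γ : Type w} [PCtx Γ M] {a : Γ → M} [DTerm a] : DTerm (fun x => asg (a x)) := by
  unfold asg; infer_instance

theorem app_mem_of_asg {A s i : M} (hs : s ∊ asg A) (hi : IsNat i) : app s i ∊ A :=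
  (mem_asg.1 hs).app_mem (mem_omega.2 hi)

theorem inRel_asg_iff {A s i a : M} (hs : s ∊ asg A) (hi : IsNat i) :
    InRel s i a ↔ a = app s i := by
  rw [(mem_asg.1 hs).inRel_iff]
  exact ⟨fun h => h.2, fun h => ⟨mem_omega.2 hi, h⟩⟩

theorem asg_ext {A B s t : M} (hs : s ∊ asg A) (ht : t ∊ asg B)
    (h : ∀ i, IsNat i → app s i = app t i) : s = t := by
  rw [(mem_asg.1 hs).eq_graph, (mem_asg.1 ht).eq_graph]
  exact graph_congr fun x hx => h x (mem_omega.1 hx)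

theorem asg_mono {A B : M} (h : IsSub A B) : IsSub (asg A) (asg B) := by
  intro s hs
  rw [mem_asg] at hs ⊢
  refine ⟨fun c hc => ?_, hs.2⟩
  obtain ⟨x, y, hx, hy, e⟩ := hs.1 c hc
  exact ⟨x, y, hx, h y hy, e⟩

/-- The assignment that agrees with `s`, except that it maps `i` to `a`. -/
noncomputable def upd (s i a : M) : M :=
  graph (omega M) fun j => the fun y => (j = i ∧ y = a) ∨ (j ≠ i ∧ y = app s j)

instance {Γ : Type w} [PCtx Γ M] {a b c : Γ → M} [DTerm a] [DTerm b] [DTerm c] :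
    DTerm (fun x => upd (a x) (b x) (c x)) := by
  unfold upd; infer_instance

theorem app_upd_self {s i a : M} (hi : IsNat i) : app (upd s i a) i = a := by
  rw [upd, app_graph (mem_omega.2 hi)]
  exact the_eq_of_iff fun y => by simp

theorem app_upd_of_ne {s i j a : M} (hj : IsNat j) (hne : j ≠ i) :
    app (upd s i a) j = app s j := by
  rw [upd, app_graph (mem_omega.2 hj)]
  exact the_eq_of_iff fun y => by simp [hne]

theorem upd_mem_asg {A s i a : M} (hs : s ∊ asg A) (hi : IsNat i) (ha : a ∊ A) :
    upd s i a ∊ asg A := by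
  refine mem_asg.2 (isFun_graph fun j hj => ?_)
  by_cases h : j = i
  · subst h
    have := app_upd_self (s := s) (a := a) hi
    rw [upd, app_graph hj] at this
    rwa [this]
  · have := app_upd_of_ne (s := s) (a := a) (mem_omega.1 hj) h
    rw [upd, app_graph hj] at this
    rw [this]
    exact app_mem_of_asg hs (mem_omega.1 hj)

theorem isUpdate_iff {A s' s i a : M} (hs' : s' ∊ asg A) (hs : s ∊ asg A) (hi : IsNat i)
    (ha : a ∊ A) : IsUpdate s' s i a ↔ s' = upd s i a := by
  constructor
  · rintro ⟨h₁, h₂⟩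
    refine asg_ext hs' (upd_mem_asg hs hi ha) fun j hj => ?_
    by_cases e : j = i
    · subst e
      rw [app_upd_self hj, ← (inRel_asg_iff hs' hj).1 h₁]
    · rw [app_upd_of_ne hj e]
      exact (inRel_asg_iff hs hj).1 ((h₂ j hj e _).1 ((inRel_asg_iff hs' hj).2 rfl))
  · rintro rfl
    refine ⟨(inRel_asg_iff hs' hi).2 (app_upd_self hi).symm, fun j hj e y => ?_⟩
    rw [inRel_asg_iff hs' hj, inRel_asg_iff hs hj, app_upd_of_ne hj e]

/-! ### Satisfaction -/

/-- Tarski's clauses, in terms of operations. -/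
theorem isSatRel_iff {A R : M} : IsSatRel A R ↔ ∀ s, s ∊ asg A →
    (∀ i j, IsNat i → IsNat j → (InRel R (memCode i j) s ↔ app s i ∊ app s j)) ∧
    (∀ i j, IsNat i → IsNat j → (InRel R (eqCode i j) s ↔ app s i = app s j)) ∧
    (∀ φ, IsFormula φ → (InRel R (negCode φ) s ↔ ¬ InRel R φ s)) ∧
    (∀ φ ψ, IsFormula φ → IsFormula ψ →
      (InRel R (andCode φ ψ) s ↔ InRel R φ s ∧ InRel R ψ s)) ∧
    (∀ i φ, IsNat i → IsFormula φ →
      (InRel R (exCode i φ) s ↔ ∃ a, a ∊ A ∧ InRel R φ (upd s i a))) := by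
  unfold IsSatRel
  refine forall_congr' fun s => ?_
  rw [isAssign_iff]
  refine imp_congr_right fun hs => and_congr ?_ (and_congr ?_ (and_congr ?_ (and_congr ?_ ?_)))
  · refine forall₂_congr fun i j => ?_
    simp only [isMemCode_iff]
    refine ⟨fun h hi hj => (h _ hi hj rfl).trans ?_,
      fun h c hi hj hc => hc ▸ (h hi hj).trans ?_⟩ <;>
    · simp only [inRel_asg_iff hs hi, inRel_asg_iff hs hj]
      simp
  · refine forall₂_congr fun i j => ?_
    simp only [isEqCode_iff]
    refine ⟨fun h hi hj => (h _ hi hj rfl).trans ?_,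
      fun h c hi hj hc => hc ▸ (h hi hj).trans ?_⟩ <;>
    · simp only [inRel_asg_iff hs hi, inRel_asg_iff hs hj]
      simp
  · refine forall_congr' fun φ => ?_
    simp only [isNegCode_iff]
    exact ⟨fun h hφ => h _ hφ rfl, fun h c hφ hc => hc ▸ h hφ⟩
  · refine forall₂_congr fun φ ψ => ?_
    simp only [isAndCode_iff]
    exact ⟨fun h hφ hψ => h _ hφ hψ rfl, fun h c hφ hψ hc => hc ▸ h hφ hψ⟩
  · refine forall₂_congr fun i φ => ?_
    simp only [isExCode_iff, isAssign_iff]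
    have key : IsNat i → ((∃ a s', a ∊ A ∧ s' ∊ asg A ∧ IsUpdate s' s i a ∧ InRel R φ s') ↔
        ∃ a, a ∊ A ∧ InRel R φ (upd s i a)) := by
      intro hi
      constructor
      · rintro ⟨a, s', ha, hs', h, hR⟩
        exact ⟨a, ha, (isUpdate_iff hs' hs hi ha).1 h ▸ hR⟩
      · rintro ⟨a, ha, hR⟩
        have hs' := upd_mem_asg hs hi ha
        exact ⟨a, _, ha, hs', (isUpdate_iff hs' hs hi ha).2 rfl, hR⟩
    exact ⟨fun h hi hφ => (h _ hi hφ rfl).trans (key hi),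
      fun h c hi hφ hc => hc ▸ (h hi hφ).trans (key hi).symm⟩

theorem IsSatRel.unique {A R R' c : M} (h : IsSatRel A R) (h' : IsSatRel A R')
    (hc : IsFormula c) : ∀ s, s ∊ asg A → (InRel R c s ↔ InRel R' c s) := by
  rw [isSatRel_iff] at h h'
  refine formula_induction (fun c => ∀ s, s ∊ asg A → (InRel R c s ↔ InRel R' c s))
    ?_ ?_ ?_ ?_ ?_ hc
  · intro i j hi hj s hs
    rw [(h s hs).1 i j hi hj, (h' s hs).1 i j hi hj]
  · intro i j hi hj s hs
    rw [(h s hs).2.1 i j hi hj, (h' s hs).2.1 i j hi hj]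
  · intro φ hφ ih s hs
    rw [(h s hs).2.2.1 φ hφ, (h' s hs).2.2.1 φ hφ, ih s hs]
  · intro φ ψ hφ hψ ih ih' s hs
    rw [(h s hs).2.2.2.1 φ ψ hφ hψ, (h' s hs).2.2.2.1 φ ψ hφ hψ, ih s hs, ih' s hs]
  · intro i φ hi hφ ih s hs
    rw [(h s hs).2.2.2.2 i φ hi hφ, (h' s hs).2.2.2.2 i φ hi hφ]
    exact exists_congr fun a => and_congr_right fun ha => ih _ (upd_mem_asg hs hi ha)

end Formulas

section Satisfaction

variable {M : Type u} [S : setLang.Structure M] [Z : ZF M]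

/-- The immediate subformulas of the formula `c`. -/
noncomputable def subformulas (c : M) : M := sep (Form M) fun φ => IsFormula c ∧
  (c = negCode φ ∨ (∃ ψ, c = andCode φ ψ) ∨ (∃ ψ, c = andCode ψ φ) ∨ ∃ i, c = exCode i φ)

section Instances

variable {Γ : Type w} [PCtx Γ M] {a b : Γ → M} [DTerm a] [DTerm b]

instance : DTerm (fun x => memCode (a x) (b x)) := by unfold memCode; infer_instance
instance : DTerm (fun x => eqCode (a x) (b x)) := by unfold eqCode; infer_instance
instance : DTerm (fun x => negCode (a x)) := by unfold negCode; infer_instance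
instance : DTerm (fun x => andCode (a x) (b x)) := by unfold andCode; infer_instance
instance : DTerm (fun x => exCode (a x) (b x)) := by unfold exCode; infer_instance
instance : DTerm (fun x => subformulas (a x)) := by unfold subformulas; infer_instance

end Instances

/-- All sets are covered: those that are not formulas have no immediate subformulas. -/
theorem subformula_induction (P : M → Prop) [DPred P]
    (h : ∀ x, (∀ y, y ∊ subformulas x → P y) → P x) (c : M) : P c := by
  by_cases hc : IsFormula c
  · refine formula_induction P ?_ ?_ ?_ ?_ ?_ hc
    all_goals intros; refine h _ fun y hy => ?_
    all_goals
      obtain ⟨-, -, hy⟩ := mem_sep.1 hy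
      simp [memCode, eqCode, negCode, andCode, exCode, opair_inj, num_inj] at hy
    · subst hy
      assumption
    · rcases hy with rfl | rfl <;> assumption
    · obtain ⟨-, rfl⟩ := hy
      assumption
  · exact h c fun y hy => (hc (mem_sep.1 hy).2.1).elim

/-- The set `T c` of the assignments under which `c` holds is defined by recursion on the
subformulas of `c`. -/
theorem exists_isSatRel (A : M) : ∃ R, IsSatRel A R ∧ IsSub R (prod (Form M) (asg A)) := by
  obtain ⟨T, dT, hT⟩ := exists_rec (M := M) subformulas (fun c f => sep (asg A) fun s =>
    (∃ i j, c = memCode i j ∧ app s i ∊ app s j) ∨ (∃ i j, c = eqCode i j ∧ app s i = app s j) ∨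
    (∃ φ, c = negCode φ ∧ ¬ s ∊ app f φ) ∨
    (∃ φ ψ, c = andCode φ ψ ∧ s ∊ app f φ ∧ s ∊ app f ψ) ∨
    ∃ i φ, c = exCode i φ ∧ ∃ a, a ∊ A ∧ upd s i a ∊ app f φ) subformula_induction
  have key : ∀ {c φ : M}, IsFormula φ → IsFormula c →
      (c = negCode φ ∨ (∃ ψ, c = andCode φ ψ) ∨ (∃ ψ, c = andCode ψ φ) ∨ ∃ i, c = exCode i φ) →
      app (graph (subformulas c) T) φ = T φ := fun hφ hc h =>
    app_graph (mem_sep.2 ⟨mem_Form.2 hφ, hc, h⟩)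
  have hR : ∀ {c s : M}, IsFormula c → s ∊ asg A →
      (InRel (sep (prod (Form M) (asg A)) fun p => ∃ c s, p = opair c s ∧ s ∊ T c) c s ↔
        s ∊ T c) := by
    intro c s hc hs
    rw [inRel_iff, mem_sep, opair_mem_prod, mem_Form]
    constructor
    · rintro ⟨-, c', s', e, h⟩
      obtain ⟨rfl, rfl⟩ := opair_inj.1 e
      exact h
    · exact fun h => ⟨⟨hc, hs⟩, c, s, rfl, h⟩
  refine ⟨sep (prod (Form M) (asg A)) fun p => ∃ c s, p = opair c s ∧ s ∊ T c,
    isSatRel_iff.2 fun s hs => ⟨?_, ?_, ?_, ?_, ?_⟩, fun z hz => (mem_sep.1 hz).1⟩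
  · intro i j hi hj
    rw [hR (isFormula_memCode hi hj) hs, hT _, mem_sep]
    simp [memCode, eqCode, negCode, andCode, exCode, opair_inj, num_inj, hs]
  · intro i j hi hj
    rw [hR (isFormula_eqCode hi hj) hs, hT _, mem_sep]
    simp [memCode, eqCode, negCode, andCode, exCode, opair_inj, num_inj, hs]
  · intro φ hφ
    rw [hR hφ hs, hR hφ.neg hs, hT _, mem_sep,
      ← key hφ hφ.neg (Or.inl rfl)]
    simp [memCode, eqCode, negCode, andCode, exCode, opair_inj, num_inj, hs]
  · intro φ ψ hφ hψ
    rw [hR hφ hs, hR hψ hs, hR (hφ.and hψ) hs, hT _, mem_sep,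
      ← key hφ (hφ.and hψ) (Or.inr (Or.inl ⟨_, rfl⟩)),
      ← key hψ (hφ.and hψ) (Or.inr (Or.inr (Or.inl ⟨_, rfl⟩)))]
    simp [memCode, eqCode, negCode, andCode, exCode, opair_inj, num_inj, hs]
  · intro i φ hi hφ
    have : ∀ a, a ∊ A → (InRel (sep (prod (Form M) (asg A))
        fun p => ∃ c s, p = opair c s ∧ s ∊ T c) φ (upd s i a) ↔ upd s i a ∊ T φ) :=
      fun a ha => hR hφ (upd_mem_asg hs hi ha)
    rw [hR (hφ.ex hi) hs, hT _, mem_sep,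
      exists_congr fun a => and_congr_right fun ha => this a ha,
      ← key hφ (hφ.ex hi) (Or.inr (Or.inr (Or.inr ⟨_, rfl⟩)))]
    simp [memCode, eqCode, negCode, andCode, exCode, opair_inj, num_inj, hs]

/-- The satisfaction relation of the structure `(A, ∈)`, as a set of pairs of a formula and an
assignment. -/
noncomputable def satRel (A : M) : M :=
  the fun R => IsSatRel A R ∧ IsSub R (prod (Form M) (asg A))

theorem satRel_spec (A : M) :
    IsSatRel A (satRel A) ∧ IsSub (satRel A) (prod (Form M) (asg A)) := by
  obtain ⟨R, hR⟩ := exists_isSatRel A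
  refine the_spec (P := fun R => IsSatRel A R ∧ IsSub R (prod (Form M) (asg A)))
    ⟨R, hR, fun R' hR' => ext fun z => ?_⟩
  have h : ∀ {R R' z : M}, IsSatRel A R ∧ IsSub R (prod (Form M) (asg A)) →
      IsSatRel A R' ∧ IsSub R' (prod (Form M) (asg A)) → z ∊ R → z ∊ R' := by
    intro R R' z h h' hz
    obtain ⟨c, s, hc, hs, rfl⟩ := mem_prod.1 (h.2 z hz)
    rw [← inRel_iff] at hz ⊢
    exact (h.1.unique h'.1 (mem_Form.1 hc) s hs).1 hz
  exact ⟨h hR' hR, h hR hR'⟩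

instance {Γ : Type w} [PCtx Γ M] {a : Γ → M} [DTerm a] : DTerm (fun x => satRel (a x)) := by
  unfold satRel; infer_instance

/-- The formula `c` holds in `(A, ∈)` under the assignment `s`. -/
def Holds (A c s : M) : Prop := InRel (satRel A) c s

instance {Γ : Type w} [PCtx Γ M] {a b c : Γ → M} [DTerm a] [DTerm b] [DTerm c] :
    Dfn (fun x => Holds (a x) (b x) (c x)) := by
  unfold Holds; infer_instance

theorem sat_iff {A c s : M} (hc : IsFormula c) (hs : s ∊ asg A) : Sat A c s ↔ Holds A c s :=
  ⟨fun ⟨_, hR, h⟩ => (hR.unique (satRel_spec A).1 hc s hs).1 h,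
    fun h => ⟨_, (satRel_spec A).1, h⟩⟩

section Clauses

variable {A s : M} (hs : s ∊ asg A)

include hs

theorem holds_mem {i j : M} (hi : IsNat i) (hj : IsNat j) :
    Holds A (memCode i j) s ↔ app s i ∊ app s j :=
  (isSatRel_iff.1 (satRel_spec A).1 s hs).1 i j hi hj

theorem holds_eq {i j : M} (hi : IsNat i) (hj : IsNat j) :
    Holds A (eqCode i j) s ↔ app s i = app s j :=
  (isSatRel_iff.1 (satRel_spec A).1 s hs).2.1 i j hi hj

theorem holds_neg {φ : M} (hφ : IsFormula φ) : Holds A (negCode φ) s ↔ ¬ Holds A φ s :=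
  (isSatRel_iff.1 (satRel_spec A).1 s hs).2.2.1 φ hφ

theorem holds_and {φ ψ : M} (hφ : IsFormula φ) (hψ : IsFormula ψ) :
    Holds A (andCode φ ψ) s ↔ Holds A φ s ∧ Holds A ψ s :=
  (isSatRel_iff.1 (satRel_spec A).1 s hs).2.2.2.1 φ ψ hφ hψ

theorem holds_ex {i φ : M} (hi : IsNat i) (hφ : IsFormula φ) :
    Holds A (exCode i φ) s ↔ ∃ a, a ∊ A ∧ Holds A φ (upd s i a) :=
  (isSatRel_iff.1 (satRel_spec A).1 s hs).2.2.2.2 i φ hi hφ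

end Clauses

/-- The truth of a formula depends only on the values of finitely many variables. -/
theorem exists_support (A : M) {c : M} (hc : IsFormula c) : ∃ n, IsNat n ∧
    ∀ s t, s ∊ asg A → t ∊ asg A → (∀ j, j ∊ n → app s j = app t j) →
      (Holds A c s ↔ Holds A c t) := by
  have bound : ∀ {i j : M}, IsNat i → IsNat j → ∃ n, IsNat n ∧ IsSub i n ∧ IsSub j n := by
    intro i j hi hj
    obtain ⟨n, e, -, h, h'⟩ := hi.1.exists_sup hj.1
    exact ⟨n, by rcases e with rfl | rfl <;> assumption, h, h'⟩
  have self : ∀ {i : M}, i ∊ succ i := mem_succ.2 (Or.inr rfl)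
  refine formula_induction (fun c => ∃ n, IsNat n ∧
    ∀ s t, s ∊ asg A → t ∊ asg A → (∀ j, j ∊ n → app s j = app t j) →
      (Holds A c s ↔ Holds A c t)) ?_ ?_ ?_ ?_ ?_ hc
  · intro i j hi hj
    obtain ⟨n, hn, h, h'⟩ := bound hi.succ hj.succ
    refine ⟨n, hn, fun s t hs ht e => ?_⟩
    rw [holds_mem hs hi hj, holds_mem ht hi hj, e i (h i self), e j (h' j self)]
  · intro i j hi hj
    obtain ⟨n, hn, h, h'⟩ := bound hi.succ hj.succ
    refine ⟨n, hn, fun s t hs ht e => ?_⟩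
    rw [holds_eq hs hi hj, holds_eq ht hi hj, e i (h i self), e j (h' j self)]
  · rintro φ hφ ⟨n, hn, h⟩
    refine ⟨n, hn, fun s t hs ht e => ?_⟩
    rw [holds_neg hs hφ, holds_neg ht hφ, h s t hs ht e]
  · rintro φ ψ hφ hψ ⟨n, hn, h⟩ ⟨m, hm, h'⟩
    obtain ⟨k, hk, hnk, hmk⟩ := bound hn hm
    refine ⟨k, hk, fun s t hs ht e => ?_⟩
    rw [holds_and hs hφ hψ, holds_and ht hφ hψ, h s t hs ht fun j hj => e j (hnk j hj),
      h' s t hs ht fun j hj => e j (hmk j hj)]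
  · rintro i φ hi hφ ⟨n, hn, h⟩
    refine ⟨n, hn, fun s t hs ht e => ?_⟩
    rw [holds_ex hs hi hφ, holds_ex ht hi hφ]
    refine exists_congr fun a => and_congr_right fun ha =>
      h _ _ (upd_mem_asg hs hi ha) (upd_mem_asg ht hi ha) fun j hj => ?_
    by_cases hji : j = i
    · subst hji
      rw [app_upd_self hi, app_upd_self hi]
    · rw [app_upd_of_ne (hn.mem hj) hji, app_upd_of_ne (hn.mem hj) hji, e j hj]

/-! ### Elementary submodels -/

/-- The Tarski–Vaught criterion inside the model. -/
theorem elemSub_iff {X A : M} : ElemSub X A ↔ (∃ x, x ∊ X) ∧ IsSub X A ∧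
    ∀ φ i s, IsFormula φ → IsNat i → s ∊ asg X → (∃ a, a ∊ A ∧ Holds A φ (upd s i a)) →
      ∃ a, a ∊ X ∧ Holds A φ (upd s i a) := by
  have e : ElemSub X A ↔ (∃ x, x ∊ X) ∧ IsSub X A ∧
      ∀ φ s, IsFormula φ → s ∊ asg X → (Holds X φ s ↔ Holds A φ s) := by
    refine and_congr_right fun _ => and_congr_right fun hsub => forall₂_congr fun φ s => ?_
    rw [isAssign_iff]
    refine imp_congr_right fun hφ => imp_congr_right fun hs => ?_
    rw [sat_iff hφ hs, sat_iff hφ (asg_mono hsub s hs)]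
  rw [e]
  refine and_congr_right fun _ => and_congr_right fun hsub => ⟨?_, ?_⟩
  · intro h φ i s hφ hi hs ha
    rw [← holds_ex (asg_mono hsub s hs) hi hφ, ← h _ s (hφ.ex hi) hs, holds_ex hs hi hφ] at ha
    obtain ⟨a, ha, hh⟩ := ha
    exact ⟨a, ha, (h φ _ hφ (upd_mem_asg hs hi ha)).1 hh⟩
  · intro tv φ s hφ hs
    revert s
    refine formula_induction (fun φ => ∀ s, s ∊ asg X → (Holds X φ s ↔ Holds A φ s))
      ?_ ?_ ?_ ?_ ?_ hφ
    · intro i j hi hj s hs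
      rw [holds_mem hs hi hj, holds_mem (asg_mono hsub s hs) hi hj]
    · intro i j hi hj s hs
      rw [holds_eq hs hi hj, holds_eq (asg_mono hsub s hs) hi hj]
    · intro φ hφ ih s hs
      rw [holds_neg hs hφ, holds_neg (asg_mono hsub s hs) hφ, ih s hs]
    · intro φ ψ hφ hψ ih ih' s hs
      rw [holds_and hs hφ hψ, holds_and (asg_mono hsub s hs) hφ hψ, ih s hs, ih' s hs]
    · intro i φ hi hφ ih s hs
      rw [holds_ex hs hi hφ, holds_ex (asg_mono hsub s hs) hi hφ]
      constructor
      · rintro ⟨a, ha, h⟩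
        exact ⟨a, hsub a ha, (ih _ (upd_mem_asg hs hi ha)).1 h⟩
      · intro h
        obtain ⟨a, ha, h⟩ := tv φ i s hφ hi hs h
        exact ⟨a, ha, (ih _ (upd_mem_asg hs hi ha)).2 h⟩

end Satisfaction

section Reflection

variable {M : Type u} [S : setLang.Structure M] [Z : ZF M]

/-! ### Reflection of formulas to elementary submodels -/

/-- The elements of the set `A`, as a type. It carries the membership relation of `M`. -/
@[ext] structure Elt (A : M) : Type u where
  /-- The element, as an element of the model. -/
  val : M
  /-- It belongs to `A`. -/
  mem : val ∊ A

instance (A : M) : setLang.Structure (Elt A) where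
  funMap := fun f => nomatch f
  RelMap := fun r => match r with
    | SetRel.mem => fun v => (v 0).1 ∊ (v 1).1

/-- Every external formula has a code inside the model. A free variable `i` becomes the variable
with the number `2 * g i`, and the `j`-th bound variable the one with the number `2 * j + 1`. -/
theorem exists_code {ι : Type} (g : ι → ℕ) {n : ℕ} (φ : setLang.BoundedFormula ι n) :
    ∃ c : M, IsFormula c ∧ ∀ (A s : M), s ∊ asg A → ∀ (v : ι → Elt A) (xs : Fin n → Elt A),
      (∀ i, app s (num M (2 * g i)) = (v i).1) →
      (∀ j : Fin n, app s (num M (2 * j + 1)) = (xs j).1) →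
      (Holds A c s ↔ φ.Realize v xs) := by
  have term : ∀ {n : ℕ} (t : setLang.Term (ι ⊕ Fin n)), ∃ k : ℕ, ∀ (A s : M) (v : ι → Elt A)
      (xs : Fin n → Elt A), (∀ i, app s (num M (2 * g i)) = (v i).1) →
      (∀ j : Fin n, app s (num M (2 * j + 1)) = (xs j).1) →
      app s (num M k) = (t.realize (Sum.elim v xs)).1 := by
    intro n t
    rcases t with (i | j) | f
    · exact ⟨_, fun A s v xs h _ => h i⟩
    · exact ⟨_, fun A s v xs _ h => h j⟩
    · nomatch f
  induction φ with
  | falsum =>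
    refine ⟨_, (isFormula_eqCode (isNat_num 0) (isNat_num 0)).neg, fun A s hs v xs _ _ => ?_⟩
    rw [holds_neg hs (isFormula_eqCode (isNat_num 0) (isNat_num 0)),
      holds_eq hs (isNat_num 0) (isNat_num 0)]
    exact iff_of_false (fun h => h rfl) id
  | equal t₁ t₂ =>
    obtain ⟨k₁, h₁⟩ := term t₁
    obtain ⟨k₂, h₂⟩ := term t₂
    refine ⟨_, isFormula_eqCode (isNat_num k₁) (isNat_num k₂), fun A s hs v xs hv hx => ?_⟩
    rw [holds_eq hs (isNat_num k₁) (isNat_num k₂), h₁ A s v xs hv hx, h₂ A s v xs hv hx]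
    exact Elt.ext_iff.symm
  | rel R ts =>
    obtain ⟨⟩ := R
    obtain ⟨k₁, h₁⟩ := term (ts 0)
    obtain ⟨k₂, h₂⟩ := term (ts 1)
    refine ⟨_, isFormula_memCode (isNat_num k₁) (isNat_num k₂), fun A s hs v xs hv hx => ?_⟩
    rw [holds_mem hs (isNat_num k₁) (isNat_num k₂), h₁ A s v xs hv hx, h₂ A s v xs hv hx]
    exact Iff.rfl
  | imp φ ψ ih₁ ih₂ =>
    obtain ⟨c, hc, h₁⟩ := ih₁
    obtain ⟨d, hd, h₂⟩ := ih₂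
    refine ⟨_, (hc.and hd.neg).neg, fun A s hs v xs hv hx => ?_⟩
    rw [holds_neg hs (hc.and hd.neg), holds_and hs hc hd.neg, holds_neg hs hd,
      h₁ A s hs v xs hv hx, h₂ A s hs v xs hv hx, BoundedFormula.realize_imp]
    tauto
  | @all n φ ih =>
    obtain ⟨c, hc, h⟩ := ih
    have hn := isNat_num (M := M) (2 * n + 1)
    refine ⟨_, (hc.neg.ex hn).neg, fun A s hs v xs hv hx => ?_⟩
    rw [holds_neg hs (hc.neg.ex hn), holds_ex hs hn hc.neg, BoundedFormula.realize_all]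
    have key : ∀ a : Elt A, Holds A c (upd s (num M (2 * n + 1)) a.1) ↔
        φ.Realize v (Fin.snoc xs a) := by
      refine fun a => h A _ (upd_mem_asg hs hn a.2) v _ (fun i => ?_) (fun j => ?_)
      · rw [app_upd_of_ne (isNat_num _) (by rw [Ne, num_inj]; omega), hv]
      · refine Fin.lastCases ?_ (fun j => ?_) j
        · rw [Fin.snoc_last]
          exact app_upd_self hn
        · rw [Fin.snoc_castSucc, ← hx j, app_upd_of_ne (isNat_num _)]
          · rfl
          · have := j.2
            rw [Ne, num_inj, Fin.val_castSucc]
            omega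
    constructor
    · intro hne a
      by_contra ha
      refine hne ⟨a.1, a.2, ?_⟩
      rwa [holds_neg (upd_mem_asg hs hn a.2) hc, key]
    · rintro hall ⟨a, ha, hh⟩
      rw [holds_neg (upd_mem_asg hs hn ha) hc] at hh
      exact hh ((key ⟨a, ha⟩).2 (hall ⟨a, ha⟩))

/-- The environment for formulas without variables and without parameters. -/
structure Pure (M : Type u) : Type u where

instance : Ctx (Pure M) (fun _ => M) := ⟨fun _ => S, ∅⟩

/-- The environments of three variables with values in `M`, without parameters. -/
abbrev Pure₃ (M : Type u) :=
  Ext (fun _ : Ext (fun _ : Ext (fun _ : Pure M => M) => M) => M)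

/-- An elementary submodel `X` of `A` that contains `q` and `t` contains a witness for every
existential statement about `q` and `t` that is true in `A`. -/
theorem ElemSub.reflect {X A : M} (h : ElemSub X A) {R : Elt A → Elt A → Elt A → Prop}
    (hR : Dfn (fun x : Pure₃ (Elt A) => R x.pre.pre.var x.pre.var x.var)) {q t r : Elt A}
    (hq : q.1 ∊ X) (ht : t.1 ∊ X) (hr : R q t r) : ∃ r : Elt A, r.1 ∊ X ∧ R q t r := by
  obtain ⟨ι, fin, φ, f, hf, hφ⟩ := hR.out
  have key : ∀ i, ∃ j : ℕ, j ≤ 2 ∧ ∀ x : Pure₃ (Elt A),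
      f i x = if j = 0 then x.pre.pre.var else if j = 1 then x.pre.var else x.var := by
    intro i
    rcases hf i with e | ⟨_, e | ⟨_, e | ⟨_, ⟨⟩, _⟩, rfl⟩, e'⟩
    · exact ⟨2, le_rfl, fun x => by rw [e]; rfl⟩
    · exact ⟨1, by omega, fun x => by rw [e', e]; rfl⟩
    · exact ⟨0, by omega, fun x => by rw [e', e]; rfl⟩
  choose g hg hgf using key
  obtain ⟨c, hc, hcode⟩ := exists_code (M := M) g φ
  obtain ⟨-, hsub, tv⟩ := elemSub_iff.1 h
  have hconst : graph (omega M) (fun _ => q.1) ∊ asg X := mem_asg.2 (isFun_graph fun _ _ => hq)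
  -- `q`, `t` and the witness are the values of the variables with the numbers 0, 2 and 4
  let s := upd (graph (omega M) fun _ => q.1) (num M 2) t.1
  have hs : s ∊ asg X := upd_mem_asg hconst (isNat_num 2) ht
  have main : ∀ r : Elt A, Holds A c (upd s (num M 4) r.1) ↔ R q t r := by
    intro r
    refine Iff.trans (hcode A _ (upd_mem_asg (asg_mono hsub s hs) (isNat_num 4) r.2)
      (fun i => f i ⟨⟨⟨⟨⟩, q⟩, t⟩, r⟩) default (fun i => ?_) finZeroElim)
        (hφ ⟨⟨⟨⟨⟩, q⟩, t⟩, r⟩).symm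
    rw [hgf]
    obtain h | h | h : g i = 0 ∨ g i = 1 ∨ g i = 2 := by have := hg i; omega
    · rw [h, if_pos rfl, app_upd_of_ne (isNat_num _) (by rw [Ne, num_inj]; omega),
        app_upd_of_ne (isNat_num _) (by rw [Ne, num_inj]; omega),
        app_graph (mem_omega.2 (isNat_num _))]
      rfl
    · rw [h, if_neg one_ne_zero, if_pos rfl,
        app_upd_of_ne (isNat_num _) (by rw [Ne, num_inj]; omega), app_upd_self (isNat_num _)]
      rfl
    · rw [h, if_neg two_ne_zero, if_neg (by omega), app_upd_self (isNat_num _)]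
      rfl
  obtain ⟨a, ha, hh⟩ := tv c _ s hc (isNat_num 4) hs ⟨r.1, r.2, (main r).2 hr⟩
  exact ⟨⟨a, hsub a ha⟩, ha, (main ⟨a, hsub a ha⟩).1 hh⟩

/-! The following notions are absolute for transitive sets. -/

section Absolute

variable {A : M} (hA : IsTransSet A)

include hA

omit Z in
theorem isUPair_elt {a b c : Elt A} : IsUPair c a b ↔ IsUPair c.1 a.1 b.1 := by
  constructor
  · intro h z
    constructor
    · intro hz
      have := (h ⟨z, hA _ c.2 z hz⟩).1 hz
      exact this.imp (congrArg Elt.val) (congrArg Elt.val)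
    · rintro (rfl | rfl)
      exacts [(h a).2 (Or.inl rfl), (h b).2 (Or.inr rfl)]
  · intro h z
    exact (h z.1).trans (or_congr Elt.ext_iff.symm Elt.ext_iff.symm)

omit Z in
theorem isOPair_elt {a b c : Elt A} : IsOPair c a b ↔ IsOPair c.1 a.1 b.1 := by
  simp only [IsOPair, isUPair_elt hA]
  constructor
  · rintro ⟨p, q, h⟩
    exact ⟨p.1, q.1, h⟩
  · rintro ⟨p, q, h⟩
    exact ⟨⟨p, hA _ c.2 _ ((h.2.2 p).2 (Or.inl rfl))⟩,
      ⟨q, hA _ c.2 _ ((h.2.2 q).2 (Or.inr rfl))⟩, h⟩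

omit Z in
theorem inRel_elt {r a b : Elt A} : InRel r a b ↔ InRel r.1 a.1 b.1 := by
  simp only [InRel, isOPair_elt hA]
  constructor
  · rintro ⟨c, h⟩
    exact ⟨c.1, h⟩
  · rintro ⟨c, h⟩
    exact ⟨⟨c, hA _ r.2 _ h.2⟩, h⟩

omit Z in
theorem isSucc_elt {a b : Elt A} : IsSucc b a ↔ IsSucc b.1 a.1 := by
  constructor
  · intro h z
    constructor
    · intro hz
      have := (h ⟨z, hA _ b.2 z hz⟩).1 hz
      exact this.imp id (congrArg Elt.val)
    · rintro (hz | rfl)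
      exacts [(h ⟨z, hA _ a.2 z hz⟩).2 (Or.inl hz), (h a).2 (Or.inr rfl)]
  · intro h z
    exact (h z.1).trans (or_congr Iff.rfl Elt.ext_iff.symm)

end Absolute

/-- The closure properties of an elementary submodel of some `V_l`, where `l` is a limit, that are
used in the sequel. -/
structure BasicClosed (X : M) : Prop where
  /-- Pairs of elements are elements. -/
  opair {a b : M} : a ∊ X → b ∊ X → opair a b ∊ X
  /-- First components of elements are elements. -/
  fst {a b : M} : ZFModel.opair a b ∊ X → a ∊ X
  /-- Second components of elements are elements. -/
  snd {a b : M} : ZFModel.opair a b ∊ X → b ∊ X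
  /-- If `r` and `a` are elements, then there are elements to which `a` is related by `r`, if it is
  related to anything. -/
  rel {r a b : M} : r ∊ X → a ∊ X → InRel r a b → ∃ b, b ∊ X ∧ InRel r a b
  /-- Different elements are separated by an element. -/
  ext {a b : M} : a ∊ X → b ∊ X → (∀ z, z ∊ X → (z ∊ a ↔ z ∊ b)) → a = b
  /-- The natural numbers are elements. -/
  nat {n : M} : IsNat n → n ∊ X

theorem V_transSet {α : M} (hα : IsOrd α) : IsTransSet (V α) := fun _ hz _ hy => V_trans hα hz hy

theorem IsLim.nat_mem {l n : M} (hl : IsLim l) (hn : IsNat n) : n ∊ l :=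
  nat_induction (fun n => n ∊ l) hl.2.1 (fun n _ h => hl.2.2 n h) hn

omit Z in
theorem ElemSub.sub {X A : M} (h : ElemSub X A) : IsSub X A := h.2.1

theorem ElemSub.basicClosed {X l : M} (hl : IsLim l) (h : ElemSub X (V l)) : BasicClosed X := by
  have hA := V_transSet hl.1
  obtain ⟨x₀, hx₀⟩ := h.1
  refine ⟨?_, ?_, ?_, ?_, ?_, ?_⟩
  · intro a b ha hb
    obtain ⟨r, hr, e⟩ := h.reflect (R := fun a b r => IsOPair r a b) inferInstance
      (q := ⟨a, h.sub a ha⟩) (t := ⟨b, h.sub b hb⟩)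
      (r := ⟨_, hl.opair_mem (h.sub a ha) (h.sub b hb)⟩) ha hb
      ((isOPair_elt hA).2 (isOPair_iff.2 rfl))
    have e := isOPair_iff.1 ((isOPair_elt hA).1 e)
    exact e ▸ hr
  · intro a b hab
    have hV := h.sub _ hab
    have ha : a ∊ V l := V_trans hl.1 (V_trans hl.1 hV (mem_upair.2 (Or.inr rfl)))
      (mem_upair.2 (Or.inl rfl))
    have hb : b ∊ V l := V_trans hl.1 (V_trans hl.1 hV (mem_upair.2 (Or.inr rfl)))
      (mem_upair.2 (Or.inr rfl))
    obtain ⟨r, hr, b', e⟩ := h.reflect (R := fun c _ r => ∃ b, IsOPair c r b) inferInstance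
      (q := ⟨_, hV⟩) (t := ⟨_, hV⟩) (r := ⟨a, ha⟩) hab hab
      ⟨⟨b, hb⟩, (isOPair_elt hA).2 (isOPair_iff.2 rfl)⟩
    have e := opair_inj.1 (isOPair_iff.1 ((isOPair_elt hA).1 e))
    exact e.1 ▸ hr
  · intro a b hab
    have hV := h.sub _ hab
    have ha : a ∊ V l := V_trans hl.1 (V_trans hl.1 hV (mem_upair.2 (Or.inr rfl)))
      (mem_upair.2 (Or.inl rfl))
    have hb : b ∊ V l := V_trans hl.1 (V_trans hl.1 hV (mem_upair.2 (Or.inr rfl)))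
      (mem_upair.2 (Or.inr rfl))
    obtain ⟨r, hr, b', e⟩ := h.reflect (R := fun c _ r => ∃ a, IsOPair c a r) inferInstance
      (q := ⟨_, hV⟩) (t := ⟨_, hV⟩) (r := ⟨b, hb⟩) hab hab
      ⟨⟨a, ha⟩, (isOPair_elt hA).2 (isOPair_iff.2 rfl)⟩
    have e := opair_inj.1 (isOPair_iff.1 ((isOPair_elt hA).1 e))
    exact e.2 ▸ hr
  · intro r a b hr ha hrel
    have hV := V_trans hl.1 (h.sub r hr) (inRel_iff.1 hrel)
    have hb : b ∊ V l := V_trans hl.1 (V_trans hl.1 hV (mem_upair.2 (Or.inr rfl)))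
      (mem_upair.2 (Or.inr rfl))
    obtain ⟨b', hb', e⟩ := h.reflect (R := fun r a b => InRel r a b) inferInstance
      (q := ⟨r, h.sub r hr⟩) (t := ⟨a, h.sub a ha⟩) (r := ⟨b, hb⟩) hr ha
      ((inRel_elt hA).2 hrel)
    exact ⟨b'.1, hb', (inRel_elt hA).1 e⟩
  · intro a b ha hb hz
    refine ZFModel.ext fun z => ?_
    by_contra hne
    have hzV : z ∊ V l := by
      by_cases hza : z ∊ a
      · exact V_trans hl.1 (h.sub a ha) hza
      · by_cases hzb : z ∊ b
        · exact V_trans hl.1 (h.sub b hb) hzb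
        · exact (hne (iff_of_false hza hzb)).elim
    obtain ⟨z', hz', e⟩ := h.reflect (R := fun a b z => ¬ (z ∊ a ↔ z ∊ b)) inferInstance
      (q := ⟨a, h.sub a ha⟩) (t := ⟨b, h.sub b hb⟩) (r := ⟨z, hzV⟩) ha hb hne
    exact e (hz _ hz')
  · intro n hn
    refine nat_induction (fun n => n ∊ X) ?_ (fun n hn ih => ?_) hn
    · obtain ⟨r, hr, e⟩ := h.reflect (R := fun _ _ r => IsEmptySet r) inferInstance
        (q := ⟨x₀, h.sub _ hx₀⟩) (t := ⟨x₀, h.sub _ hx₀⟩)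
        (r := ⟨emp M, emp_mem_V hl.1 hl.ne_emp⟩) hx₀ hx₀ (fun z => not_mem_emp z.1)
      have : r.1 = emp M := isEmptySet_iff.1 fun z hz => e ⟨z, hA _ r.2 z hz⟩ hz
      exact this ▸ hr
    · obtain ⟨r, hr, e⟩ := h.reflect (R := fun a _ r => IsSucc r a) inferInstance
        (q := ⟨n, h.sub _ ih⟩) (t := ⟨n, h.sub _ ih⟩)
        (r := ⟨succ n, ord_mem_V hl.1 (hl.2.2 n (hl.nat_mem hn))⟩) ih ih
        ((isSucc_elt hA).2 (isSucc_iff.2 rfl))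
      have e := isSucc_iff.1 ((isSucc_elt hA).1 e)
      exact e ▸ hr

end Reflection

section Closed

variable {M : Type u} [S : setLang.Structure M] [Z : ZF M]

/-! ### Elementary submodels from closure under two relations -/

/-- The graph of the operation that updates assignments in `A`. -/
noncomputable def updRel (A : M) : M :=
  sep (prod (prod (prod (asg A) (omega M)) A) (asg A)) fun z =>
    ∃ s n a, z = opair (opair (opair s n) a) (upd s n a)

/-- The relation of a formula `φ`, a variable `i` and an assignment `s` to the elements `a` of `A`
such that `φ` holds in `A` under the assignment that maps `i` to `a` and otherwise agrees
with `s`. -/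
noncomputable def witnessRel (A : M) : M :=
  sep (prod (prod (prod (Form M) (omega M)) (asg A)) A) fun z =>
    ∃ φ i s a, z = opair (opair (opair φ i) s) a ∧ Holds A φ (upd s i a)

instance {Γ : Type w} [PCtx Γ M] {a : Γ → M} [DTerm a] : DTerm (fun x => updRel (a x)) := by
  unfold updRel; infer_instance
instance {Γ : Type w} [PCtx Γ M] {a : Γ → M} [DTerm a] : DTerm (fun x => witnessRel (a x)) := by
  unfold witnessRel; infer_instance

theorem inRel_updRel {A s n a t : M} : InRel (updRel A) (opair (opair s n) a) t ↔
    s ∊ asg A ∧ IsNat n ∧ a ∊ A ∧ t = upd s n a := by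
  rw [inRel_iff, updRel, mem_sep]
  constructor
  · rintro ⟨h, s', n', a', e⟩
    simp only [opair_inj] at e
    obtain ⟨⟨⟨rfl, rfl⟩, rfl⟩, rfl⟩ := e
    simp only [opair_mem_prod, mem_omega] at h
    exact ⟨h.1.1.1, h.1.1.2, h.1.2, rfl⟩
  · rintro ⟨hs, hn, ha, rfl⟩
    refine ⟨?_, s, n, a, rfl⟩
    simp only [opair_mem_prod, mem_omega]
    exact ⟨⟨⟨hs, hn⟩, ha⟩, upd_mem_asg hs hn ha⟩

theorem inRel_witnessRel {A φ i s a : M} : InRel (witnessRel A) (opair (opair φ i) s) a ↔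
    IsFormula φ ∧ IsNat i ∧ s ∊ asg A ∧ a ∊ A ∧ Holds A φ (upd s i a) := by
  rw [inRel_iff, witnessRel, mem_sep]
  constructor
  · rintro ⟨h, φ', i', s', a', e, hh⟩
    simp only [opair_inj] at e
    obtain ⟨⟨⟨rfl, rfl⟩, rfl⟩, rfl⟩ := e
    simp only [opair_mem_prod, mem_omega, mem_Form] at h
    exact ⟨h.1.1.1, h.1.1.2, h.1.2, h.2, hh⟩
  · rintro ⟨hφ, hi, hs, ha, hh⟩
    refine ⟨?_, φ, i, s, a, rfl, hh⟩
    simp only [opair_mem_prod, mem_omega, mem_Form]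
    exact ⟨⟨⟨hφ, hi⟩, hs⟩, ha⟩

/-- Every element of `X` that is related to something by `r` is related to an element of `X`. -/
def ClosedRel (X r : M) : Prop := ∀ a b, a ∊ X → InRel r a b → ∃ b', b' ∊ X ∧ InRel r a b'

/-- If `X` is closed under pairing and under the relations `updRel A` and `witnessRel A`, then
`X ∩ A` is an elementary submodel of `A`. An assignment in `X ∩ A` need not belong to `X`, but its
finite parts do, and this suffices for the Tarski–Vaught criterion. -/
theorem elemSub_of_closed {X A s₀ x₀ : M} (hpair : ∀ a b, a ∊ X → b ∊ X → opair a b ∊ X)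
    (hnat : ∀ n, IsNat n → n ∊ X) (hU : ClosedRel X (updRel A)) (hT : ClosedRel X (witnessRel A))
    (hs₀ : s₀ ∊ asg A) (hs₀X : s₀ ∊ X) (hx₀ : x₀ ∊ X) (hx₀A : x₀ ∊ A) :
    ElemSub (sep A fun x => x ∊ X) A := by
  have hsub : IsSub (sep A fun x => x ∊ X) A := fun z hz => (mem_sep (P := fun x => x ∊ X).1 hz).1
  have hform : ∀ {φ : M}, IsFormula φ → φ ∊ X := by
    intro φ hφ
    refine formula_induction (fun φ => φ ∊ X) ?_ ?_ ?_ ?_ ?_ hφ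
    · exact fun i j hi hj => hpair _ _ (hnat _ (isNat_num 0)) (hpair _ _ (hnat i hi) (hnat j hj))
    · exact fun i j hi hj => hpair _ _ (hnat _ (isNat_num 1)) (hpair _ _ (hnat i hi) (hnat j hj))
    · exact fun φ _ h => hpair _ _ (hnat _ (isNat_num 2)) h
    · exact fun φ ψ _ _ h h' => hpair _ _ (hnat _ (isNat_num 3)) (hpair _ _ h h')
    · exact fun i φ hi _ h => hpair _ _ (hnat _ (isNat_num 4)) (hpair _ _ (hnat i hi) h)
  refine elemSub_iff.2 ⟨⟨x₀, mem_sep.2 ⟨hx₀A, hx₀⟩⟩, hsub, ?_⟩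
  rintro φ i s hφ hi hs ⟨a₀, ha₀, hh⟩
  have hsA := asg_mono hsub s hs
  have approx : ∀ n, IsNat n → ∃ t, t ∊ X ∧ t ∊ asg A ∧ ∀ j, j ∊ n → app t j = app s j := by
    intro n hn
    refine nat_induction
      (fun n => ∃ t, t ∊ X ∧ t ∊ asg A ∧ ∀ j, j ∊ n → app t j = app s j) ?_ ?_ hn
    · exact ⟨s₀, hs₀X, hs₀, fun j hj => (not_mem_emp j hj).elim⟩
    · rintro n hn ⟨t, htX, ht, h⟩
      obtain ⟨hA, hX⟩ := mem_sep.1 (app_mem_of_asg hs hn)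
      obtain ⟨t', ht', e⟩ := hU _ _ (hpair _ _ (hpair _ _ htX (hnat n hn)) hX)
        (inRel_updRel.2 ⟨ht, hn, hA, rfl⟩)
      obtain ⟨-, -, -, rfl⟩ := inRel_updRel.1 e
      refine ⟨_, ht', upd_mem_asg ht hn hA, fun j hj => ?_⟩
      rcases mem_succ.1 hj with hj | rfl
      · rw [app_upd_of_ne (hn.mem hj) (by rintro rfl; exact mem_irrefl _ hj), h j hj]
      · rw [app_upd_self hn]
  obtain ⟨n, hn, hsupp⟩ := exists_support A hφ
  obtain ⟨t, htX, ht, hagree⟩ := approx n hn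
  have transfer : ∀ a, a ∊ A → (Holds A φ (upd t i a) ↔ Holds A φ (upd s i a)) := by
    refine fun a ha => hsupp _ _ (upd_mem_asg ht hi ha) (upd_mem_asg hsA hi ha) fun j hj => ?_
    by_cases e : j = i
    · subst e
      rw [app_upd_self hi, app_upd_self hi]
    · rw [app_upd_of_ne (hn.mem hj) e, app_upd_of_ne (hn.mem hj) e, hagree j hj]
  obtain ⟨a, haX, h⟩ := hT _ _ (hpair _ _ (hpair _ _ (hform hφ) (hnat i hi)) htX)
    (inRel_witnessRel.2 ⟨hφ, hi, ht, ha₀, (transfer a₀ ha₀).2 hh⟩)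
  obtain ⟨-, -, -, ha, hh⟩ := inRel_witnessRel.1 h
  exact ⟨a, mem_sep.2 ⟨ha, haX⟩, (transfer a ha).1 hh⟩

end Closed

section Collapse

variable {M : Type u} [S : setLang.Structure M] [Z : ZF M]

/-! ### The transitive collapse -/

/-- The collapsing map, as a class function. -/
theorem IsCollapse.exists_map {X Y : M} (h : IsCollapse X Y) : ∃ π : M → M, DFun π ∧
    (∀ x, x ∊ X → π x ∊ Y) ∧ ∀ x, x ∊ X → ∀ z, z ∊ π x ↔ ∃ y, y ∊ X ∧ y ∊ x ∧ z = π y := by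
  obtain ⟨f, hf, -, h⟩ := h
  refine ⟨app f, inferInstance, fun x hx => hf.app_mem hx, fun x hx z => ?_⟩
  rw [h x _ hx (hf.inRel_app hx)]
  refine exists_congr fun y => and_congr_right fun hy => and_congr_right fun _ => ?_
  rw [hf.inRel_iff]
  exact and_iff_right hy

section Map

variable {X : M} {π : M → M} [DFun π]
  (hπ : ∀ x, x ∊ X → ∀ z, z ∊ π x ↔ ∃ y, y ∊ X ∧ y ∊ x ∧ z = π y)

include hπ

/-- The collapsing map is injective, since the submodel is extensional. -/
theorem collapse_inj (hX : BasicClosed X) {x y : M} (hx : x ∊ X) (hy : y ∊ X) (h : π x = π y) :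
    x = y := by
  by_contra hne
  obtain ⟨x, hx, ⟨y, hy, h, hne⟩, hmin⟩ :=
    exists_minimal (fun x => ∃ y, y ∊ X ∧ π x = π y ∧ x ≠ y) hx ⟨y, hy, h, hne⟩
  refine hne (hX.ext hx hy fun z hz => ⟨fun hzx => ?_, fun hzy => ?_⟩)
  · obtain ⟨w, hw, hwy, e⟩ := (hπ y hy _).1 (h ▸ (hπ x hx _).2 ⟨z, hz, hzx, rfl⟩)
    by_contra hzy
    exact hmin z hzx hz ⟨w, hw, e, by rintro rfl; exact hzy hwy⟩
  · obtain ⟨w, hw, hwx, e⟩ := (hπ x hx _).1 (h ▸ (hπ y hy _).2 ⟨z, hz, hzy, rfl⟩)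
    by_contra hzx
    exact hmin w hwx hw ⟨z, hz, e.symm, by rintro rfl; exact hzx hwx⟩

/-- The collapsing map is the identity on every ordinal that is included in the submodel. -/
theorem collapse_ord {α : M} (hα : IsOrd α) (hsub : IsSub α X) {ξ : M} (hξ : ξ ∊ α) : π ξ = ξ := by
  refine ord_induction (fun ξ => ξ ∊ α → π ξ = ξ) (fun ξ _ ih hξ => ?_) (hα.mem hξ) hξ
  refine ext fun z => ?_
  rw [hπ ξ (hsub ξ hξ)]
  constructor
  · rintro ⟨y, -, hy, rfl⟩
    rwa [ih y hy (hα.trans hξ hy)]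
  · intro hz
    exact ⟨z, hsub z (hα.trans hξ hz), hz, (ih z hz (hα.trans hξ hz)).symm⟩

end Map

/-! ### Weakly Löwenheim–Skolem cardinals -/

omit Z in
theorem IsWeaklyLS.isOrd {κ : M} (hκ : IsWeaklyLS κ) : IsOrd κ := hκ.1.1.1

theorem IsWeaklyLS.omega_mem {κ : M} (hκ : IsWeaklyLS κ) : omega M ∊ κ :=
  hκ.1.2 _ (isOmega_iff.2 rfl)

theorem IsWeaklyLS.exists_elemSub {κ γ l x : M} (hκ : IsWeaklyLS κ) (hγ : γ ∊ κ) (hl : IsOrd l)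
    (hs : κ ∊ l) (hx : x ∊ V l) : ∃ X, ElemSub X (V l) ∧ IsSub (V γ) X ∧ x ∊ X ∧
      ∃ Y, IsCollapse X Y ∧ Y ∊ V κ :=
  hκ.2 γ l x _ _ _ hγ hl (hl.1 κ hs) (isV_iff.2 ⟨hκ.isOrd.mem hγ, rfl⟩) (isV_iff.2 ⟨hl, rfl⟩)
    (isV_iff.2 ⟨hκ.isOrd, rfl⟩) hx

/-- There is no partial function from `V_γ × V_γ` onto `κ`, for `γ < κ`: an elementary submodel
containing it would contain all elements of `κ`, and its collapse could not belong to `V_κ`. -/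
theorem IsWeaklyLS.not_onto {κ γ h : M} (hκ : IsWeaklyLS κ) (hγ : γ ∊ κ)
    (hfun : ∀ a ξ ξ', InRel h a ξ → InRel h a ξ' → ξ = ξ') :
    ¬ ∀ ξ, ξ ∊ κ → ∃ a b, a ∊ V γ ∧ b ∊ V γ ∧ InRel h (opair a b) ξ := by
  intro honto
  obtain ⟨l, hl, hκl⟩ := exists_lim hκ.isOrd
  let h' := sep (prod (prod (V γ) (V γ)) κ) fun z => z ∊ h
  have hV : V γ ∊ V l := V_mem hl.1 (hl.1.trans hκl hγ)
  have hh' : h' ∊ V l :=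
    V_sub hl.1 (hl.prod_mem (hl.prod_mem hV hV) (ord_mem_V hl.1 hκl))
      fun z hz => (mem_sep.1 hz).1
  obtain ⟨W, hW, hVW, hhW, Y, hY, hYκ⟩ := hκ.exists_elemSub hγ hl.1 hκl hh'
  have cW := hW.basicClosed hl
  have hκW : IsSub κ W := by
    intro ξ hξ
    obtain ⟨a, b, ha, hb, hr⟩ := honto ξ hξ
    have hr' : InRel h' (opair a b) ξ := inRel_iff.2 (mem_sep.2
      ⟨by simp only [opair_mem_prod]; exact ⟨⟨ha, hb⟩, hξ⟩, inRel_iff.1 hr⟩)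
    obtain ⟨ξ', hξ', e⟩ := cW.rel hhW (cW.opair (hVW a ha) (hVW b hb)) hr'
    rwa [hfun _ _ _ hr (inRel_iff.2 (mem_sep.1 (inRel_iff.1 e)).2)]
  obtain ⟨π, dπ, hπY, hπ⟩ := hY.exists_map
  refine ord_not_mem_V hκ.isOrd (V_sub hκ.isOrd hYκ fun ξ hξ => ?_)
  rw [← collapse_ord hπ hκ.isOrd hκW hξ]
  exact hπY ξ (hκW ξ hξ)

theorem IsWeaklyLS.isLim {κ : M} (hκ : IsWeaklyLS κ) : IsLim κ := by
  have hω := hκ.omega_mem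
  refine ⟨hκ.isOrd, hκ.isOrd.trans hω (mem_omega.2 isNat_emp), fun γ hγ => ?_⟩
  have oγ := hκ.isOrd.mem hγ
  rcases oγ.succ.trichotomy hκ.isOrd with h | h | h
  · exact h
  · -- `κ = γ + 1` is the image of a partial function on `γ × γ`
    exfalso
    have hsub : IsSub (omega M) γ :=
      (isOrd_omega.sub_iff oγ).2 (h ▸ hω)
    have h0 : emp M ∊ γ := hsub _ (mem_omega.2 isNat_emp)
    have h1 : succ (emp M) ∊ γ := hsub _ (mem_omega.2 isNat_emp.succ)
    have hne : succ (emp M) ≠ emp M := by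
      have h : emp M ∊ succ (emp M) := mem_succ.2 (Or.inr rfl)
      intro e
      rw [e] at h
      exact not_mem_emp _ h
    let F : M → M := fun z => the fun y => (z = opair y (emp M)) ∨
      ((¬ ∃ a, z = opair a (emp M)) ∧ y = γ)
    have dF : DFun F := by
      show DFun fun z => the fun y => (z = opair y (emp M)) ∨
        ((¬ ∃ a, z = opair a (emp M)) ∧ y = γ)
      infer_instance
    have hF : ∀ y, F (opair y (emp M)) = y := fun y =>
      the_eq_of_iff fun a => by simp [opair_inj, eq_comm]
    have hF' : F (opair (emp M) (succ (emp M))) = γ :=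
      the_eq_of_iff fun a => by simp [opair_inj, hne]
    refine hκ.not_onto (h := graph (prod (V γ) (V γ)) F) hγ (fun a ξ ξ' h h' => ?_)
      fun ξ hξ => ?_
    · rw [(inRel_graph.1 h).2, (inRel_graph.1 h').2]
    · rw [← h] at hξ
      rcases mem_succ.1 hξ with hξ | rfl
      · exact ⟨ξ, emp M, ord_mem_V oγ hξ, ord_mem_V oγ h0, inRel_graph.2
          ⟨opair_mem_prod.2 ⟨ord_mem_V oγ hξ, ord_mem_V oγ h0⟩, (hF ξ).symm⟩⟩
      · exact ⟨emp M, succ (emp M), ord_mem_V oγ h0, ord_mem_V oγ h1, inRel_graph.2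
          ⟨opair_mem_prod.2 ⟨ord_mem_V oγ h0, ord_mem_V oγ h1⟩, hF'.symm⟩⟩
  · rcases mem_succ.1 h with h | rfl
    exacts [(mem_asymm h hγ).elim, (mem_irrefl _ hγ).elim]

/-- A weak form of the axiom of choice below `κ`: if `g` is a function into `V_l` whose domain
belongs to `V_κ`, then there is another such function whose values contain, for every value of `g`,
a witness for the relation `r`, if there is one in `V_l`. It is the inverse of the collapse of an
elementary submodel that contains `g`, `r` and all elements of the domain of `g`. -/
theorem IsWeaklyLS.exists_witnesses {κ l g d r : M} (hκ : IsWeaklyLS κ) (hl : IsOrd l)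
    (hd : d ∊ V κ) (hg : IsFun g d (V l)) : ∃ h e, e ∊ V κ ∧ IsFun h e (V l) ∧
      ∀ a u v, InRel g a u → InRel r u v → v ∊ V l → ∃ c w, InRel h c w ∧ InRel r u w := by
  obtain ⟨γ, hγ, hdγ⟩ := (mem_V hκ.isOrd).1 hd
  obtain ⟨m, -, om, hlm, hκm⟩ := hl.exists_sup hκ.isOrd
  obtain ⟨θ, hθ, hmθ⟩ := exists_lim om
  have hκθ : κ ∊ θ := by
    rcases mem_succ.1 ((hκ.isOrd.sub_iff om).1 hκm) with h | rfl
    exacts [hθ.1.trans hmθ h, hmθ]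
  have hlθ : l ∊ θ := by
    rcases mem_succ.1 ((hl.sub_iff om).1 hlm) with h | rfl
    exacts [hθ.1.trans hmθ h, hmθ]
  have hU : V l ∊ V θ := V_mem hθ.1 hlθ
  let r' := sep (prod (V l) (V l)) fun z => z ∊ r
  have hr' : r' ∊ V θ := V_sub hθ.1 (hθ.prod_mem hU hU) fun z hz => (mem_sep.1 hz).1
  have hgθ : g ∊ V θ :=
    V_sub hθ.1 (hθ.prod_mem (V_trans hθ.1 (V_mem hθ.1 hκθ) hd) hU) (isFun_sub_prod hg)
  obtain ⟨W, hW, hVW, hxW, Y, hY, hYκ⟩ := hκ.exists_elemSub hγ hθ.1 hκθ (hθ.opair_mem hgθ hr')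
  have cW := hW.basicClosed hθ
  obtain ⟨π, dπ, hπY, hπ⟩ := hY.exists_map
  -- the domain of the inverse of the collapse, restricted to the values in `V_l`
  let e := sep Y fun z => ∃ w, w ∊ W ∧ w ∊ V l ∧ z = π w
  have he : ∀ {w : M}, w ∊ W → w ∊ V l → π w ∊ e := fun hw hwl =>
    mem_sep.2 ⟨hπY _ hw, _, hw, hwl, rfl⟩
  let F : M → M := fun z => the fun w => w ∊ W ∧ z = π w
  have dF : DFun F := by
    show DFun fun z => the fun w => w ∊ W ∧ z = π w
    infer_instance
  have hF : ∀ {w}, w ∊ W → F (π w) = w := fun {w} hw => the_eq_of_iff fun w' =>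
    ⟨fun h => (collapse_inj hπ cW hw h.1 h.2).symm, by rintro rfl; exact ⟨hw, rfl⟩⟩
  refine ⟨graph e F, e, V_sub hκ.isOrd hYκ fun z hz => (mem_sep.1 hz).1,
    isFun_graph fun z hz => ?_, fun a u v hgu hruv hv => ?_⟩
  · obtain ⟨-, w, hw, hwl, rfl⟩ := mem_sep.1 hz
    rwa [hF hw]
  · obtain ⟨had, hul⟩ := hg.mem hgu
    obtain ⟨u', hu', hgu'⟩ := cW.rel (cW.fst hxW) (hVW a (hdγ a had)) hgu
    obtain rfl := (hg.2 a had).unique hgu' hgu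
    have hr : InRel r' u' v :=
      inRel_iff.2 (mem_sep.2 ⟨opair_mem_prod.2 ⟨hul, hv⟩, inRel_iff.1 hruv⟩)
    obtain ⟨w, hw, hrw⟩ := cW.rel (cW.snd hxW) hu' hr
    obtain ⟨h₁, h₂⟩ := mem_sep.1 (inRel_iff.1 hrw)
    exact ⟨π w, w, inRel_graph.2 ⟨he hw (opair_mem_prod.1 h₁).2, (hF hw).symm⟩, inRel_iff.2 h₂⟩

end Collapse

section Successor

variable {M : Type u} [S : setLang.Structure M] [Z : ZF M]

/-! ### Maps onto successor cardinals -/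

theorem isBij_graph {F : M → M} [DFun F] {a b : M} (h : ∀ x, x ∊ a → F x ∊ b)
    (hinj : ∀ x y, x ∊ a → y ∊ a → F x = F y → x = y)
    (hsurj : ∀ y, y ∊ b → ∃ x, x ∊ a ∧ F x = y) : IsBij (graph a F) a b := by
  refine ⟨isFun_graph h, fun y hy => ?_⟩
  obtain ⟨x, hx, rfl⟩ := hsurj y hy
  exact ⟨x, inRel_graph.2 ⟨hx, rfl⟩, fun x' hx' =>
    hinj _ _ (inRel_graph.1 hx').1 hx (inRel_graph.1 hx').2.symm⟩

theorem IsBij.app_inj {f a b x y : M} (h : IsBij f a b) (hx : x ∊ a) (hy : y ∊ a)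
    (e : app f x = app f y) : x = y :=
  (h.2 _ (h.1.app_mem hx)).unique (h.1.inRel_app hx) (e ▸ h.1.inRel_app hy)

theorem IsBij.exists_app_eq {f a b y : M} (h : IsBij f a b) (hy : y ∊ b) :
    ∃ x, x ∊ a ∧ app f x = y :=
  let ⟨x, hx, _⟩ := h.2 y hy
  ⟨x, (h.1.inRel_iff.1 hx).1, (h.1.inRel_iff.1 hx).2.symm⟩

theorem IsBij.symm {f a b : M} (h : IsBij f a b) : ∃ g, IsBij g b a := by
  have key : ∀ y, y ∊ b → (the fun x => InRel f x y) ∊ a ∧ app f (the fun x => InRel f x y) = y :=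
    fun y hy => by
      have := h.1.inRel_iff.1 (the_spec (P := fun x => InRel f x y) (h.2 y hy))
      exact ⟨this.1, this.2.symm⟩
  refine ⟨graph b fun y => the fun x => InRel f x y, isBij_graph (fun y hy => (key y hy).1)
    (fun x y hx hy e => ?_) fun x hx => ⟨app f x, h.1.app_mem hx, ?_⟩⟩
  · rw [← (key x hx).2, e, (key y hy).2]
  · exact h.app_inj (key _ (h.1.app_mem hx)).1 hx (key _ (h.1.app_mem hx)).2

theorem IsBij.trans {f g a b c : M} (h : IsBij f a b) (h' : IsBij g b c) :
    ∃ k, IsBij k a c := by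
  refine ⟨graph a fun x => app g (app f x), isBij_graph
    (fun x hx => h'.1.app_mem (h.1.app_mem hx))
    (fun x y hx hy e => h.app_inj hx hy (h'.app_inj (h.1.app_mem hx) (h.1.app_mem hy) e))
    fun z hz => ?_⟩
  obtain ⟨y, hy, rfl⟩ := h'.exists_app_eq hz
  obtain ⟨x, hx, rfl⟩ := h.exists_app_eq hy
  exact ⟨x, hx, rfl⟩

theorem isBij_id (a : M) : IsBij (graph a fun x => x) a a :=
  isBij_graph (fun _ h => h) (fun _ _ _ _ h => h) fun y hy => ⟨y, hy, rfl⟩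

/-- Every element of `κ⁺` is the image of a subset of `κ` under a bijection, namely of its
cardinality. -/
theorem IsSuccCard.exists_bij {κ p ξ : M} (hp : IsSuccCard p κ) (hκ : IsOrd κ) (hξ : ξ ∊ p) :
    ∃ β e, IsSub β κ ∧ IsBij e β ξ := by
  have oξ := hp.1.1.mem hξ
  obtain ⟨β, oβ, ⟨f, hf⟩, hmin⟩ := exists_least_ord (fun β => ∃ f, IsBij f β ξ) oξ ⟨_, isBij_id ξ⟩
  refine ⟨β, f, ?_, hf⟩
  rcases hκ.mem_or_sub oβ with h | h
  · have hβ : IsCard β := ⟨oβ, fun γ hγ ⟨g, hg⟩ => hmin γ hγ (hg.trans hf)⟩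
    have hpβ := hp.2.2 β hβ h
    rcases oξ.mem_or_sub oβ with h' | h'
    · exact (hmin ξ h' ⟨_, isBij_id ξ⟩).elim
    · exact (mem_irrefl ξ (h' ξ (hpβ ξ hξ))).elim
  · exact h

/-- The order of `p` that first compares the values of `r` and then the arguments is isomorphic to
an ordinal. The isomorphism `G` is defined by `G ζ = {G ζ' | ζ' precedes ζ}`. -/
theorem exists_lex_collapse {p : M} (hp : IsOrd p) (r : M → M) [DFun r]
    (hr : ∀ ζ, ζ ∊ p → IsOrd (r ζ)) : ∃ G : M → M, DFun G ∧ (∀ ζ, ζ ∊ p → IsOrd (G ζ)) ∧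
      (∀ ζ, ζ ∊ p → ∀ z, z ∊ G ζ → ∃ ζ', ζ' ∊ p ∧ IsSub (r ζ') (r ζ) ∧ z = G ζ') ∧
      ∀ ζ ζ', ζ ∊ p → ζ' ∊ p → G ζ = G ζ' → ζ = ζ' := by
  let lt : M → M → Prop := fun x y => r x ∊ r y ∨ (r x = r y ∧ x ∊ y)
  have dlt : DRel lt := by
    show DRel fun x y => r x ∊ r y ∨ (r x = r y ∧ x ∊ y)
    infer_instance
  let pr : M → M := fun y => sep p fun x => y ∊ p ∧ lt x y
  have dpr : DFun pr := by
    show DFun fun y => sep p fun x => y ∊ p ∧ lt x y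
    infer_instance
  have mem_pr : ∀ {x y : M}, x ∊ pr y ↔ x ∊ p ∧ y ∊ p ∧ lt x y := mem_sep
  have ind : ∀ (P : M → Prop) [DPred P], (∀ x, (∀ y, y ∊ pr x → P y) → P x) → ∀ x, P x := by
    intro P _ h x
    by_cases hx : x ∊ p
    · refine ord_induction (fun ρ => ∀ x, x ∊ p → r x = ρ → P x) (fun ρ _ ihρ => ?_) (hr x hx)
        x hx rfl
      intro x hx
      refine ord_induction (fun x => x ∊ p → r x = ρ → P x) (fun x ox ih hx e => ?_)
        (hp.mem hx) hx
      refine h x fun y hy => ?_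
      obtain ⟨hyp, -, hy | ⟨e', hy⟩⟩ := mem_pr.1 hy
      · exact ihρ _ (e ▸ hy) y hyp rfl
      · exact ih y hy hyp (e'.trans e)
    · exact h x fun y hy => (hx (mem_pr.1 hy).2.1).elim
  obtain ⟨G, dG, hG⟩ := exists_rec pr (fun x f => img (pr x) fun y => app f y) fun P _ h => ind P h
  have memG : ∀ {x z : M}, z ∊ G x ↔ ∃ y, y ∊ pr x ∧ z = G y := by
    intro x z
    rw [hG x, mem_img]
    exact exists_congr fun y => and_congr_right fun hy => by rw [app_graph hy]
  have lt_trans : ∀ {x y z : M}, z ∊ p → lt x y → lt y z → lt x z := by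
    rintro x y z hz (h | ⟨e, h⟩) (h' | ⟨e', h'⟩)
    · exact Or.inl ((hr z hz).trans h' h)
    · exact Or.inl (e' ▸ h)
    · exact Or.inl (e ▸ h')
    · exact Or.inr ⟨e.trans e', (hp.mem hz).trans h' h⟩
  have ordG : ∀ x, IsOrd (G x) := by
    refine ind (fun x => IsOrd (G x)) fun x ih => isOrd_of_transitive ?_ ?_
    · intro u hu v hv
      obtain ⟨y, hy, rfl⟩ := memG.1 hu
      obtain ⟨z, hz, rfl⟩ := memG.1 hv
      obtain ⟨hyp, hx, hyx⟩ := mem_pr.1 hy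
      obtain ⟨hzp, -, hzy⟩ := mem_pr.1 hz
      exact memG.2 ⟨z, mem_pr.2 ⟨hzp, hx, lt_trans hx hzy hyx⟩, rfl⟩
    · intro u hu
      obtain ⟨y, hy, rfl⟩ := memG.1 hu
      exact ih y hy
  refine ⟨G, dG, fun x _ => ordG x, fun x hx z hz => ?_, fun x y hx hy e => ?_⟩
  · obtain ⟨y, hy, rfl⟩ := memG.1 hz
    obtain ⟨hyp, -, h⟩ := mem_pr.1 hy
    refine ⟨y, hyp, ?_, rfl⟩
    rcases h with h | ⟨h, -⟩
    · exact (hr x hx).1 _ h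
    · exact h ▸ IsSub.refl _
  · have key : ∀ {x y : M}, x ∊ p → y ∊ p → G x = G y → ¬ lt x y := by
      intro x y hx hy e h
      have := memG.2 ⟨x, mem_pr.2 ⟨hx, hy, h⟩, rfl⟩
      exact mem_irrefl _ (e ▸ this)
    have h₁ := key hx hy e
    have h₂ := key hy hx e.symm
    rcases (hr x hx).trichotomy (hr y hy) with h | h | h
    · exact (h₁ (Or.inl h)).elim
    · rcases (hp.mem hx).trichotomy (hp.mem hy) with h' | h' | h'
      · exact (h₁ (Or.inr ⟨h, h'⟩)).elim
      · exact h'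
      · exact (h₂ (Or.inr ⟨h.symm, h'⟩)).elim
    · exact (h₂ (Or.inl h)).elim

/-- There is no partial function from `N × V_κ` onto `κ⁺`, for `N ∈ V_κ`. Such a function would
write `κ⁺` as the increasing union of `κ` many sets, each an image of some `N × V_i` with `i < κ`.
Ordering `κ⁺` by the first of these sets that an element belongs to, all proper initial segments
would have an order type below `κ` by `IsWeaklyLS.not_onto`, and so `κ⁺` would be equinumerous to an
ordinal that is at most `κ`. -/
theorem IsWeaklyLS.not_onto_succCard {κ p E N : M} (hκ : IsWeaklyLS κ) (hp : IsSuccCard p κ)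
    (hN : N ∊ V κ) (hE : ∀ a ζ ζ', InRel E a ζ → InRel E a ζ' → ζ = ζ') :
    ¬ ∀ ζ, ζ ∊ p → ∃ c a, c ∊ N ∧ a ∊ V κ ∧ InRel E (opair c a) ζ := by
  intro honto
  have oκ := hκ.isOrd
  have op := hp.1.1
  -- `ζ` belongs to the image of `N × V_i`
  let Lev : M → M → Prop := fun ζ i => ∃ c a, c ∊ N ∧ a ∊ V i ∧ InRel E (opair c a) ζ
  have dLev : DRel Lev := by
    show DRel fun ζ i => ∃ c a, c ∊ N ∧ a ∊ V i ∧ InRel E (opair c a) ζ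
    infer_instance
  let Least : M → M → Prop := fun ζ i => IsOrd i ∧ Lev ζ i ∧ ∀ j, j ∊ i → ¬ Lev ζ j
  have dLeast : DRel Least := by
    show DRel fun ζ i => IsOrd i ∧ Lev ζ i ∧ ∀ j, j ∊ i → ¬ Lev ζ j
    infer_instance
  -- the index of the first of these images that `ζ` belongs to
  let r : M → M := fun ζ => the fun i => Least ζ i
  have dr : DFun r := by
    show DFun fun ζ => the fun i => Least ζ i
    infer_instance
  have hr : ∀ ζ, ζ ∊ p → Least ζ (r ζ) ∧ r ζ ∊ κ := by
    intro ζ hζ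
    obtain ⟨c, a, hc, ha, h⟩ := honto ζ hζ
    obtain ⟨γ, hγ, haγ⟩ := (mem_V oκ).1 ha
    have hsκ := hκ.isLim.2.2 γ hγ
    have hs : Lev ζ (succ γ) := ⟨c, a, hc, hκ.isLim.mem_V_succ hγ haγ, h⟩
    obtain ⟨i, oi, hi, hmin⟩ := exists_least_ord (Lev ζ) (oκ.mem hsκ) hs
    have hLeast : Least ζ i := ⟨oi, hi, hmin⟩
    have e : r ζ = i := the_eq_of_iff (P := Least ζ) fun j => by
      refine ⟨fun hj => ?_, fun e => e ▸ hLeast⟩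
      rcases oi.trichotomy hj.1 with h | h | h
      · exact (hj.2.2 i h hi).elim
      · exact h.symm
      · exact (hmin j h hj.2.1).elim
    rw [e]
    refine ⟨hLeast, ?_⟩
    rcases oi.mem_or_sub (oκ.mem hsκ) with h | h
    · exact oκ.trans hsκ h
    · rcases mem_succ.1 (((oκ.mem hsκ).sub_iff oi).1 h) with h | h
      · exact (hmin _ h hs).elim
      · exact h ▸ hsκ
  obtain ⟨G, dG, ordG, memG, injG⟩ := exists_lex_collapse op r fun ζ hζ => (hr ζ hζ).1.1
  obtain ⟨δ, hδ, hNδ⟩ := (mem_V oκ).1 hN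
  have hGκ : ∀ ζ, ζ ∊ p → G ζ ∊ κ := by
    intro ζ hζ
    rcases (ordG ζ hζ).mem_or_sub oκ with h | h
    · exact h
    · -- the predecessors of `ζ` all belong to the image of `N × V_(r ζ)`, which is part of the
      -- image of `V_γ × V_γ`
      exfalso
      obtain ⟨γ, hγ, oγ, h₁, h₂⟩ := (oκ.mem hδ).exists_sup (oκ.mem (hr ζ hζ).2)
      have hγκ : γ ∊ κ := by
        rcases hγ with rfl | rfl
        exacts [hδ, (hr ζ hζ).2]
      have hpre : ∀ ξ, ξ ∊ κ → ∃ a b ζ', a ∊ V γ ∧ b ∊ V γ ∧ InRel E (opair a b) ζ' ∧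
          ξ = G ζ' := by
        intro ξ hξ
        obtain ⟨ζ', hζ', hsub, rfl⟩ := memG ζ hζ ξ (h ξ hξ)
        obtain ⟨c, a, hc, ha, hE⟩ := (hr ζ' hζ').1.2.1
        exact ⟨c, a, ζ', V_mono (oκ.mem hδ) oγ h₁ c (hNδ c hc),
          V_mono (hr ζ' hζ').1.1 oγ (hsub.trans h₂) a ha, hE, rfl⟩
      let Q : M → Prop := fun z => ∃ a ζ', z = opair a (G ζ') ∧ InRel E a ζ'
      have dQ : DPred Q := by
        show DPred fun z => ∃ a ζ', z = opair a (G ζ') ∧ InRel E a ζ'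
        infer_instance
      refine hκ.not_onto (h := sep (prod (prod (V γ) (V γ)) κ) Q) hγκ ?_ fun ξ hξ => ?_
      · intro a ξ ξ' h h'
        obtain ⟨-, a₁, ζ₁, e₁, hE₁⟩ := mem_sep.1 (inRel_iff.1 h)
        obtain ⟨-, a₂, ζ₂, e₂, hE₂⟩ := mem_sep.1 (inRel_iff.1 h')
        obtain ⟨rfl, rfl⟩ := opair_inj.1 e₁
        obtain ⟨rfl, rfl⟩ := opair_inj.1 e₂
        rw [hE _ _ _ hE₁ hE₂]
      · obtain ⟨a, b, ζ', ha, hb, hE, rfl⟩ := hpre ξ hξ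
        refine ⟨a, b, ha, hb, inRel_iff.2 (mem_sep.2 ⟨?_, _, ζ', rfl, hE⟩)⟩
        simp only [opair_mem_prod]
        exact ⟨⟨ha, hb⟩, hξ⟩
  have oρ : IsOrd (img p G) := by
    refine isOrd_of_transitive (fun u hu v hv => ?_) fun u hu => ?_
    · obtain ⟨ζ, hζ, rfl⟩ := mem_img.1 hu
      obtain ⟨ζ', hζ', -, rfl⟩ := memG ζ hζ v hv
      exact mem_img.2 ⟨ζ', hζ', rfl⟩
    · obtain ⟨ζ, hζ, rfl⟩ := mem_img.1 hu
      exact ordG ζ hζ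
  have hρ : img p G ∊ p := by
    have hsub : IsSub (img p G) κ := fun u hu => by
      obtain ⟨ζ, hζ, rfl⟩ := mem_img.1 hu
      exact hGκ ζ hζ
    rcases mem_succ.1 ((oρ.sub_iff oκ).1 hsub) with h | h
    exacts [op.trans hp.2.1 h, h ▸ hp.2.1]
  obtain ⟨g, hg⟩ := (isBij_graph (F := G) (a := p) (b := img p G)
    (fun ζ hζ => mem_img.2 ⟨ζ, hζ, rfl⟩) injG fun y hy => by
      obtain ⟨ζ, hζ, rfl⟩ := mem_img.1 hy
      exact ⟨ζ, hζ, rfl⟩).symm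
  exact hp.1.2 _ hρ ⟨g, hg⟩

end Successor

section Hull

variable {M : Type u} [S : setLang.Structure M] [Z : ZF M]

/-! ### Elementary submodels with a small intersection with the successor cardinal -/

theorem IsLim.pow_mem {l a : M} (hl : IsLim l) (ha : a ∊ V l) : pow a ∊ V l := by
  obtain ⟨γ, hγ, h⟩ := (mem_V hl.1).1 ha
  exact mem_V_of_sub hl.1 (hl.2.2 γ hγ) fun z hz =>
    hl.mem_V_succ hγ ((mem_pow.1 hz).trans h)

/-- The functions into `U` whose domain belongs to `V_κ`. -/
noncomputable def gens (κ U : M) : M :=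
  sep (pow (prod (V κ) U)) fun g => ∃ d, d ∊ V κ ∧ IsFun g d U

instance {Γ : Type w} [PCtx Γ M] {a b : Γ → M} [DTerm a] [DTerm b] :
    DTerm (fun x => gens (a x) (b x)) := by
  unfold gens; infer_instance

theorem mem_gens {κ U g : M} (hκ : IsOrd κ) : g ∊ gens κ U ↔ ∃ d, d ∊ V κ ∧ IsFun g d U := by
  rw [gens, mem_sep, mem_pow]
  refine ⟨fun h => h.2, fun ⟨d, hd, h⟩ => ⟨fun z hz => ?_, d, hd, h⟩⟩
  obtain ⟨x, y, hx, hy, rfl⟩ := mem_prod.1 (isFun_sub_prod h z hz)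
  exact opair_mem_prod.2 ⟨V_trans hκ hd hx, hy⟩

/-- The values of the functions in `Y` whose domain belongs to `V_κ`, as far as they belong to
`U`. -/
noncomputable def hull (Y κ U : M) : M :=
  sep U fun u => ∃ g a, g ∊ Y ∧ g ∊ gens κ U ∧ InRel g a u

theorem mem_hull {Y κ U u : M} (hκ : IsOrd κ) :
    u ∊ hull Y κ U ↔ ∃ g a, g ∊ Y ∧ g ∊ gens κ U ∧ InRel g a u := by
  rw [hull, mem_sep]
  refine ⟨fun h => h.2, fun ⟨g, a, hgY, hg, h⟩ => ⟨?_, g, a, hgY, hg, h⟩⟩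
  obtain ⟨d, -, hf⟩ := (mem_gens hκ).1 hg
  exact (hf.mem h).2

/-- The pairs `⟨g, h⟩` of functions into `U` with domains in `V_κ` such that the values of `h`
contain witnesses for the relation `r`, for all values of `g`. -/
noncomputable def skolemRel (κ U r : M) : M :=
  sep (prod (gens κ U) (gens κ U)) fun z => ∃ g h, z = opair g h ∧
    ∀ a u v, InRel g a u → InRel r u v → v ∊ U → ∃ c w, InRel h c w ∧ InRel r u w

/-- The triples `⟨⟨g, h⟩, k⟩` of functions into `U` with domains in `V_κ` such that all pairs of a
value of `g` and a value of `h` are values of `k`. -/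
noncomputable def pairRel (κ U : M) : M :=
  sep (prod (prod (gens κ U) (gens κ U)) (gens κ U)) fun z => ∃ g h k, z = opair (opair g h) k ∧
    ∀ a u b v, InRel g a u → InRel h b v → ∃ c, InRel k c (opair u v)

/-- The hull is closed under every relation whose Skolem relation belongs to `Y`: functions that
provide witnesses exist by `IsWeaklyLS.exists_witnesses`, and hence exist in `Y`. -/
theorem hull_closedRel {Y κ l r : M} (hκ : IsWeaklyLS κ) (hl : IsOrd l) (hY : BasicClosed Y)
    (hr : skolemRel κ (V l) r ∊ Y) (hU : ∀ u v, InRel r u v → v ∊ V l) :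
    ClosedRel (hull Y κ (V l)) r := by
  intro u v hu huv
  obtain ⟨g, a, hgY, hg, hgu⟩ := (mem_hull hκ.isOrd).1 hu
  obtain ⟨d, hd, hgf⟩ := (mem_gens hκ.isOrd).1 hg
  obtain ⟨h, e, he, hf, hw⟩ := hκ.exists_witnesses (r := r) hl hd hgf
  have hrel : InRel (skolemRel κ (V l) r) g h := inRel_iff.2 (mem_sep.2
    ⟨opair_mem_prod.2 ⟨hg, (mem_gens hκ.isOrd).2 ⟨e, he, hf⟩⟩, g, h, rfl, hw⟩)
  obtain ⟨k, hkY, hk⟩ := hY.rel hr hgY hrel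
  obtain ⟨hk, g', k', e, hw⟩ := mem_sep.1 (inRel_iff.1 hk)
  obtain ⟨rfl, rfl⟩ := opair_inj.1 e
  obtain ⟨c, w, hcw, huw⟩ := hw a u v hgu huv (hU u v huv)
  exact ⟨w, (mem_hull hκ.isOrd).2 ⟨k, c, hkY, (opair_mem_prod.1 hk).2, hcw⟩, huw⟩

/-- The function `k` is the product of `g` and `h`. -/
theorem exists_pairing {κ l g h : M} (hκ : IsLim κ) (hl : IsLim l) (hg : g ∊ gens κ (V l))
    (hh : h ∊ gens κ (V l)) : ∃ k, k ∊ gens κ (V l) ∧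
      ∀ a u b v, InRel g a u → InRel h b v → ∃ c, InRel k c (opair u v) := by
  obtain ⟨d, hd, hg⟩ := (mem_gens hκ.1).1 hg
  obtain ⟨e, he, hh⟩ := (mem_gens hκ.1).1 hh
  let F : M → M := fun z => the fun y => ∃ a b, z = opair a b ∧ y = opair (app g a) (app h b)
  have dF : DFun F := by
    show DFun fun z => the fun y => ∃ a b, z = opair a b ∧ y = opair (app g a) (app h b)
    infer_instance
  have hF : ∀ a b, F (opair a b) = opair (app g a) (app h b) := fun a b =>
    the_eq_of_iff fun y => by simp [opair_inj]
  refine ⟨graph (prod d e) F, (mem_gens hκ.1).2 ⟨_, hκ.prod_mem hd he, isFun_graph fun z hz => ?_⟩,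
    fun a u b v hu hv => ?_⟩
  · obtain ⟨a, b, ha, hb, rfl⟩ := mem_prod.1 hz
    rw [hF]
    exact hl.opair_mem (hg.app_mem ha) (hh.app_mem hb)
  · obtain ⟨ha, rfl⟩ := hg.inRel_iff.1 hu
    obtain ⟨hb, rfl⟩ := hh.inRel_iff.1 hv
    exact ⟨opair a b, inRel_graph.2 ⟨opair_mem_prod.2 ⟨ha, hb⟩, (hF a b).symm⟩⟩

theorem hull_opair {Y κ l u v : M} (hκ : IsLim κ) (hl : IsLim l) (hY : BasicClosed Y)
    (hp : pairRel κ (V l) ∊ Y) (hu : u ∊ hull Y κ (V l)) (hv : v ∊ hull Y κ (V l)) :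
    opair u v ∊ hull Y κ (V l) := by
  obtain ⟨g, a, hgY, hg, hgu⟩ := (mem_hull hκ.1).1 hu
  obtain ⟨h, b, hhY, hh, hhv⟩ := (mem_hull hκ.1).1 hv
  obtain ⟨k, hk, hkp⟩ := exists_pairing hκ hl hg hh
  have hrel : InRel (pairRel κ (V l)) (opair g h) k := inRel_iff.2 (mem_sep.2
    ⟨by simp only [opair_mem_prod]; exact ⟨⟨hg, hh⟩, hk⟩, g, h, k, rfl, hkp⟩)
  obtain ⟨k', hkY, hk'⟩ := hY.rel hp (hY.opair hgY hhY) hrel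
  obtain ⟨hk, g', h', k'', e, hw⟩ := mem_sep.1 (inRel_iff.1 hk')
  obtain ⟨e', rfl⟩ := opair_inj.1 e
  obtain ⟨rfl, rfl⟩ := opair_inj.1 e'
  obtain ⟨c, hc⟩ := hw a u b v hgu hhv
  exact (mem_hull hκ.1).2 ⟨k', c, hkY, (opair_mem_prod.1 hk).2, hc⟩

/-- The function with the only value `c`, defined on the ordinal `1`. -/
noncomputable def constFun (c : M) : M := graph (succ (emp M)) fun _ => c

instance {Γ : Type w} [PCtx Γ M] {a : Γ → M} [DTerm a] : DTerm (fun x => constFun (a x)) := by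
  unfold constFun; infer_instance

theorem constFun_mem_gens {κ U c : M} (hκ : IsLim κ) (hc : c ∊ U) : constFun c ∊ gens κ U :=
  (mem_gens hκ.1).2 ⟨_, ord_mem_V hκ.1 (hκ.2.2 _ hκ.2.1), isFun_graph fun _ _ => hc⟩

theorem mem_hull_of_constFun {Y κ U c : M} (hκ : IsLim κ) (hc : c ∊ U) (h : constFun c ∊ Y) :
    c ∊ hull Y κ U :=
  (mem_hull hκ.1).2 ⟨_, emp M, h, constFun_mem_gens hκ hc,
    inRel_graph.2 ⟨mem_succ.2 (Or.inr rfl), rfl⟩⟩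

/-- The pairs `⟨ξ, e⟩` of an element `ξ` of `p` and a bijection `e` from a subset of `κ` onto
`ξ`. -/
noncomputable def bijRel (κ p U : M) : M :=
  sep (prod p U) fun z => ∃ ξ e β, z = opair ξ e ∧ IsSub β κ ∧ IsBij e β ξ

/-- The graph of the evaluation of functions, restricted to `U`. -/
noncomputable def evalRel (U : M) : M :=
  sep (prod (prod U U) U) fun z => ∃ e ν y, z = opair (opair e ν) y ∧ InRel e ν y

/-- If `κ` is a singular weakly Löwenheim–Skolem cardinal, then every `V_α` has an elementary
submodel that contains a given element and intersects `κ⁺` in an element of `κ⁺`. It is the part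
in `V_α` of the hull of a submodel `Y` whose collapse `N` belongs to `V_κ`. -/
theorem exists_elemSub_inter_mem {κ p α x : M} (hs : IsSingular κ) (hκ : IsWeaklyLS κ)
    (hp : IsSuccCard p κ) (hα : IsOrd α) (hpα : IsSub p α) (hx : x ∊ V α) :
    ∃ X η, ElemSub X (V α) ∧ x ∊ X ∧ η ∊ p ∧ ∀ z, z ∊ η ↔ z ∊ X ∧ z ∊ p := by
  have oκ := hκ.isOrd
  have lκ := hκ.isLim
  have op := hp.1.1
  have hκα : κ ∊ α := hpα κ hp.2.1
  obtain ⟨-, -, β, f, hβ, hf, hcof⟩ := hs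
  -- `V l` contains all objects that the hull speaks about, `V m` all relations among functions
  obtain ⟨l, hl, hαl⟩ := exists_lim hα
  obtain ⟨m, hm, hlm⟩ := exists_lim hl.1
  have hκl : κ ∊ l := hl.1.trans hαl hκα
  have hκm : κ ∊ m := hm.1.trans hlm hκl
  have hAU : V α ∊ V l := V_mem hl.1 hαl
  have hκU : IsSub κ (V l) := fun ξ hξ => ord_mem_V hl.1 (hl.1.trans hκl hξ)
  have hpA : IsSub p (V α) := hpα.trans (ord_sub_V hα)
  have hgens : gens κ (V l) ∊ V m := V_sub hm.1
    (hm.pow_mem (hm.prod_mem (V_mem hm.1 hκm) (V_mem hm.1 hlm))) fun z hz => (mem_sep.1 hz).1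
  have hskolem : ∀ r, skolemRel κ (V l) r ∊ V m := fun r =>
    V_sub hm.1 (hm.prod_mem hgens hgens) fun z hz => (mem_sep.1 hz).1
  have hpair : pairRel κ (V l) ∊ V m :=
    V_sub hm.1 (hm.prod_mem (hm.prod_mem hgens hgens) hgens) fun z hz => (mem_sep.1 hz).1
  have hasg : IsSub (asg (V α)) (V l) := fun s hs =>
    V_sub hl.1 (hl.prod_mem (ord_mem_V hl.1 (hl.1.trans hκl hκ.omega_mem)) hAU)
      (isFun_sub_prod (mem_asg.1 hs))
  have hconst : ∀ c, c ∊ V l → constFun c ∊ V m := fun c hc =>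
    V_trans hm.1 hgens (constFun_mem_gens lκ hc)
  have hβm : β ∊ V m := ord_mem_V hm.1 (hm.1.trans hκm hβ)
  -- families of functions that generate all elements of `κ`
  let J : M := graph β fun η => graph (app f η) fun ξ => ξ
  let K : M := graph β fun η => constFun (app f η)
  have hid : ∀ η, η ∊ β → graph (app f η) (fun ξ => ξ) ∊ gens κ (V l) := fun η hη =>
    (mem_gens oκ).2 ⟨_, ord_mem_V oκ (hf.app_mem hη), isFun_graph fun ξ hξ =>
      hκU ξ (oκ.trans (hf.app_mem hη) hξ)⟩
  have hJ : J ∊ V m := V_sub hm.1 (hm.prod_mem hβm hgens) (isFun_sub_prod (isFun_graph hid))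
  have hK : K ∊ V m := V_sub hm.1 (hm.prod_mem hβm hgens) (isFun_sub_prod
    (isFun_graph fun η hη => constFun_mem_gens lκ (hκU _ (hf.app_mem hη))))
  let s₀ : M := graph (omega M) fun _ => x
  have hs₀ : s₀ ∊ asg (V α) := mem_asg.2 (isFun_graph fun _ _ => hx)
  have hxU : x ∊ V l := V_trans hl.1 hAU hx
  obtain ⟨Y, hY, hβY, hparY, N, hN, hNκ⟩ := hκ.exists_elemSub hβ hm.1 hκm
    (hm.opair_mem (hm.opair_mem (hm.opair_mem hpair hJ)
      (hm.opair_mem hK (hconst _ (hasg _ hs₀))))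
      (hm.opair_mem (hm.opair_mem (hconst x hxU) (hskolem (updRel (V α))))
        (hm.opair_mem (hskolem (witnessRel (V α)))
          (hm.opair_mem (hskolem (bijRel κ p (V l))) (hskolem (evalRel (V l)))))))
  have cY := hY.basicClosed hm
  have h₁ := cY.fst hparY
  have h₂ := cY.snd hparY
  have hpairH : ∀ a b, a ∊ hull Y κ (V l) → b ∊ hull Y κ (V l) → opair a b ∊ hull Y κ (V l) :=
    fun a b => hull_opair lκ hl cY (cY.fst (cY.fst h₁))
  have hupd : ClosedRel (hull Y κ (V l)) (updRel (V α)) :=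
    hull_closedRel hκ hl.1 cY (cY.snd (cY.fst h₂)) fun u v h =>
      hasg v (opair_mem_prod.1 (mem_sep.1 (inRel_iff.1 h)).1).2
  have hwit : ClosedRel (hull Y κ (V l)) (witnessRel (V α)) :=
    hull_closedRel hκ hl.1 cY (cY.fst (cY.snd h₂)) fun u v h =>
      V_trans hl.1 hAU (opair_mem_prod.1 (mem_sep.1 (inRel_iff.1 h)).1).2
  have hbij : ClosedRel (hull Y κ (V l)) (bijRel κ p (V l)) :=
    hull_closedRel hκ hl.1 cY (cY.fst (cY.snd (cY.snd h₂))) fun u v h =>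
      (opair_mem_prod.1 (mem_sep.1 (inRel_iff.1 h)).1).2
  have heval : ClosedRel (hull Y κ (V l)) (evalRel (V l)) :=
    hull_closedRel hκ hl.1 cY (cY.snd (cY.snd (cY.snd h₂))) fun u v h =>
      (opair_mem_prod.1 (mem_sep.1 (inRel_iff.1 h)).1).2
  -- every `ξ < κ` is at most some `f(η)` with `η < β`, and `β` is included in `Y`
  have hκH : IsSub κ (hull Y κ (V l)) := by
    intro ξ hξ
    obtain ⟨η, ζ, hη, hr, hsub⟩ := hcof ξ hξ
    obtain ⟨-, rfl⟩ := hf.inRel_iff.1 hr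
    have hηY : η ∊ Y := hβY η (ord_mem_V (oκ.mem hβ) hη)
    rcases mem_succ.1 (((oκ.mem hξ).sub_iff (oκ.mem (hf.app_mem hη))).1 hsub) with h | rfl
    · obtain ⟨g, hgY, hg⟩ := cY.rel (cY.snd (cY.fst h₁)) hηY (inRel_graph.2 ⟨hη, rfl⟩)
      obtain ⟨-, rfl⟩ := inRel_graph.1 hg
      exact (mem_hull oκ).2 ⟨_, ξ, hgY, hid η hη, inRel_graph.2 ⟨h, rfl⟩⟩
    · obtain ⟨g, hgY, hg⟩ := cY.rel (cY.fst (cY.snd h₁)) hηY (inRel_graph.2 ⟨hη, rfl⟩)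
      obtain ⟨-, rfl⟩ := inRel_graph.1 hg
      exact mem_hull_of_constFun lκ (hκU _ hξ) hgY
  -- `ξ < κ⁺` is the image of a subset of `κ` under some `e'` in the hull, by closure under `bijRel`
  have htrans : ∀ ξ ν, ξ ∊ hull Y κ (V l) → ξ ∊ p → ν ∊ ξ → ν ∊ hull Y κ (V l) := by
    intro ξ ν hξ hξp hν
    obtain ⟨δ, e, hδ, he⟩ := hp.exists_bij oκ hξp
    have hξU : ξ ∊ V l := V_trans hl.1 hAU (hpA ξ hξp)
    have hδU : δ ∊ V l := V_sub hl.1 (ord_mem_V hl.1 hκl) hδ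
    have heU : e ∊ V l := V_sub hl.1 (hl.prod_mem hδU hξU) (isFun_sub_prod he.1)
    obtain ⟨e', heH, he'⟩ := hbij ξ e hξ (inRel_iff.2 (mem_sep.2
      ⟨opair_mem_prod.2 ⟨hξp, heU⟩, ξ, e, δ, rfl, hδ, he⟩))
    obtain ⟨hmem, ξ', e'', δ', eq, hδ', hb⟩ := mem_sep.1 (inRel_iff.1 he')
    obtain ⟨rfl, rfl⟩ := opair_inj.1 eq
    obtain ⟨i, hi, rfl⟩ := hb.exists_app_eq hν
    have hiU := hκU i (hδ' i hi)
    obtain ⟨y, hyH, hy⟩ := heval (opair e' i) (app e' i)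
      (hpairH _ _ heH (hκH i (hδ' i hi))) (inRel_iff.2 (mem_sep.2 ⟨by
        simp only [opair_mem_prod]
        exact ⟨⟨(opair_mem_prod.1 hmem).2, hiU⟩, V_trans hl.1 hξU hν⟩, e', i, _, rfl,
          hb.1.inRel_app hi⟩))
    obtain ⟨-, e₁, i₁, y₁, eq, hy⟩ := mem_sep.1 (inRel_iff.1 hy)
    obtain ⟨eq', rfl⟩ := opair_inj.1 eq
    obtain ⟨rfl, rfl⟩ := opair_inj.1 eq'
    exact (hb.1.inRel_iff.1 hy).2 ▸ hyH
  have hX := elemSub_of_closed hpairH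
    (fun n hn => hκH n (oκ.trans hκ.omega_mem (mem_omega.2 hn))) hupd hwit hs₀
    (mem_hull_of_constFun lκ (hasg _ hs₀) (cY.snd (cY.snd h₁)))
    (mem_hull_of_constFun lκ hxU (cY.fst (cY.fst h₂))) hx
  let η := sep p fun z => z ∊ hull Y κ (V l)
  have mem_η : ∀ z, z ∊ η ↔ z ∊ p ∧ z ∊ hull Y κ (V l) := fun z => mem_sep
  have oη : IsOrd η := isOrd_of_transitive (fun ξ hξ ν hν => by
    rw [mem_η] at hξ ⊢
    exact ⟨op.trans hξ.1 hν, htrans ξ ν hξ.2 hξ.1 hν⟩) fun ξ hξ => op.mem ((mem_η ξ).1 hξ).1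
  have hne : η ≠ p := by
    intro e
    obtain ⟨π, dπ, hπN, hπ⟩ := hN.exists_map
    -- otherwise the values `g(a)` of the functions `g` in `Y` would exhaust `κ⁺`, and the collapse
    -- would turn them into the values of a partial function on `N × V_κ`
    refine hκ.not_onto_succCard (E := sep (prod (prod N (V κ)) p) fun z => ∃ g a ζ,
      z = opair (opair (π g) a) ζ ∧ g ∊ Y ∧ g ∊ gens κ (V l) ∧ InRel g a ζ) hp hNκ ?_ ?_
    · intro a ζ ζ' h h'
      obtain ⟨-, g₁, a₁, ζ₁, e₁, hgY₁, hg₁, hr₁⟩ := mem_sep.1 (inRel_iff.1 h)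
      obtain ⟨-, g₂, a₂, ζ₂, e₂, hgY₂, hg₂, hr₂⟩ := mem_sep.1 (inRel_iff.1 h')
      obtain ⟨rfl, rfl⟩ := opair_inj.1 e₁
      obtain ⟨e₃, rfl⟩ := opair_inj.1 e₂
      obtain ⟨e₄, rfl⟩ := opair_inj.1 e₃
      obtain rfl := collapse_inj hπ cY hgY₁ hgY₂ e₄
      obtain ⟨d, -, hgf⟩ := (mem_gens oκ).1 hg₁
      exact (hgf.2 _ (hgf.mem hr₁).1).unique hr₁ hr₂
    · intro ζ hζ
      obtain ⟨g, a, hgY, hg, hr⟩ := (mem_hull oκ).1 ((mem_η ζ).1 (e ▸ hζ)).2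
      obtain ⟨d, hd, hgf⟩ := (mem_gens oκ).1 hg
      have ha := V_trans oκ hd (hgf.mem hr).1
      refine ⟨π g, a, hπN g hgY, ha, inRel_iff.2 (mem_sep.2 ⟨?_, g, a, ζ, rfl, hgY, hg, hr⟩)⟩
      simp only [opair_mem_prod]
      exact ⟨⟨hπN g hgY, ha⟩, hζ⟩
  refine ⟨_, η, hX, mem_sep.2 ⟨hx, mem_hull_of_constFun lκ hxU (cY.fst (cY.fst h₂))⟩,
    oη.mem_of_sub_of_ne op (fun z hz => ((mem_η z).1 hz).1) hne, fun z => ?_⟩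
  rw [mem_η, mem_sep]
  exact ⟨fun h => ⟨⟨hpA z h.1, h.2⟩, h.1⟩, fun h => ⟨h.2, h.1.2⟩⟩

end Hull

section Filter

variable {M : Type u} [S : setLang.Structure M] [Z : ZF M]

/-! ### The filter of elementary submodels -/

/-- `D` contains all elements of `p` that are the intersection with `p` of an elementary submodel of
`V_α` containing `x`, where `α ≥ p` and `x ∈ V_α`. -/
def Witness (p α x D : M) : Prop :=
  IsOrd α ∧ IsSub p α ∧ x ∊ V α ∧ ∀ η, η ∊ p →
    (∃ X, ElemSub X (V α) ∧ x ∊ X ∧ ∀ z, z ∊ η ↔ z ∊ X ∧ z ∊ p) → η ∊ D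

instance {Γ : Type w} [PCtx Γ M] {a b c d : Γ → M} [DTerm a] [DTerm b] [DTerm c] [DTerm d] :
    Dfn (fun x => Witness (a x) (b x) (c x) (d x)) := by
  unfold Witness; infer_instance

theorem inElemFilter_iff {p D : M} :
    InElemFilter p D ↔ IsSub D p ∧ ∃ α x, Witness p α x D := by
  refine and_congr_right fun _ => ⟨?_, ?_⟩
  · rintro ⟨α, v, x, hα, hp, hv, hx, h⟩
    obtain ⟨-, rfl⟩ := isV_iff.1 hv
    exact ⟨α, x, hα, hp, hx, h⟩
  · rintro ⟨α, x, hα, hp, hx, h⟩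
    exact ⟨α, V α, x, hα, hp, isV_iff.2 ⟨hα, rfl⟩, hx, h⟩

theorem IsLim.asg_mem {l a : M} (hl : IsLim l) (hω : omega M ∊ l) (ha : a ∊ V l) : asg a ∊ V l :=
  V_sub hl.1 (hl.pow_mem (hl.prod_mem (ord_mem_V hl.1 hω) ha)) fun _ hz => (mem_sep.1 hz).1

theorem IsLim.updRel_mem {l a : M} (hl : IsLim l) (hω : omega M ∊ l) (ha : a ∊ V l) :
    updRel a ∊ V l :=
  V_sub hl.1 (hl.prod_mem (hl.prod_mem (hl.prod_mem (hl.asg_mem hω ha) (ord_mem_V hl.1 hω)) ha)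
    (hl.asg_mem hω ha)) fun _ hz => (mem_sep.1 hz).1

theorem IsLim.witnessRel_mem {l a : M} (hl : IsLim l) (hω : omega M ∊ l) (ha : a ∊ V l) :
    witnessRel a ∊ V l :=
  V_sub hl.1 (hl.prod_mem (hl.prod_mem (hl.prod_mem
    (V_sub hl.1 (V_mem hl.1 hω) fun _ hz => (mem_sep.1 hz).1) (ord_mem_V hl.1 hω))
    (hl.asg_mem hω ha)) ha) fun _ hz => (mem_sep.1 hz).1

/-- A single witness for the diagonal intersection of a family of members of the filter. It is a
relation that provides, for every index `ξ`, a witness for `G ξ` together with all that is needed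
to restrict an elementary submodel to the corresponding level of the hierarchy. -/
theorem exists_diagonal_witness {p : M} (hp : IsOrd p) (hω : omega M ∊ p) (G : M → M) [DFun G]
    (hG : ∀ ξ, ξ ∊ p → InElemFilter p (G ξ)) : ∃ l x, IsLim l ∧ p ∊ l ∧ x ∊ V l ∧
      ∀ X η, ElemSub X (V l) → x ∊ X → (∀ z, z ∊ η ↔ z ∊ X ∧ z ∊ p) → η ∊ p →
        ∀ ξ, ξ ∊ η → η ∊ G ξ := by
  let Least : M → M → Prop := fun ξ α => IsOrd α ∧ (∃ x, Witness p α x (G ξ)) ∧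
    ∀ β, β ∊ α → ¬ ∃ x, Witness p β x (G ξ)
  have dLeast : DRel Least := by
    show DRel fun ξ α => IsOrd α ∧ (∃ x, Witness p α x (G ξ)) ∧
      ∀ β, β ∊ α → ¬ ∃ x, Witness p β x (G ξ)
    infer_instance
  -- the least level with a witness; this avoids a choice, and replacement bounds all these levels
  let a : M → M := fun ξ => the fun α => Least ξ α
  have da : DFun a := by
    show DFun fun ξ => the fun α => Least ξ α
    infer_instance
  have ha : ∀ ξ, ξ ∊ p → Least ξ (a ξ) := by
    intro ξ hξ
    obtain ⟨-, α, x, h⟩ := inElemFilter_iff.1 (hG ξ hξ)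
    obtain ⟨β, oβ, hβ, hmin⟩ :=
      exists_least_ord (fun α => ∃ x, Witness p α x (G ξ)) h.1 ⟨x, h⟩
    refine the_spec (P := Least ξ) ⟨β, ⟨oβ, hβ, hmin⟩, fun γ hγ => ?_⟩
    rcases oβ.trichotomy hγ.1 with h | h | h
    · exact (hγ.2.2 β h hβ).elim
    · exact h.symm
    · exact (hmin γ h hγ.2.1).elim
  have oδ : IsOrd (sUnion (img p a)) := isOrd_sUnion fun x hx => by
    obtain ⟨ξ, hξ, rfl⟩ := mem_img.1 hx
    exact (ha ξ hξ).1
  obtain ⟨γ, -, oγ, hpγ, hδγ⟩ := hp.exists_sup oδ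
  obtain ⟨k, hk, hγk⟩ := exists_lim oγ
  obtain ⟨l, hl, hkl⟩ := exists_lim hk.1
  have mem_k : ∀ {α : M}, IsOrd α → IsSub α γ → α ∊ k := by
    intro α hα h
    rcases mem_succ.1 ((hα.sub_iff oγ).1 h) with h | rfl
    exacts [hk.1.trans hγk h, hγk]
  have hpk := mem_k hp hpγ
  have hωk := hk.1.trans hpk hω
  have hak : ∀ ξ, ξ ∊ p → a ξ ∊ k := fun ξ hξ => mem_k (ha ξ hξ).1 fun z hz =>
    hδγ z (mem_sUnion.2 ⟨_, mem_img.2 ⟨ξ, hξ, rfl⟩, hz⟩)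
  -- the relation of `ξ` to the tuples of a witness `x` at a level `α`, an assignment, and the two
  -- relations that `elemSub_of_closed` requires for `V α`
  let Q : M := sep (prod p (V k)) fun z => ∃ ξ x α s,
    z = opair ξ (opair (opair x s) (opair (updRel (V α)) (witnessRel (V α)))) ∧
      s ∊ asg (V α) ∧ Witness p α x (G ξ)
  have hQ : ∀ {ξ w : M}, InRel Q ξ w ↔ (ξ ∊ p ∧ w ∊ V k) ∧ ∃ x α s,
      w = opair (opair x s) (opair (updRel (V α)) (witnessRel (V α))) ∧
        s ∊ asg (V α) ∧ Witness p α x (G ξ) := by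
    intro ξ w
    rw [inRel_iff, mem_sep, opair_mem_prod]
    refine and_congr_right fun _ => ⟨?_, ?_⟩
    · rintro ⟨ξ', x, α, s, e, h⟩
      obtain ⟨rfl, rfl⟩ := opair_inj.1 e
      exact ⟨x, α, s, rfl, h⟩
    · rintro ⟨x, α, s, rfl, h⟩
      exact ⟨ξ, x, α, s, rfl, h⟩
  refine ⟨l, Q, hl, hl.1.trans hkl hpk, V_sub hl.1 (hl.prod_mem
    (ord_mem_V hl.1 (hl.1.trans hkl hpk)) (V_mem hl.1 hkl)) fun z hz => (mem_sep.1 hz).1, ?_⟩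
  intro X η hX hQX hη hηp ξ hξη
  have cX := hX.basicClosed hl
  obtain ⟨hξX, hξp⟩ := (hη ξ).1 hξη
  obtain ⟨oα, ⟨x, hx⟩, -⟩ := ha ξ hξp
  have hVk := V_mem hk.1 (hak ξ hξp)
  have hs : graph (omega M) (fun _ => x) ∊ asg (V (a ξ)) :=
    mem_asg.2 (isFun_graph fun _ _ => hx.2.2.1)
  obtain ⟨w, hwX, hw⟩ := cX.rel hQX hξX (hQ.2 ⟨⟨hξp, hk.opair_mem
    (hk.opair_mem (V_trans hk.1 hVk hx.2.2.1) (V_trans hk.1 (hk.asg_mem hωk hVk) hs))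
    (hk.opair_mem (hk.updRel_mem hωk hVk) (hk.witnessRel_mem hωk hVk))⟩, x, a ξ, _, rfl, hs, hx⟩)
  obtain ⟨-, x, α, s, rfl, hs, oα, hpα, hx, hwit⟩ := hQ.1 hw
  have h₁ := cX.fst hwX
  have h₂ := cX.snd hwX
  have hX' := elemSub_of_closed (fun _ _ => cX.opair) (fun _ => cX.nat)
    (fun _ _ => cX.rel (cX.fst h₂)) (fun _ _ => cX.rel (cX.snd h₂)) hs (cX.snd h₁)
    (cX.fst h₁) hx
  refine hwit η hηp ⟨_, hX', mem_sep.2 ⟨hx, cX.fst h₁⟩, fun z => ?_⟩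
  rw [hη, mem_sep]
  exact ⟨fun h => ⟨⟨ord_sub_V oα z (hpα z h.2), h.1⟩, h.2⟩, fun h => ⟨h.1.2, h.2⟩⟩

/-- Diagonal intersections are in the filter by `exists_diagonal_witness`. So are intersections of
two members, as diagonal intersections of sequences with two values, and the pressing-down property
follows from a diagonal intersection of complements of fibres. Properness is
`exists_elemSub_inter_mem`. -/
theorem exists_isNormalFilter {κ p : M} (hs : IsSingular κ) (hκ : IsWeaklyLS κ)
    (hp : IsSuccCard p κ) : ∃ F : M, (∀ D, D ∊ F ↔ InElemFilter p D) ∧ IsNormalFilter p F := by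
  have op := hp.1.1
  have hω : omega M ∊ p := op.trans hp.2.1 hκ.omega_mem
  have hnat : ∀ {n : M}, IsNat n → n ∊ p := fun hn => op.trans hω (mem_omega.2 hn)
  have hF : ∀ D, D ∊ sep (pow p) (fun D => InElemFilter p D) ↔ InElemFilter p D := fun D => by
    rw [mem_sep, mem_pow]
    exact ⟨fun h => h.2, fun h => ⟨h.1, h⟩⟩
  -- the intersections with `p` contain all natural numbers, in particular the ordinals `0` and `1`
  have diag : ∀ (G : M → M) [DFun G], (∀ ξ, ξ ∊ p → InElemFilter p (G ξ)) → ∀ D, IsSub D p →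
      (∀ η, η ∊ p → (∀ n, IsNat n → n ∊ η) → (∀ ξ, ξ ∊ η → η ∊ G ξ) → η ∊ D) →
      InElemFilter p D := by
    intro G _ hG D hD h
    obtain ⟨l, x, hl, hpl, hx, hX⟩ := exists_diagonal_witness op hω G hG
    refine inElemFilter_iff.2 ⟨hD, l, x, hl.1, hl.1.1 p hpl, hx, ?_⟩
    rintro η hη ⟨X, hXV, hxX, e⟩
    exact h η hη (fun n hn => (e n).2 ⟨(hXV.basicClosed hl).nat hn, hnat hn⟩)
      (hX X η hXV hxX e hη)
  have sup : ∀ D E, InElemFilter p D → IsSub D E → IsSub E p → InElemFilter p E := by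
    intro D E hD hDE hE
    obtain ⟨-, α, x, h₁, h₂, h₃, h⟩ := inElemFilter_iff.1 hD
    exact inElemFilter_iff.2 ⟨hE, α, x, h₁, h₂, h₃, fun η hη hX => hDE η (h η hη hX)⟩
  refine ⟨sep (pow p) fun D => InElemFilter p D, hF, ⟨?_, ?_, ?_, ?_⟩, ?_, ?_, ?_, ?_⟩
  · exact fun D hD => ((hF D).1 hD).1
  · exact (hF p).2 (inElemFilter_iff.2 ⟨IsSub.refl p, p, emp M, op, IsSub.refl p,
      ord_mem_V op (hnat isNat_emp), fun η hη _ => hη⟩)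
  · exact fun D E hD hDE hE => (hF E).2 (sup D E ((hF D).1 hD) hDE hE)
  · -- an ordinal above `1` in the diagonal intersection of the sequence `D, E, E, …` belongs both
    -- to `D` and to `E`
    intro D E C hD hE hC
    rw [hF] at hD hE ⊢
    let G : M → M := fun ξ => the fun y => (ξ = emp M ∧ y = D) ∨ (ξ ≠ emp M ∧ y = E)
    have dG : DFun G := by
      show DFun fun ξ => the fun y => (ξ = emp M ∧ y = D) ∨ (ξ ≠ emp M ∧ y = E)
      infer_instance
    have hG₀ : G (emp M) = D := the_eq_of_iff fun y => by simp
    have hG₁ : ∀ {ξ}, ξ ≠ emp M → G ξ = E := fun h => the_eq_of_iff fun y => by simp [h]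
    have h₁ : succ (emp M) ≠ emp M := by
      have h : emp M ∊ succ (emp M) := mem_succ.2 (Or.inr rfl)
      intro e
      rw [e] at h
      exact not_mem_emp _ h
    refine diag G (fun ξ _ => ?_) C (fun z hz => hD.1 z ((hC z).1 hz).1) fun η _ hn h => ?_
    · by_cases e : ξ = emp M
      · rw [e, hG₀]
        exact hD
      · rw [hG₁ e]
        exact hE
    · exact (hC η).2 ⟨hG₀ ▸ h _ (hn _ isNat_emp), hG₁ h₁ ▸ h _ (hn _ isNat_emp.succ)⟩
  · intro D hD
    obtain ⟨-, α, x, h₁, h₂, h₃, h⟩ := inElemFilter_iff.1 ((hF D).1 hD)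
    obtain ⟨X, η, hX, hxX, hη, e⟩ := exists_elemSub_inter_mem hs hκ hp h₁ h₂ h₃
    exact ⟨η, h η hη ⟨X, hX, hxX, e⟩⟩
  · intro D ξ hD hξ h
    refine (hF D).2 (inElemFilter_iff.2 ⟨hD, p, ξ, op, IsSub.refl p, ord_mem_V op hξ, ?_⟩)
    rintro η hη ⟨X, -, hξX, e⟩
    exact h η hη ((op.mem hη).1 ξ ((e ξ).2 ⟨hξX, hξ⟩))
  · intro G D hG hD
    refine (hF D).2 (diag (app G) (fun ξ hξ => (hF _).1 (hG.app_mem hξ)) D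
      (fun z hz => ((hD z).1 hz).1) fun η hη _ h => (hD η).2 ⟨hη, fun α d hα hd => ?_⟩)
    rw [(hG.inRel_iff.1 hd).2]
    exact h α hα
  · -- if no fibre is positive, then the complements of the fibres belong to the filter, and no
    -- nonempty element of their diagonal intersection belongs to `X`
    intro X f hX hf hreg
    by_contra hcon
    push Not at hcon
    let G : M → M := fun α => sep p fun β => ¬ (β ∊ X ∧ InRel f β α)
    have dG : DFun G := by
      show DFun fun α => sep p fun β => ¬ (β ∊ X ∧ InRel f β α)
      infer_instance
    have mem_G : ∀ {α β}, β ∊ G α ↔ β ∊ p ∧ ¬ (β ∊ X ∧ InRel f β α) := mem_sep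
    have hG : ∀ α, α ∊ p → InElemFilter p (G α) := by
      intro α hα
      obtain ⟨Y, hY, hpos⟩ := hcon α hα
      have hYp : IsSub Y p := fun z hz => hX.1 z ((hY z).1 hz).1
      obtain ⟨C, hC, hYC⟩ : ∃ C, C ∊ sep (pow p) (fun D => InElemFilter p D) ∧
          ∀ z, z ∊ Y → ¬ z ∊ C := by
        by_contra hne
        push Not at hne
        exact hpos ⟨hYp, hne⟩
      rw [hF] at hC
      exact sup C _ hC (fun z hz => mem_G.2 ⟨hC.1 z hz, fun h => hYC z ((hY z).2 h) hz⟩)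
        fun z hz => (mem_G.1 hz).1
    obtain ⟨β, hβX, hβ⟩ := hX.2 _ ((hF (sep p fun β => emp M ∊ β ∧ ∀ α, α ∊ β → β ∊ G α)).2
      (diag G hG _ (fun z hz => (mem_sep.1 hz).1)
        fun η hη hn h => mem_sep.2 ⟨hη, hn _ isNat_emp, h⟩))
    obtain ⟨-, h0, h⟩ := mem_sep.1 hβ
    have hr := hf.inRel_app hβX
    exact (mem_G.1 (h _ (hreg β _ hβX (fun hem => hem _ h0) hr))).2 ⟨hβX, hr⟩

end Filter

section Uniform

/-- The structures for the language of set theory with two distinguished elements. -/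
structure Pointed : Type (u + 1) where
  /-- The universe of the structure. -/
  carrier : Type u
  /-- The membership relation. -/
  str : setLang.Structure carrier
  /-- The first distinguished element. -/
  fst : carrier
  /-- The second distinguished element. -/
  snd : carrier

instance : Ctx Pointed.{u} Pointed.carrier :=
  ⟨Pointed.str, {t | t = Pointed.fst ∨ t = Pointed.snd}⟩

instance : DTerm Pointed.fst.{u} := DTerm.of_mem (Or.inl rfl)
instance : DTerm Pointed.snd.{u} := DTerm.of_mem (Or.inr rfl)

attribute [local instance] Ctx.str in
/-- One formula defines membership in the filter in all structures. -/
theorem exists_formula : ∃ φ : setLang.Formula (Fin 2), ∀ (M : Type u) [setLang.Structure M]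
    (D p : M), InElemFilter p D ↔ φ.Realize ![D, p] := by
  have h : Dfn (fun x : Pointed.{u} => InElemFilter x.snd x.fst) := inferInstance
  obtain ⟨ι, -, φ, t, ht, hφ⟩ := h.out
  have key : ∀ i, ∃ j : Fin 2, ∀ x, t i x = ![x.fst, x.snd] j := by
    intro i
    rcases ht i with e | e
    · exact ⟨0, fun x => congrFun e x⟩
    · exact ⟨1, fun x => congrFun e x⟩
  choose g hg using key
  refine ⟨φ.relabel g, fun M _ D p => ?_⟩
  rw [Formula.realize_relabel]
  refine (hφ ⟨M, inferInstance, D, p⟩).trans (iff_of_eq (congrArg φ.Realize (funext fun i => ?_)))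
  exact hg i _

end Uniform

end ZFModel

/-- There is one formula `φ` of the language of set theory, in two free variables, such that in
every model of ZF, for every singular weakly Löwenheim–Skolem cardinal `κ` with successor cardinal
`p = κ⁺`, the following holds. The family `F` of all `D ⊆ κ⁺` that contain
`{η < κ⁺ | η = X ∩ κ⁺ for some X ≺ V_α with x ∈ X}` for some `α ≥ κ⁺` and `x ∈ V_α` is a set, it is
a normal filter over `κ⁺`, and `φ` defines it from the parameter `κ⁺`. -/
theorem mainTheorem7 :
    ∃ φ : ZFModel.setLang.Formula (Fin 2),
      ∀ (M : Type*) [ZFModel.setLang.Structure M], ZFModel.IsModelZF M →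
        ∀ κ p : M, ZFModel.IsSingular κ → ZFModel.IsWeaklyLS κ → ZFModel.IsSuccCard p κ →
          ∃ F : M, (∀ D : M, ZFModel.Mem D F ↔ ZFModel.InElemFilter p D) ∧
            ZFModel.IsNormalFilter p F ∧
            ∀ D : M, ZFModel.Mem D F ↔ φ.Realize ![D, p] := by
  obtain ⟨φ, hφ⟩ := ZFModel.exists_formula
  refine ⟨φ, fun M _ hM κ p hs hκ hp => ?_⟩
  have : ZFModel.ZF M := ⟨hM⟩
  obtain ⟨F, hF, hN⟩ := ZFModel.exists_isNormalFilter hs hκ hp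
  exact ⟨F, hF, hN, fun D => (hF D).trans (hφ M D p)⟩
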